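/- A rooted planar map is a connected graph (loops and multiple edges allowed) with at least one edge, embedded cellularly in the oriented sphere, considered up to orientation-preserving homeomorphism, with one distinguished half-edge. Equivalently, it is a triple $(\sigma,\alpha,r)$, up to simultaneous relabelling, where $\sigma,\alpha$ are permutations of a set of $2m\ge 2$ half-edges generating a transitive group, $\alpha$ is an involution without fixed point, the numbers of cycles satisfy $c(\sigma)-c(\alpha)+c(\sigma\circ\alpha)=2$, and $r$ is a half-edge; its $m$ edges are the cycles of $\alpha$, its vertices are the cycles of $\sigma$, and the degree of a vertex is the length of the cycle. Let $E^{(0)}$ be the generating function of rooted planar maps with a weight $t$ per edge and, for all $n\ge 1$, a weight $v_n$ per vertex of degree $n$, a formal power series in $t$ and $(v_n)_{n\ge1}$. Theorem. There is exactly one pair $(R,S)$ of formal power series in $t$ and $(v_n)_{n\ge 1}$ with rational coefficients such that $$R = t + t \sum_{n=1}^{\infty} v_n \sum_{j=1}^{\lfloor n/2 \rfloor} \frac{(n-1)!}{j!\,(j-1)!\,(n-2j)!}\, R^j S^{n-2j},$$ $$S = t \sum_{n=1}^{\infty} v_n \sum_{j=0}^{\lfloor (n-1)/2 \rfloor} \frac{(n-1)!}{(j!)^2\,(n-2j-1)!}\,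 R^j S^{n-2j-1}.$$ Moreover $R$ and $S$ vanish at $t=0$, and $$E^{(0)} = \frac{1}{t}\left( R + S^2 - \sum_{n=1}^{\infty} v_n \sum_{j=2}^{\lfloor (n+2)/2 \rfloor} \frac{(2n-3j+2)\,(n-1)!}{j!\,(j-2)!\,(n-2j+2)!}\, R^j S^{n-2j+2} - t \right).$$ -/

import Mathlib

/-! Rooted planar maps, coded by pairs of permutations of the half-edges, and their generating
function as a formal power series in `t` and `v₁, v₂, …`. -/

namespace PlanarCensus

/-- The cycles of a permutation, fixed points included. -/
abbrev Cycles {H : Type} (σ : Equiv.Perm H) : Type := Quotient (Equiv.Perm.SameCycle.setoid σ)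

/-- The length of a cycle: the number of elements of `H` on it. -/
noncomputable def cycleLength {H : Type} {σ : Equiv.Perm H} (c : Cycles σ) : ℕ :=
  Nat.card {i : H // (Quotient.mk _ i : Cycles σ) = c}

/-- The number `c(σ)` of cycles of a permutation, fixed points included. -/
noncomputable def numCycles {H : Type} (σ : Equiv.Perm H) : ℕ := Nat.card (Cycles σ)

/-- A planar map with `m` edges, with half-edges labelled by `Fin (2 * m)` and one distinguished
half-edge. The permutation `α` sends a half-edge to the other half of its edge, and `σ` sends a
half-edge to the next one around its vertex. Vertices, edges and faces are the cycles
of `σ`, `α` and `σ ∘ α`. -/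
structure LabelledRootedPlanarMap (m : ℕ) where
  σ : Equiv.Perm (Fin (2 * m))
  α : Equiv.Perm (Fin (2 * m))
  involutive : ∀ i, α (α i) = i
  fixedPointFree : ∀ i, α i ≠ i
  transitive : MulAction.IsPretransitive (Subgroup.closure {σ, α}) (Fin (2 * m))
  /-- Genus `0`: the Euler characteristic is `2`. -/
  planar : (numCycles σ : ℤ) - (numCycles α : ℤ) + (numCycles (σ * α) : ℤ) = 2
  root : Fin (2 * m)

/-- Two labelled rooted maps are identified when they differ by a relabelling of the half-edges
that preserves the root. -/
def LabelledRootedPlanarMap.relabelling (m : ℕ) : Setoid (LabelledRootedPlanarMap m) where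
  r M M' := ∃ ρ : Equiv.Perm (Fin (2 * m)),
    M'.σ = ρ * M.σ * ρ⁻¹ ∧ M'.α = ρ * M.α * ρ⁻¹ ∧ M'.root = ρ M.root
  iseqv :=
    { refl := fun M => ⟨1, by simp, by simp, by simp⟩
      symm := by
        rintro M M' ⟨ρ, h1, h2, h3⟩
        refine ⟨ρ⁻¹, ?_, ?_, ?_⟩
        · rw [h1]; group
        · rw [h2]; group
        · rw [h3]; simp
      trans := by
        rintro M M' M'' ⟨ρ, h1, h2, h3⟩ ⟨ρ', h1', h2', h3'⟩
        refine ⟨ρ' * ρ, ?_, ?_, ?_⟩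
        · rw [h1', h1]; group
        · rw [h2', h2]; group
        · rw [h3', h3]; rfl }

/-- Rooted planar maps with `m` edges. -/
def RootedPlanarMap (m : ℕ) : Type := Quotient (LabelledRootedPlanarMap.relabelling m)

/-- The number of cycles of length `n`. -/
noncomputable def numCyclesOfLength {H : Type} (σ : Equiv.Perm H) (n : ℕ) : ℕ :=
  Nat.card {c : Cycles σ // cycleLength c = n}

theorem numCyclesOfLength_conj {H : Type} (σ ρ : Equiv.Perm H) (n : ℕ) :
    numCyclesOfLength (ρ * σ * ρ⁻¹) n = numCyclesOfLength σ n := by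
  have key : ∀ a b : H, Equiv.Perm.SameCycle σ a b ↔
      Equiv.Perm.SameCycle (ρ * σ * ρ⁻¹) (ρ a) (ρ b) := by
    intro a b
    rw [Equiv.Perm.sameCycle_conj]
    simp
  let e : Cycles σ ≃ Cycles (ρ * σ * ρ⁻¹) := Quotient.congr ρ key
  symm
  refine Nat.card_congr (e.subtypeEquiv ?_)
  intro c
  have : cycleLength (e c) = cycleLength c := by
    symm
    refine Nat.card_congr (ρ.subtypeEquiv ?_)
    intro i
    rw [← e.injective.eq_iff]
    rfl
  rw [this]

/-- The number of vertices of degree `n` of a rooted planar map. -/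
noncomputable def RootedPlanarMap.numVertices {m : ℕ} (M : RootedPlanarMap m) (n : ℕ) : ℕ :=
  Quotient.lift (s := LabelledRootedPlanarMap.relabelling m)
    (fun M : LabelledRootedPlanarMap m => numCyclesOfLength M.σ n)
    (by
      rintro M M' ⟨ρ, h, -, -⟩
      rw [h, numCyclesOfLength_conj]) M

instance (m : ℕ) : Finite (RootedPlanarMap m) := by
  have : Finite (LabelledRootedPlanarMap m) := by
    refine Finite.of_injective
      (fun M : LabelledRootedPlanarMap m => (M.σ, M.α, M.root)) ?_
    rintro ⟨⟩ ⟨⟩ h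
    simp only [Prod.mk.injEq] at h
    obtain ⟨rfl, rfl, rfl⟩ := h
    rfl
  exact Quotient.finite _

/-- Formal power series in the variables `t` (index `none`) and `vₙ`, `n ≥ 1`
(index `some n`). -/
abbrev Series : Type := MvPowerSeries (Option ℕ+) ℚ

/-- The variable `t`. -/
noncomputable def t : Series := MvPowerSeries.X none

/-- The variable `vₙ`. -/
noncomputable def v (n : ℕ+) : Series := MvPowerSeries.X (some n)

/-- The formal series `∑_{n ≥ 1} vₙ Aₙ`, computed coefficientwise. -/
noncomputable def vSum (A : ℕ+ → Series) : Series :=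
  fun d => ∑ᶠ n : ℕ+, MvPowerSeries.coeff d (v n * A n)

/-- Each coefficient of `∑_{n ≥ 1} vₙ Aₙ` is a finite sum. -/
theorem vSum_finite (A : ℕ+ → Series) (d : Option ℕ+ →₀ ℕ) :
    (Function.support fun n : ℕ+ => MvPowerSeries.coeff d (v n * A n)).Finite := by
  classical
  refine Set.Finite.subset
    (d.support.finite_toSet.preimage (Option.some_injective ℕ+).injOn) ?_
  intro n hn
  by_contra h
  apply hn
  have h0 : d (some n) = 0 := by simpa using h
  change MvPowerSeries.coeff d (MvPowerSeries.X (some n) * A n) = 0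
  rw [MvPowerSeries.X, MvPowerSeries.coeff_monomial_mul, if_neg]
  intro hle
  have := hle (some n)
  simp [h0] at this

/-- The generating function `E⁽⁰⁾` of rooted planar maps: the coefficient of
`t ^ m * ∏ vₙ ^ kₙ` is the number of rooted planar maps with `m` edges and, for all `n ≥ 1`,
`kₙ` vertices of degree `n`. -/
noncomputable def E₀ : Series := fun d =>
  (Nat.card {M : RootedPlanarMap (d none) // ∀ n : ℕ+, M.numVertices n = d (some n)} : ℚ)

/-- A rational constant as a formal power series. -/
noncomputable abbrev const (q : ℚ) : Series := MvPowerSeries.C q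

open scoped Nat in
/-- The pair of equations that determines `R` and `S`. -/
def IsSolution (R S : Series) : Prop :=
  R = t + t * vSum (fun n => ∑ j ∈ Finset.Icc 1 ((n : ℕ) / 2),
      const ((((n : ℕ) - 1)! : ℚ) / ((j ! : ℚ) * ((j - 1)! : ℚ) * (((n : ℕ) - 2 * j)! : ℚ)))
        * R ^ j * S ^ ((n : ℕ) - 2 * j)) ∧
  S = t * vSum (fun n => ∑ j ∈ Finset.Icc 0 (((n : ℕ) - 1) / 2),
      const ((((n : ℕ) - 1)! : ℚ) / ((j ! : ℚ) ^ 2 * (((n : ℕ) - 2 * j - 1)! : ℚ)))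
        * R ^ j * S ^ ((n : ℕ) - 2 * j - 1))

/-- A formal power series vanishes at `t = 0`: it has no monomial without `t`. -/
def VanishesAtZero (F : Series) : Prop :=
  ∀ d : Option ℕ+ →₀ ℕ, d none = 0 → MvPowerSeries.coeff d F = 0

end PlanarCensus

/-! The proof derives Tutte's recursion for planar maps with a leg, solves it explicitly in terms of
`R` and `S`, and identifies the solution by working modulo powers of `t`.

Recursion. A leg is a half-edge that belongs to no edge. Let `W l` be the series of planar maps with
one leg on an unweighted vertex of degree `l`, leg included. When the vertex carries another
half-edge, the one following the leg serves as root, and its edge is contracted. Contraction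
multiplies both permutations by the transposition of the two ends, so it leaves the faces unchanged
and marks the two corners with legs. A root edge that is not a loop leaves a connected planar map,
with weight `a n` for the lost end of degree `n`. A loop leaves two planar maps with one leg each:
`euler_inequality` forces exactly two components, both of genus zero. This is
`connectedPlanar_mul_swap_iff`, `rootEdgeSum_eq` and `sum_loop`, and gives, for `k ≥ 1`, `W (k+1) =
t ∑ a n W (k+n-1) + t ∑ W i W j` over `i + j = k`, with `W 0 = 0` and `W 1 = 1`. `mapCount` is the
coefficientwise form. Counting is done with labelled half-edges, where choosing the labels of each
component gives binomial coefficients; the factor `(2m)!` is removed at the end because a rooted map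
has no nontrivial automorphism (`card_labelled`). Weights are put on half-edges, `b n` for each one
on a vertex of degree `n`, so that `a n = b n ^ n`; `coeff_scale_aeval` undoes the powers. The
recursion for `W 3` shows that `t * E₀ = W 3 - t`.

Solution. Let `y` be the power series with `1/X = 1/y + S + R y`, and put `p = 1/y`, `q = R y`, so
`p q = R`. The Laurent polynomial `1/X - t ∑ a n X^(1-n)` is symmetric in `p` and `q`, with
coefficients given by `pathCount`. The equations for `S` and `R` say that its constant term vanishes
and that its linear term in `q` is `t y`. It is therefore `u + u'` with `u` a polynomial in `q`,
`u'` the same polynomial in `p`, and `u = t w` for `w` the `resolvent`. The product `u u'` is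
symmetric in `p` and `q`, hence a polynomial in `p + q` and `p q`, that is in `1/X`, and has no
positive power of `X`. Expanding `u (u + u' - u)` and reading off positive powers yields exactly the
recursion (`coeff_resolvent`). Each use of the recursion gains a factor `t`, so it determines its
solution (`dvd_resolvent_sub`), and `coeff_resolvent_three` is the closed formula.

The infinite sums over `n` are handled by setting `v n = 0` for large `n`, which does not affect a
given coefficient. Existence and uniqueness of `(R, S)` come from a contraction for the `t`-adic
topology (`existsUnique_fixedPoint`). -/

namespace PlanarCensus

open Equiv

/-! ### Counting classes, and merging two of them. -/

section Setoid

variable {X Y : Type}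

/-- The number of classes of a setoid. -/
noncomputable def numClasses (s : Setoid X) : ℕ := Nat.card (Quotient s)

/-- The setoid obtained from `s` by merging the classes of `x` and `y`. -/
def glue (s : Setoid X) (x y : X) : Setoid X where
  r a b := s a b ∨ (s a x ∧ s y b) ∨ (s a y ∧ s x b)
  iseqv :=
    { refl := fun a => Or.inl (s.refl' a)
      symm := by
        rintro a b (h | ⟨h, h'⟩ | ⟨h, h'⟩)
        · exact Or.inl (s.symm' h)
        · exact Or.inr (Or.inr ⟨s.symm' h', s.symm' h⟩)
        · exact Or.inr (Or.inl ⟨s.symm' h', s.symm' h⟩)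
      trans := by
        rintro a b c (h | ⟨h, h'⟩ | ⟨h, h'⟩) (k | ⟨k, k'⟩ | ⟨k, k'⟩)
        · exact Or.inl (s.trans' h k)
        · exact Or.inr (Or.inl ⟨s.trans' h k, k'⟩)
        · exact Or.inr (Or.inr ⟨s.trans' h k, k'⟩)
        · exact Or.inr (Or.inl ⟨h, s.trans' h' k⟩)
        · exact Or.inr (Or.inl ⟨h, k'⟩)
        · exact Or.inl (s.trans' h k')
        · exact Or.inr (Or.inr ⟨h, s.trans' h' k⟩)
        · exact Or.inl (s.trans' h k')
        · exact Or.inr (Or.inr ⟨h, k'⟩) }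

theorem le_glue (s : Setoid X) (x y : X) : s ≤ glue s x y := fun _ _ h => Or.inl h

theorem glue_rel (s : Setoid X) (x y : X) : glue s x y x y :=
  Or.inr (Or.inl ⟨s.refl' x, s.refl' y⟩)

theorem glue_le_iff {s u : Setoid X} {x y : X} : glue s x y ≤ u ↔ s ≤ u ∧ u x y := by
  constructor
  · exact fun h => ⟨(le_glue s x y).trans h, h (glue_rel s x y)⟩
  · rintro ⟨h, hxy⟩ a b (k | ⟨k, k'⟩ | ⟨k, k'⟩)
    · exact h k
    · exact u.trans' (h k) (u.trans' hxy (h k'))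
    · exact u.trans' (h k) (u.trans' (u.symm' hxy) (h k'))

theorem glue_eq_self {s : Setoid X} {x y : X} (h : s x y) : glue s x y = s :=
  le_antisymm (glue_le_iff.2 ⟨le_rfl, h⟩) (le_glue s x y)

theorem glue_sup (s u : Setoid X) (x y : X) : glue s x y ⊔ u = glue (s ⊔ u) x y := by
  apply le_antisymm
  · refine sup_le (glue_le_iff.2 ⟨le_sup_left.trans (le_glue _ _ _), glue_rel _ _ _⟩)
      (le_sup_right.trans (le_glue _ _ _))
  · refine glue_le_iff.2 ⟨sup_le_sup_right (le_glue _ _ _) _, ?_⟩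
    exact (le_sup_left : glue s x y ≤ _) (glue_rel s x y)

/-- The classes other than that of `y` biject with the merged classes, the class of `x` standing for
the union. -/
theorem numClasses_glue [Finite X] {s : Setoid X} {x y : X} (h : ¬ s x y) :
    numClasses (glue s x y) + 1 = numClasses s := by
  classical
  have : Finite (Quotient s) := Quotient.finite _
  have : Fintype (Quotient s) := Fintype.ofFinite _
  let f : {c : Quotient s // c ≠ Quotient.mk s y} → Quotient (glue s x y) :=
    fun c => Setoid.map_of_le (le_glue s x y) c.1
  have hf : Function.Bijective f := by
    constructor
    · rintro ⟨⟨a⟩, ha⟩ ⟨⟨b⟩, hb⟩ hab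
      have ha' : ¬ s a y := fun k => ha (Quotient.sound k)
      have hb' : ¬ s b y := fun k => hb (Quotient.sound k)
      have hab' : glue s x y a b := Quotient.exact hab
      rcases hab' with k | ⟨-, k⟩ | ⟨k, -⟩
      · exact Subtype.ext (Quotient.sound k)
      · exact (hb' (s.symm' k)).elim
      · exact (ha' k).elim
    · rintro ⟨a⟩
      by_cases ha : s a y
      · refine ⟨⟨Quotient.mk s x, fun k => h (Quotient.exact k)⟩, Quotient.sound ?_⟩
        exact Or.inr (Or.inl ⟨s.refl' x, s.symm' ha⟩)
      · exact ⟨⟨Quotient.mk s a, fun k => ha (Quotient.exact k)⟩, rfl⟩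
  have h1 : numClasses (glue s x y) = Nat.card {c : Quotient s // c ≠ Quotient.mk s y} :=
    (Nat.card_congr (Equiv.ofBijective f hf)).symm
  have h2 : 0 < Fintype.card (Quotient s) := Fintype.card_pos_iff.2 ⟨Quotient.mk s y⟩
  rw [h1, numClasses, Nat.card_eq_fintype_card, Nat.card_eq_fintype_card,
    Fintype.card_subtype_compl, Fintype.card_subtype_eq]
  omega

theorem numClasses_comap {s : Setoid Y} {f : X → Y} (hf : Function.Surjective f) :
    numClasses (Setoid.comap f s) = numClasses s := by
  refine Nat.card_congr ((Setoid.comapQuotientEquiv f s).trans ?_)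
  have : Set.range (@Quotient.mk'' _ s ∘ f) = Set.univ := by
    rw [Set.range_eq_univ]
    exact Quotient.mk''_surjective.comp hf
  rw [this]
  exact Equiv.Set.univ _

theorem numClasses_le_one_iff [Finite X] {s : Setoid X} : numClasses s ≤ 1 ↔ s = ⊤ := by
  rw [numClasses, Finite.card_le_one_iff_subsingleton, Quotient.subsingleton_iff]

theorem numClasses_pos [Finite X] [Nonempty X] (s : Setoid X) : 0 < numClasses s := by
  have : Nonempty (Quotient s) := ‹Nonempty X›.map (Quotient.mk s)
  exact Nat.card_pos

theorem numClasses_top [Finite X] [Nonempty X] : numClasses (⊤ : Setoid X) = 1 :=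
  le_antisymm (numClasses_le_one_iff.2 rfl) (numClasses_pos _)

theorem numClasses_bot : numClasses (⊥ : Setoid X) = Nat.card X :=
  Nat.card_congr (Quotient.congr (ra := ⊥) (rb := ⊥) (Equiv.refl X) (by simp) |>.trans
    (Setoid.quotientBotEquiv (α := X)))

theorem numClasses_sum [Finite X] [Finite Y] {s : Setoid (X ⊕ Y)}
    (h : ∀ x y, ¬ s (Sum.inl x) (Sum.inr y)) :
    numClasses s = numClasses (Setoid.comap Sum.inl s) + numClasses (Setoid.comap Sum.inr s) := by
  let f : Quotient (Setoid.comap Sum.inl s) ⊕ Quotient (Setoid.comap Sum.inr s) → Quotient s :=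
    Sum.elim (Quotient.map' Sum.inl fun _ _ k => k) (Quotient.map' Sum.inr fun _ _ k => k)
  have hf : Function.Bijective f := by
    constructor
    · rintro (⟨⟨a⟩⟩ | ⟨⟨a⟩⟩) (⟨⟨b⟩⟩ | ⟨⟨b⟩⟩) hab
      · exact congrArg Sum.inl (Quotient.sound (Quotient.exact (s := s) (a := .inl a) (b := .inl b) hab))
      · exact (h _ _ (Quotient.exact (s := s) (a := .inl a) (b := .inr b) hab)).elim
      · exact (h _ _ (Quotient.exact (s := s) (a := .inl b) (b := .inr a) hab.symm)).elim
      · exact congrArg Sum.inr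
          (Quotient.sound (Quotient.exact (s := s) (a := .inr a) (b := .inr b) hab))
    · rintro ⟨a | a⟩
      · exact ⟨Sum.inl (Quotient.mk _ a), rfl⟩
      · exact ⟨Sum.inr (Quotient.mk _ a), rfl⟩
  rw [numClasses, ← Nat.card_congr (Equiv.ofBijective f hf), Nat.card_sum]
  rfl

theorem numClasses_option [Finite X] {s : Setoid (Option X)}
    (h : ∀ x, ¬ s none (some x)) :
    numClasses s = numClasses (Setoid.comap some s) + 1 := by
  let f : Option (Quotient (Setoid.comap some s)) → Quotient s :=
    fun o => o.elim (Quotient.mk s none) (Quotient.map' some fun _ _ k => k)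
  have hf : Function.Bijective f := by
    constructor
    · rintro (_ | ⟨⟨a⟩⟩) (_ | ⟨⟨b⟩⟩) hab
      · rfl
      · exact (h _ (Quotient.exact (s := s) (a := none) (b := some b) hab)).elim
      · exact (h _ (Quotient.exact (s := s) (a := none) (b := some a) hab.symm)).elim
      · exact congrArg some
          (Quotient.sound (Quotient.exact (s := s) (a := some a) (b := some b) hab))
    · rintro ⟨_ | a⟩
      · exact ⟨none, rfl⟩
      · exact ⟨some (Quotient.mk _ a), rfl⟩
  rw [numClasses, ← Nat.card_congr (Equiv.ofBijective f hf)]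
  exact Finite.card_option

end Setoid

/-! ### Cycles of a permutation and their change under a transposition. -/

section Cycles

variable {X Y : Type}

/-- The setoid whose classes are the cycles of a permutation. -/
abbrev cyc (σ : Perm X) : Setoid X := Perm.SameCycle.setoid σ

/-- The setoid whose classes are the orbits of the group generated by `σ` and `α`. -/
def orb (σ α : Perm X) : Setoid X := cyc σ ⊔ cyc α

theorem cyc_le_iff {σ : Perm X} {s : Setoid X} : cyc σ ≤ s ↔ ∀ x, s x (σ x) := by
  constructor
  · exact fun h x => h (show σ.SameCycle x (σ x) from ⟨1, by simp⟩)
  · rintro h x y ⟨i, rfl⟩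
    induction i using Int.induction_on with
    | zero => exact s.refl' x
    | succ i ih =>
      rw [add_comm, zpow_one_add]
      exact s.trans' ih (h _)
    | pred i ih =>
      refine s.trans' ih (s.symm' ?_)
      have := h ((σ ^ (-(i : ℤ) - 1)) x)
      rwa [← Perm.mul_apply, ← zpow_one_add, add_sub_cancel] at this

theorem orb_le_iff {σ α : Perm X} {s : Setoid X} :
    orb σ α ≤ s ↔ (∀ x, s x (σ x)) ∧ ∀ x, s x (α x) := by
  rw [orb, sup_le_iff, cyc_le_iff, cyc_le_iff]

theorem orb_apply_left (σ α : Perm X) (x : X) : orb σ α x (σ x) := (orb_le_iff.1 le_rfl).1 x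

theorem orb_apply_right (σ α : Perm X) (x : X) : orb σ α x (α x) := (orb_le_iff.1 le_rfl).2 x

theorem cyc_rel_apply (σ : Perm X) (x : X) : cyc σ x (σ x) := cyc_le_iff.1 le_rfl x

theorem cyc_one : cyc (1 : Perm X) = ⊥ := by
  rw [eq_bot_iff, cyc_le_iff]
  intro x
  exact Setoid.refl' _ _

/-- The two permutations only exchange their values at `x` and `y`, which is invisible once these
points are identified. One inclusion is enough, since the transposition is an involution. -/
theorem glue_cyc_mul_swap [DecidableEq X] (σ : Perm X) (x y : X) :
    glue (cyc (σ * swap x y)) x y = glue (cyc σ) x y := by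
  have key : ∀ σ : Perm X, cyc (σ * swap x y) ≤ glue (cyc σ) x y := by
    intro σ
    rw [cyc_le_iff]
    intro z
    rw [Perm.mul_apply]
    rcases eq_or_ne z x with rfl | hx
    · rw [swap_apply_left]
      exact Or.inr (Or.inl ⟨Setoid.refl' _ _, cyc_rel_apply σ y⟩)
    rcases eq_or_ne z y with rfl | hy
    · rw [swap_apply_right]
      exact Or.inr (Or.inr ⟨Setoid.refl' _ _, cyc_rel_apply σ x⟩)
    · rw [swap_apply_of_ne_of_ne hx hy]
      exact Or.inl (cyc_rel_apply σ z)
  apply le_antisymm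
  · exact glue_le_iff.2 ⟨key σ, glue_rel _ _ _⟩
  · refine glue_le_iff.2 ⟨?_, glue_rel _ _ _⟩
    have := key (σ * swap x y)
    rwa [mul_assoc, swap_mul_self, mul_one] at this

/-- The length of the cycle of `x`. -/
noncomputable def len (σ : Perm X) (x : X) : ℕ := {y | cyc σ x y}.ncard

theorem len_congr {σ : Perm X} {x y : X} (h : cyc σ x y) : len σ x = len σ y := by
  unfold len
  congr 1
  ext z
  exact ⟨fun k => Setoid.trans' _ (Setoid.symm' _ h) k, fun k => Setoid.trans' _ h k⟩

variable [Finite X]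

theorem len_pos (σ : Perm X) (x : X) : 0 < len σ x :=
  (Set.ncard_pos (Set.toFinite _)).2 ⟨x, Setoid.refl' (cyc σ) x⟩

theorem len_le (σ : Perm X) (x : X) : len σ x ≤ Nat.card X :=
  Set.ncard_le_card _

theorem mem_periodicPts (σ : Perm X) (x : X) : x ∈ Function.periodicPts σ :=
  Function.mk_mem_periodicPts (orderOf_pos σ) (by
    rw [Function.IsPeriodicPt, Function.IsFixedPt, ← Perm.coe_pow, pow_orderOf_eq_one,
      Perm.one_apply])

theorem cyc_iff_exists_lt (σ : Perm X) (x y : X) :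
    cyc σ x y ↔ ∃ i < Function.minimalPeriod σ x, (σ ^ i) x = y := by
  constructor
  · intro h
    obtain ⟨i, rfl⟩ := Perm.SameCycle.exists_nat_pow_eq (f := σ) h
    refine ⟨i % Function.minimalPeriod σ x, Nat.mod_lt _ ?_, ?_⟩
    · exact Function.minimalPeriod_pos_of_mem_periodicPts (mem_periodicPts σ x)
    · rw [Perm.coe_pow, Perm.coe_pow, Function.iterate_mod_minimalPeriod_eq]
  · rintro ⟨i, -, rfl⟩
    exact ⟨i, by simp⟩

theorem pow_injOn {X : Type} (σ : Perm X) (x : X) :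
    Set.InjOn (fun i : ℕ => (σ ^ i) x) (Set.Iio (Function.minimalPeriod σ x)) := by
  simpa only [Perm.coe_pow] using Function.iterate_injOn_Iio_minimalPeriod (f := σ) (x := x)

theorem len_eq_minimalPeriod (σ : Perm X) (x : X) : len σ x = Function.minimalPeriod σ x := by
  have : {y | cyc σ x y} = (fun i : ℕ => (σ ^ i) x) '' Set.Iio (Function.minimalPeriod σ x) := by
    ext y
    rw [Set.mem_ofPred_eq, cyc_iff_exists_lt]
    rfl
  rw [len, this, (pow_injOn σ x).ncard_image, ← Finset.coe_Iio,
    Set.ncard_coe_finset, Nat.card_Iio]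

theorem cyc_iff_exists_lt_len (σ : Perm X) (x y : X) :
    cyc σ x y ↔ ∃ i < len σ x, (σ ^ i) x = y := by
  rw [len_eq_minimalPeriod, cyc_iff_exists_lt]

theorem pow_len_apply (σ : Perm X) (x : X) : (σ ^ len σ x) x = x := by
  rw [len_eq_minimalPeriod, Perm.coe_pow]
  exact Function.iterate_minimalPeriod

theorem pow_injOn_len (σ : Perm X) (x : X) :
    Set.InjOn (fun i : ℕ => (σ ^ i) x) (Set.Iio (len σ x)) := by
  rw [len_eq_minimalPeriod]
  exact pow_injOn σ x

/-- Splitting a cycle: the cycle of `σ ^ n x` after composing with a transposition. -/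
theorem cyc_mul_swap_pow [DecidableEq X] (σ : Perm X) (x : X) {n : ℕ} (hn : 0 < n)
    (hn' : n < len σ x) (z : X) :
    cyc (σ * swap x ((σ ^ n) x)) ((σ ^ n) x) z ↔ ∃ i, 1 ≤ i ∧ i ≤ n ∧ (σ ^ i) x = z := by
  have inj : ∀ i j, i < len σ x → j < len σ x → (σ ^ i) x = (σ ^ j) x → i = j :=
    fun i j hi hj h => pow_injOn_len σ x hi hj h
  set y := (σ ^ n) x with hy
  set τ := σ * swap x y with hτ
  have hxy : x ≠ y := fun h => hn.ne (inj 0 n (by omega) hn' (by simpa using h))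
  have step : ∀ i, 1 ≤ i → i < n → τ ((σ ^ i) x) = (σ ^ (i + 1)) x := by
    intro i h1 h2
    rw [hτ, Perm.mul_apply, swap_apply_of_ne_of_ne, pow_succ', Perm.mul_apply]
    · intro h
      have := inj i 0 (by omega) (by omega) (by simpa using h)
      omega
    · intro h
      have := inj i n (by omega) (by omega) h
      omega
  have stepy : τ y = (σ ^ 1) x := by rw [hτ, Perm.mul_apply, swap_apply_right, pow_one]
  have fwd : ∀ i, 1 ≤ i → i ≤ n → cyc τ y ((σ ^ i) x) := by
    intro i h1
    induction i, h1 using Nat.le_induction with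
    | base => intro _; rw [← stepy]; exact cyc_rel_apply τ y
    | succ i h1 ih =>
      intro h2
      rw [← step i h1 (by omega)]
      exact Setoid.trans' _ (ih (by omega)) (cyc_rel_apply _ _)
  constructor
  · intro h
    obtain ⟨j, rfl⟩ := Perm.SameCycle.exists_nat_pow_eq (f := τ) h
    clear h
    induction j with
    | zero => exact ⟨n, hn, le_rfl, rfl⟩
    | succ j ih =>
      obtain ⟨i, h1, h2, h3⟩ := ih
      rw [pow_succ', Perm.mul_apply, ← h3]
      rcases h2.eq_or_lt with rfl | h2
      · exact ⟨1, le_rfl, hn, stepy.symm⟩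
      · exact ⟨i + 1, by omega, h2, (step i h1 h2).symm⟩
  · rintro ⟨i, h1, h2, rfl⟩
    exact fwd i h1 h2

theorem len_mul_swap_pow [DecidableEq X] (σ : Perm X) (x : X) {n : ℕ} (hn : 0 < n)
    (hn' : n < len σ x) : len (σ * swap x ((σ ^ n) x)) ((σ ^ n) x) = n := by
  have : {z | cyc (σ * swap x ((σ ^ n) x)) ((σ ^ n) x) z}
      = (fun i : ℕ => (σ ^ i) x) '' (Finset.Icc 1 n : Set ℕ) := by
    ext z
    rw [Set.mem_ofPred_eq, cyc_mul_swap_pow σ x hn hn']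
    simp [and_assoc]
  rw [len, this, Set.InjOn.ncard_image, Set.ncard_coe_finset, Nat.card_Icc, Nat.add_sub_cancel]
  refine (pow_injOn_len σ x).mono ?_
  intro i hi
  rw [Finset.mem_coe, Finset.mem_Icc] at hi
  exact lt_of_le_of_lt hi.2 hn'

theorem not_cyc_mul_swap [DecidableEq X] {σ : Perm X} {x y : X} (hxy : x ≠ y) (h : cyc σ x y) :
    ¬ cyc (σ * swap x y) x y := by
  obtain ⟨n, hn, rfl⟩ := (cyc_iff_exists_lt_len σ x y).1 h
  have hn0 : 0 < n := by
    rcases Nat.eq_zero_or_pos n with rfl | h0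
    · simp at hxy
    · exact h0
  intro k
  obtain ⟨i, h1, h2, h3⟩ := (cyc_mul_swap_pow σ x hn0 hn x).1 (Setoid.symm' _ k)
  have := pow_injOn_len σ x (show i < len σ x by omega) (show 0 < len σ x by omega)
    (by simpa using h3)
  omega

/-- From `x` the new permutation jumps to `σ y` and then runs along the old cycle of `y`. It cannot
meet `x`, which is not on that cycle, so it ends at `y`. -/
theorem cyc_mul_swap_of_not [DecidableEq X] {σ : Perm X} {x y : X} (h : ¬ cyc σ x y) :
    cyc (σ * swap x y) x y := by
  by_contra k
  have hstep : ∀ i, i < len σ y → cyc (σ * swap x y) x ((σ ^ (i + 1)) y) := by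
    intro i
    induction i with
    | zero =>
      intro _
      have := cyc_rel_apply (σ * swap x y) x
      rwa [Perm.mul_apply, swap_apply_left] at this
    | succ i ih =>
      intro hi
      have h1 := ih (by omega)
      have h2 := cyc_rel_apply (σ * swap x y) ((σ ^ (i + 1)) y)
      rw [Perm.mul_apply, swap_apply_of_ne_of_ne, ← Perm.mul_apply, ← pow_succ'] at h2
      · exact Setoid.trans' _ h1 h2
      · intro e
        apply h
        rw [← e]
        exact ⟨-(i + 1 : ℕ), by rw [zpow_neg, zpow_natCast]; simp⟩
      · intro e
        apply k
        rwa [e] at h1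
  obtain ⟨l, hl⟩ : ∃ l, len σ y = l + 1 := ⟨len σ y - 1, by have := len_pos σ y; omega⟩
  have := hstep l (by omega)
  rw [← hl, pow_len_apply] at this
  exact k this

theorem cyc_mul_swap_eq_glue [DecidableEq X] {σ : Perm X} {x y : X} (h : ¬ cyc σ x y) :
    cyc (σ * swap x y) = glue (cyc σ) x y := by
  rw [← glue_cyc_mul_swap, glue_eq_self (cyc_mul_swap_of_not h)]

theorem numClasses_cyc_mul_swap [DecidableEq X] {σ : Perm X} {x y : X} (h : ¬ cyc σ x y) :
    numClasses (cyc (σ * swap x y)) + 1 = numClasses (cyc σ) := by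
  rw [cyc_mul_swap_eq_glue h, numClasses_glue h]

theorem numClasses_cyc_mul_swap' [DecidableEq X] {σ : Perm X} {x y : X} (hxy : x ≠ y)
    (h : cyc σ x y) : numClasses (cyc (σ * swap x y)) = numClasses (cyc σ) + 1 := by
  have := numClasses_cyc_mul_swap (not_cyc_mul_swap hxy h)
  rw [mul_assoc, swap_mul_self, mul_one] at this
  exact this.symm

theorem len_mul_swap_of_not {X : Type} [DecidableEq X] {σ : Perm X} {x y z : X} (hx : ¬ cyc σ x z)
    (hy : ¬ cyc σ y z) : len (σ * swap x y) z = len σ z := by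
  unfold len
  congr 1
  have h1 : ¬ glue (cyc σ) x y x z := by
    rintro (k | ⟨-, k⟩ | ⟨-, k⟩)
    exacts [hx k, hy k, hx k]
  have h2 : ¬ glue (cyc σ) x y y z := by
    rintro (k | ⟨-, k⟩ | ⟨-, k⟩)
    exacts [hy k, hy k, hx k]
  ext w
  simp only [Set.mem_ofPred_eq]
  have e1 : glue (cyc σ) x y z w ↔ cyc σ z w := by
    constructor
    · rintro (k | ⟨k, -⟩ | ⟨k, -⟩)
      exacts [k, (hx (Setoid.symm' _ k)).elim, (hy (Setoid.symm' _ k)).elim]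
    · exact Or.inl
  have e2 : glue (cyc (σ * swap x y)) x y z w ↔ cyc (σ * swap x y) z w := by
    constructor
    · rintro (k | ⟨k, -⟩ | ⟨k, -⟩)
      · exact k
      · exfalso; apply h1
        rw [← glue_cyc_mul_swap]
        exact Or.inl (Setoid.symm' _ k)
      · exfalso; apply h2
        rw [← glue_cyc_mul_swap]
        exact Or.inl (Setoid.symm' _ k)
    · exact Or.inl
  rw [← e2, glue_cyc_mul_swap, e1]

end Cycles

end PlanarCensus

namespace PlanarCensus

open Equiv

/-! ### Euler's inequality and contraction of an edge. -/

section Euler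

variable {X : Type}

theorem cyc_mul_le_orb (σ α : Perm X) : cyc (σ * α) ≤ orb σ α := by
  rw [cyc_le_iff]
  intro x
  exact Setoid.trans' _ (orb_apply_right σ α x) (orb_apply_left σ α (α x))

theorem cyc_le_orb_left (σ α : Perm X) : cyc σ ≤ orb σ α := le_sup_left

/-- The Euler characteristic of a possibly disconnected map is at most twice the number of its
components. -/
theorem euler_inequality [Finite X] (σ α : Perm X) :
    numClasses (cyc σ) + numClasses (cyc α) + numClasses (cyc (σ * α))
      ≤ Nat.card X + 2 * numClasses (orb σ α) := by
  classical
  have hle : ∀ α : Perm X, numClasses (cyc α) ≤ Nat.card X := fun α =>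
    Nat.card_le_card_of_surjective (Quotient.mk (cyc α)) Quotient.mk_surjective
  -- Transpositions are stripped from `α` one at a time; each adds a cycle, so this difference drops
  -- to `0`, where `α` is the identity.
  induction h : Nat.card X - numClasses (cyc α) generalizing α with
  | zero | succ n ih =>
    by_cases hα : α = 1
    · subst hα
      rw [mul_one, orb, cyc_one, sup_bot_eq, numClasses_bot]
      omega
    obtain ⟨x, hx⟩ : ∃ x, α x ≠ x := by
      by_contra! k
      exact hα (Equiv.ext k)
    have hxy : x ≠ α x := fun k => hx k.symm
    set y := α x with hy
    have h1 : cyc α x y := cyc_rel_apply α x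
    have h2 := numClasses_cyc_mul_swap' hxy h1
    have h3 := hle (α * swap x y)
    have h4 := not_cyc_mul_swap hxy h1
    -- The first alternative closes the base case: there `α` would already have the maximal number
    -- of cycles, and splitting one more is impossible.
    first
    | omega
    | have h5 := ih (α * swap x y) (by omega)
      have e1 : cyc α = glue (cyc (α * swap x y)) x y := by
        rw [← cyc_mul_swap_eq_glue h4, mul_assoc, swap_mul_self, mul_one]
      have e2 : orb σ α = glue (orb σ (α * swap x y)) x y := by
        rw [orb, e1, sup_comm, glue_sup, sup_comm]
        rfl
      have e3 : σ * α = σ * (α * swap x y) * swap x y := by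
        rw [mul_assoc, mul_assoc, swap_mul_self, mul_one]
      -- Restoring the transposition costs `α` one cycle. If the components do not change, the faces
      -- can increase by at most one; if two components merge, so do two faces, and the left side
      -- loses two.
      by_cases k : orb σ (α * swap x y) x y
      · rw [glue_eq_self k] at e2
        have : numClasses (cyc (σ * α)) ≤ numClasses (cyc (σ * (α * swap x y))) + 1 := by
          rw [e3]
          by_cases k' : cyc (σ * (α * swap x y)) x y
          · exact (numClasses_cyc_mul_swap' hxy k').le
          · have := numClasses_cyc_mul_swap k'
            omega
        rw [e2]
        omega
      · have k' : ¬ cyc (σ * (α * swap x y)) x y := fun k' => k (cyc_mul_le_orb _ _ k')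
        have h6 := numClasses_cyc_mul_swap k'
        rw [← e3] at h6
        have h7 := numClasses_glue k
        rw [← e2] at h7
        omega

/-- The map coded by `σ` and `α` is connected and planar. -/
def ConnectedPlanar (σ α : Perm X) : Prop :=
  orb σ α = ⊤ ∧
    numClasses (cyc σ) + numClasses (cyc α) + numClasses (cyc (σ * α)) = Nat.card X + 2

theorem glue_eq_top_iff {s : Setoid X} {x y : X} : glue s x y = ⊤ ↔ ∀ z, s x z ∨ s y z := by
  rw [Setoid.eq_top_iff]
  constructor
  · intro h z
    rcases h x z with k | ⟨-, k⟩ | ⟨-, k⟩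
    exacts [Or.inl k, Or.inr k, Or.inl k]
  · intro h a b
    have hx : ∀ z, glue s x y x z := fun z => (h z).elim Or.inl
      fun k => Or.inr (Or.inl ⟨s.refl' x, k⟩)
    exact Setoid.trans' _ (Setoid.symm' _ (hx a)) (hx b)

/-- The effect on planarity of contracting the edge formed by `x` and `y`. -/
theorem connectedPlanar_mul_swap_iff [Finite X] [DecidableEq X] {σ α : Perm X} {x y : X}
    (hxy : x ≠ y) (hx : α x = x) (hy : α y = y) :
    ConnectedPlanar (σ * swap x y) (α * swap x y) ↔
      (cyc σ x y ∧ ConnectedPlanar σ α) ∨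
      (¬ orb σ α x y ∧ (∀ z, orb σ α x z ∨ orb σ α y z) ∧
        numClasses (cyc σ) + numClasses (cyc α) + numClasses (cyc (σ * α)) = Nat.card X + 4) := by
  have : Nonempty X := ⟨x⟩
  have hα : ¬ cyc α x y := fun h => hxy (Perm.SameCycle.eq_of_left h hx)
  have e1 : orb (σ * swap x y) (α * swap x y) = glue (orb σ α) x y := by
    rw [orb, cyc_mul_swap_eq_glue hα, sup_comm, glue_sup, sup_comm, ← glue_sup,
      glue_cyc_mul_swap, glue_sup]
    rfl
  -- The transposition commutes with `α`, which fixes both points; the two copies cancel and the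
  -- faces stay the same.
  have e2 : σ * swap x y * (α * swap x y) = σ * α := by
    have : swap x y * α = α * swap x y := by
      rw [swap_mul_eq_mul_swap, Perm.inv_eq_iff_eq.2 hx.symm, Perm.inv_eq_iff_eq.2 hy.symm]
    rw [mul_assoc, ← this, swap_mul_self_mul]
  have h1 := numClasses_cyc_mul_swap hα
  have h2 := euler_inequality σ α
  have e3 : glue (orb σ α) x y = ⊤ ↔ ∀ z, orb σ α x z ∨ orb σ α y z := glue_eq_top_iff
  rw [ConnectedPlanar, ConnectedPlanar, e1, e2]
  by_cases k : cyc σ x y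
  · have k' : orb σ α x y := cyc_le_orb_left σ α k
    have h3 := numClasses_cyc_mul_swap' hxy k
    rw [glue_eq_self k']
    constructor
    · rintro ⟨h, h'⟩
      exact Or.inl ⟨k, h, by omega⟩
    · rintro (⟨-, h, h'⟩ | ⟨h, -⟩)
      · exact ⟨h, by omega⟩
      · exact (h k').elim
  · have h3 := numClasses_cyc_mul_swap k
    constructor
    · rintro ⟨h, h'⟩
      have h4 : numClasses (cyc σ) + numClasses (cyc α) + numClasses (cyc (σ * α))
          = Nat.card X + 4 := by omega
      -- A connected pair with count `Nat.card X + 4` would contradict Euler's inequality, so `x`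
      -- and `y` lie in different components.
      refine Or.inr ⟨fun k' => ?_, e3.1 h, h4⟩
      rw [glue_eq_self k'] at h
      rw [h, numClasses_top] at h2
      omega
    · rintro (⟨h, -⟩ | ⟨-, h, h'⟩)
      · exact (k h).elim
      · exact ⟨e3.2 h, by omega⟩

end Euler

/-! ### Invariance under relabelling. -/

section Transport

variable {X Y : Type} (e : X ≃ Y)

theorem cyc_permCongr (σ : Perm X) (x y : X) : cyc (e.permCongr σ) (e x) (e y) ↔ cyc σ x y := by
  have h : cyc (e.permCongr σ) ≤ Setoid.comap e.symm (cyc σ) := by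
    rw [cyc_le_iff]
    intro z
    rw [Setoid.comap_rel, permCongr_apply, symm_apply_apply]
    exact cyc_rel_apply _ _
  have h' : cyc σ ≤ Setoid.comap e (cyc (e.permCongr σ)) := by
    rw [cyc_le_iff]
    intro z
    rw [Setoid.comap_rel]
    have := cyc_rel_apply (e.permCongr σ) (e z)
    rwa [permCongr_apply, symm_apply_apply] at this
  constructor
  · intro k
    simpa [Setoid.comap_rel] using h k
  · exact fun k => h' k

theorem cyc_permCongr_eq (σ : Perm X) : cyc (e.permCongr σ) = Setoid.comap e.symm (cyc σ) := by
  ext x y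
  rw [Setoid.comap_rel, ← cyc_permCongr e, apply_symm_apply, apply_symm_apply]

theorem orb_permCongr_eq (σ α : Perm X) :
    orb (e.permCongr σ) (e.permCongr α) = Setoid.comap e.symm (orb σ α) := by
  apply le_antisymm
  · rw [orb_le_iff]
    simp only [Setoid.comap_rel, permCongr_apply, symm_apply_apply]
    exact ⟨fun x => orb_apply_left _ _ _, fun x => orb_apply_right _ _ _⟩
  · have : orb σ α ≤ Setoid.comap e (orb (e.permCongr σ) (e.permCongr α)) := by
      rw [orb_le_iff]
      constructor
      · intro x
        have := orb_apply_left (e.permCongr σ) (e.permCongr α) (e x)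
        rwa [permCongr_apply, symm_apply_apply] at this
      · intro x
        have := orb_apply_right (e.permCongr σ) (e.permCongr α) (e x)
        rwa [permCongr_apply, symm_apply_apply] at this
    intro x y k
    simpa [Setoid.comap_rel] using this k

theorem len_permCongr (σ : Perm X) (x : X) : len (e.permCongr σ) (e x) = len σ x := by
  have : {y | cyc (e.permCongr σ) (e x) y} = e '' {y | cyc σ x y} := by
    ext y
    obtain ⟨y, rfl⟩ := e.surjective y
    simp only [Set.mem_ofPred_eq, cyc_permCongr, e.injective.mem_set_image]
  rw [len, this, Set.ncard_image_of_injective _ e.injective, len]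

theorem permCongr_mul' (σ α : Perm X) :
    e.permCongr σ * e.permCongr α = e.permCongr (σ * α) := by
  ext x
  simp

theorem connectedPlanar_permCongr {σ α : Perm X} :
    ConnectedPlanar (e.permCongr σ) (e.permCongr α) ↔ ConnectedPlanar σ α := by
  have top : ∀ s : Setoid X, Setoid.comap e.symm s = ⊤ ↔ s = ⊤ := by
    intro s
    simp only [Setoid.eq_top_iff, Setoid.comap_rel]
    exact ⟨fun h x y => by simpa using h (e x) (e y), fun h x y => h _ _⟩
  rw [ConnectedPlanar, ConnectedPlanar, permCongr_mul', orb_permCongr_eq, cyc_permCongr_eq,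
    cyc_permCongr_eq, cyc_permCongr_eq, numClasses_comap e.symm.surjective,
    numClasses_comap e.symm.surjective, numClasses_comap e.symm.surjective, Nat.card_congr e, top]

end Transport

/-! ### Inserting a leg into a map. -/

section Option

variable {Y : Type}

theorem cyc_optionCongr_le (σ : Perm Y) : cyc σ ≤ Setoid.comap some (cyc (optionCongr σ)) := by
  rw [cyc_le_iff]
  intro x
  exact cyc_rel_apply (optionCongr σ) (some x)

/-- The setoid on `Option Y` which extends a setoid of `Y`, the class of `none` being
a singleton. -/
def optionSetoid (s : Setoid Y) : Setoid (Option Y) where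
  r := Option.Rel s
  iseqv :=
    { refl := by
        rintro (_ | x)
        · exact .none
        · exact .some (s.refl' x)
      symm := by
        rintro _ _ (h | _)
        · exact .some (s.symm' h)
        · exact .none
      trans := by
        rintro _ _ _ (h | _) (k | _)
        · exact .some (s.trans' h k)
        · exact .none }

theorem optionSetoid_some (s : Setoid Y) (x y : Y) :
    optionSetoid s (some x) (some y) ↔ s x y :=
  ⟨fun h => by cases h; assumption, fun h => .some h⟩

theorem optionSetoid_none (s : Setoid Y) (x : Y) : ¬ optionSetoid s none (some x) := nofun

theorem cyc_optionCongr (σ : Perm Y) : cyc (optionCongr σ) = optionSetoid (cyc σ) := by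
  apply le_antisymm
  · rw [cyc_le_iff]
    rintro (_ | x)
    · exact Setoid.refl' _ _
    · exact .some (cyc_rel_apply σ x)
  · rintro _ _ (h | _)
    · exact cyc_optionCongr_le σ h
    · exact Setoid.refl' _ _

theorem orb_optionCongr_none (σ α : Perm Y) (x : Y) :
    ¬ orb (optionCongr σ) (optionCongr α) none (some x) := by
  have : orb (optionCongr σ) (optionCongr α) ≤ optionSetoid (orb σ α) := by
    rw [orb_le_iff]
    constructor
    · rintro (_ | x)
      · exact .none
      · exact .some (orb_apply_left _ _ _)
    · rintro (_ | x)
      · exact .none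
      · exact .some (orb_apply_right _ _ _)
  exact fun h => optionSetoid_none _ _ (this h)

theorem numClasses_cyc_optionCongr [Finite Y] (σ : Perm Y) :
    numClasses (cyc (optionCongr σ)) = numClasses (cyc σ) + 1 := by
  rw [cyc_optionCongr, numClasses_option (optionSetoid_none _)]
  congr 2
  ext x y
  rw [Setoid.comap_rel, optionSetoid_some]

variable [DecidableEq Y]

/-- The permutation obtained from `σ` by inserting `none` just before `i`. -/
def insertBefore (i : Option Y) (σ : Perm Y) : Perm (Option Y) := swap none i * optionCongr σ

theorem insertBefore_none_apply (i : Option Y) (σ : Perm Y) : insertBefore i σ none = i := by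
  simp [insertBefore]

theorem insertBefore_some_apply_of_eq (σ : Perm Y) (x : Y) :
    insertBefore (some (σ x)) σ (some x) = none := by
  simp [insertBefore]

theorem insertBefore_some_apply_of_ne {i : Option Y} {σ : Perm Y} {x : Y} (h : some (σ x) ≠ i) :
    insertBefore i σ (some x) = some (σ x) := by
  simp [insertBefore, swap_apply_of_ne_of_ne, h]

/-- The transposition stands on the left, so a leg inserted in a vertex is inserted in a face in the
same way. -/
theorem insertBefore_mul (i : Option Y) (σ α : Perm Y) :
    insertBefore i σ * optionCongr α = insertBefore i (σ * α) := by
  rw [insertBefore, insertBefore, mul_assoc]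
  congr 1
  ext1 (_ | x) <;> simp

/-- Collapsing the leg onto the half-edge `y` that follows it identifies components. The case `α =
1` describes the cycles. -/
theorem orb_insertBefore (y : Y) (σ α : Perm Y) :
    orb (insertBefore (some y) σ) (optionCongr α) = Setoid.comap (fun o => o.getD y) (orb σ α) := by
  apply le_antisymm
  · rw [orb_le_iff]
    constructor
    · rintro (_ | x)
      · rw [insertBefore_none_apply]
        exact Setoid.refl' (orb σ α) y
      · by_cases h : σ x = y
        · rw [← h, insertBefore_some_apply_of_eq]
          exact orb_apply_left _ _ _
        · rw [insertBefore_some_apply_of_ne (by simpa using h)]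
          exact orb_apply_left _ _ _
    · rintro (_ | x)
      · exact Setoid.refl' _ _
      · exact orb_apply_right _ _ _
  · set s := orb (insertBefore (some y) σ) (optionCongr α) with hs
    have hny : s none (some y) := by
      have := orb_apply_left (insertBefore (some y) σ) (optionCongr α) none
      rwa [insertBefore_none_apply] at this
    have h : orb σ α ≤ Setoid.comap some s := by
      rw [orb_le_iff]
      constructor
      · intro x
        have := orb_apply_left (insertBefore (some y) σ) (optionCongr α) (some x)
        by_cases h : σ x = y
        · subst h
          rw [insertBefore_some_apply_of_eq] at this
          exact Setoid.trans' s this hny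
        · rwa [insertBefore_some_apply_of_ne (by simpa using h)] at this
      · intro x
        exact orb_apply_right (insertBefore (some y) σ) (optionCongr α) (some x)
    have h' : ∀ o : Option Y, s o (some (o.getD y)) := by
      rintro (_ | x)
      · exact hny
      · exact Setoid.refl' _ _
    intro o o' k
    exact Setoid.trans' _ (h' o) (Setoid.trans' _ (h k) (Setoid.symm' _ (h' o')))

theorem orb_one_right {X : Type} (σ : Perm X) : orb σ 1 = cyc σ := by
  rw [orb, cyc_one, sup_bot_eq]

theorem cyc_insertBefore (y : Y) (σ : Perm Y) :
    cyc (insertBefore (some y) σ) = Setoid.comap (fun o => o.getD y) (cyc σ) := by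
  have := orb_insertBefore y σ 1
  rwa [optionCongr_one, orb_one_right, orb_one_right] at this

theorem getD_surjective {Y : Type} (y : Y) : Function.Surjective (fun o : Option Y => o.getD y) :=
  fun x => ⟨some x, rfl⟩

/-- The leg adds one point and one trivial cycle of the edge permutation; vertices, faces and
components are the same in number. -/
theorem connectedPlanar_insertBefore [Finite Y] (y : Y) (σ α : Perm Y) :
    ConnectedPlanar (insertBefore (some y) σ) (optionCongr α) ↔ ConnectedPlanar σ α := by
  have top : ∀ s : Setoid Y, Setoid.comap (fun o : Option Y => o.getD y) s = ⊤ ↔ s = ⊤ := by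
    intro s
    simp only [Setoid.eq_top_iff, Setoid.comap_rel]
    exact ⟨fun h x z => h (some x) (some z), fun h x y => h _ _⟩
  rw [ConnectedPlanar, ConnectedPlanar, insertBefore_mul, orb_insertBefore, cyc_insertBefore,
    cyc_insertBefore, numClasses_cyc_optionCongr, numClasses_comap (getD_surjective y),
    numClasses_comap (getD_surjective y), top, Finite.card_option]
  refine and_congr_right fun _ => ?_
  omega

/-- A leg alone on its vertex is a connected component by itself. -/
theorem connectedPlanar_optionCongr {Y : Type} [Finite Y] (σ α : Perm Y) :
    ConnectedPlanar (optionCongr σ) (optionCongr α) ↔ IsEmpty Y := by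
  constructor
  · rintro ⟨h, -⟩
    constructor
    intro y
    apply orb_optionCongr_none σ α y
    rw [h]
    trivial
  · intro _
    refine ⟨Setoid.eq_top_iff.2 ?_, ?_⟩
    · intro x y
      rw [Subsingleton.elim x y]
    · have : ∀ s : Setoid (Option Y), numClasses s = 1 := by
        intro s
        refine le_antisymm (numClasses_le_one_iff.2 (Setoid.eq_top_iff.2 fun x y => ?_))
          (numClasses_pos s)
        rw [Subsingleton.elim x y]
      rw [this, this, this, Finite.card_option, Nat.card_of_isEmpty]

theorem len_insertBefore_of_cyc [Finite Y] {y : Y} {σ : Perm Y} {o : Option Y}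
    (h : cyc σ y (o.getD y)) : len (insertBefore (some y) σ) o = len σ y + 1 := by
  have : {z | cyc (insertBefore (some y) σ) o z} = insert none (some '' {z | cyc σ y z}) := by
    ext z
    rw [Set.mem_ofPred_eq, cyc_insertBefore, Setoid.comap_rel]
    have e : ∀ w, cyc σ (o.getD y) w ↔ cyc σ y w := fun w =>
      ⟨fun k => Setoid.trans' _ h k, fun k => Setoid.trans' _ (Setoid.symm' _ h) k⟩
    rw [e]
    rcases z with _ | z
    · simp only [Option.getD_none, Set.mem_insert_iff, true_or, iff_true]
      exact Setoid.refl' _ _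
    · simp
  rw [len, this, Set.ncard_insert_of_notMem (by simp),
    Set.ncard_image_of_injective _ (Option.some_injective _), len]

theorem len_insertBefore_of_not_cyc {y x : Y} {σ : Perm Y}
    (h : ¬ cyc σ y x) : len (insertBefore (some y) σ) (some x) = len σ x := by
  have : {z | cyc (insertBefore (some y) σ) (some x) z} = some '' {z | cyc σ x z} := by
    ext z
    rw [Set.mem_ofPred_eq, cyc_insertBefore, Setoid.comap_rel]
    rcases z with _ | z
    · simp only [Option.getD_none, Option.getD_some, Set.mem_image, reduceCtorEq, and_false,
        exists_false, iff_false]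
      exact fun k => h (Setoid.symm' _ k)
    · simp
  rw [len, this, Set.ncard_image_of_injective _ (Option.some_injective _), len]

end Option

/-! ### Disjoint unions of two maps. -/

section Sum

variable {X Y : Type}

/-- The disjoint union of two setoids. -/
def sumSetoid (s : Setoid X) (u : Setoid Y) : Setoid (X ⊕ Y) where
  r := Sum.LiftRel s u
  iseqv :=
    { refl := by
        rintro (x | x)
        · exact .inl (s.refl' x)
        · exact .inr (u.refl' x)
      symm := by
        rintro _ _ (h | h)
        · exact .inl (s.symm' h)
        · exact .inr (u.symm' h)
      trans := by
        rintro _ _ _ (h | h) (k | k)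
        · exact .inl (s.trans' h k)
        · exact .inr (u.trans' h k) }

theorem sumSetoid_inl (s : Setoid X) (u : Setoid Y) (x y : X) :
    sumSetoid s u (.inl x) (.inl y) ↔ s x y := Sum.liftRel_inl_inl

theorem sumSetoid_inr (s : Setoid X) (u : Setoid Y) (x y : Y) :
    sumSetoid s u (.inr x) (.inr y) ↔ u x y := Sum.liftRel_inr_inr

theorem sumSetoid_inl_inr (s : Setoid X) (u : Setoid Y) (x : X) (y : Y) :
    ¬ sumSetoid s u (.inl x) (.inr y) := Sum.not_liftRel_inl_inr

theorem sumSetoid_inr_inl (s : Setoid X) (u : Setoid Y) (x : X) (y : Y) :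
    ¬ sumSetoid s u (.inr y) (.inl x) := Sum.not_liftRel_inr_inl

theorem orb_sumCongr (σ α : Perm X) (σ' α' : Perm Y) :
    orb (Perm.sumCongr σ σ') (Perm.sumCongr α α') = sumSetoid (orb σ α) (orb σ' α') := by
  apply le_antisymm
  · rw [orb_le_iff]
    constructor
    · rintro (x | x)
      · exact .inl (orb_apply_left _ _ _)
      · exact .inr (orb_apply_left _ _ _)
    · rintro (x | x)
      · exact .inl (orb_apply_right _ _ _)
      · exact .inr (orb_apply_right _ _ _)
  · set s := orb (Perm.sumCongr σ σ') (Perm.sumCongr α α')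
    have h1 : orb σ α ≤ Setoid.comap Sum.inl s := orb_le_iff.2
      ⟨fun x => orb_apply_left (Perm.sumCongr σ σ') (Perm.sumCongr α α') (.inl x),
        fun x => orb_apply_right (Perm.sumCongr σ σ') (Perm.sumCongr α α') (.inl x)⟩
    have h2 : orb σ' α' ≤ Setoid.comap Sum.inr s := orb_le_iff.2
      ⟨fun x => orb_apply_left (Perm.sumCongr σ σ') (Perm.sumCongr α α') (.inr x),
        fun x => orb_apply_right (Perm.sumCongr σ σ') (Perm.sumCongr α α') (.inr x)⟩
    rintro _ _ (h | h)
    · exact h1 h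
    · exact h2 h

theorem cyc_sumCongr (σ : Perm X) (σ' : Perm Y) :
    cyc (Perm.sumCongr σ σ') = sumSetoid (cyc σ) (cyc σ') := by
  have := orb_sumCongr σ 1 σ' 1
  rwa [Perm.sumCongr_one, orb_one_right, orb_one_right, orb_one_right] at this

theorem numClasses_sumSetoid [Finite X] [Finite Y] (s : Setoid X) (u : Setoid Y) :
    numClasses (sumSetoid s u) = numClasses s + numClasses u := by
  rw [numClasses_sum (sumSetoid_inl_inr s u)]
  congr 2 <;> ext x y <;> rw [Setoid.comap_rel]
  · exact sumSetoid_inl s u x y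
  · exact sumSetoid_inr s u x y

theorem len_sumCongr_inl (σ : Perm X) (σ' : Perm Y) (x : X) :
    len (Perm.sumCongr σ σ') (.inl x) = len σ x := by
  have : {z | cyc (Perm.sumCongr σ σ') (.inl x) z} = Sum.inl '' {z | cyc σ x z} := by
    ext z
    rw [Set.mem_ofPred_eq, cyc_sumCongr]
    rcases z with z | z
    · simp [sumSetoid_inl]
    · simp [sumSetoid_inl_inr]
  rw [len, this, Set.ncard_image_of_injective _ Sum.inl_injective, len]

theorem len_sumCongr_inr (σ : Perm X) (σ' : Perm Y) (x : Y) :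
    len (Perm.sumCongr σ σ') (.inr x) = len σ' x := by
  have : {z | cyc (Perm.sumCongr σ σ') (.inr x) z} = Sum.inr '' {z | cyc σ' x z} := by
    ext z
    rw [Set.mem_ofPred_eq, cyc_sumCongr]
    rcases z with z | z
    · simp [sumSetoid_inr_inl]
    · simp [sumSetoid_inr]
  rw [len, this, Set.ncard_image_of_injective _ Sum.inr_injective, len]

/-- Two connected components of total Euler characteristic `4` are both planar. -/
theorem connectedPlanar_sumCongr_iff [Finite X] [Finite Y] [Nonempty X] [Nonempty Y]
    (σ α : Perm X) (σ' α' : Perm Y) :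
    ConnectedPlanar σ α ∧ ConnectedPlanar σ' α' ↔
      orb σ α = ⊤ ∧ orb σ' α' = ⊤ ∧
      numClasses (cyc (Perm.sumCongr σ σ')) + numClasses (cyc (Perm.sumCongr α α'))
        + numClasses (cyc (Perm.sumCongr σ σ' * Perm.sumCongr α α')) = Nat.card (X ⊕ Y) + 4 := by
  rw [Perm.sumCongr_mul, cyc_sumCongr, cyc_sumCongr, cyc_sumCongr, numClasses_sumSetoid,
    numClasses_sumSetoid, numClasses_sumSetoid, Nat.card_sum]
  have h1 := euler_inequality σ α
  have h2 := euler_inequality σ' α'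
  constructor
  · rintro ⟨⟨h, h'⟩, k, k'⟩
    exact ⟨h, k, by omega⟩
  · rintro ⟨h, k, h'⟩
    -- Euler's inequality bounds each component by characteristic `2`; a total of `4` forces both
    -- equalities.
    rw [h, numClasses_top] at h1
    rw [k, numClasses_top] at h2
    exact ⟨⟨h, by omega⟩, k, by omega⟩

end Sum

end PlanarCensus

namespace PlanarCensus

open Equiv

/-! ### Indicators of propositions with values in a ring. -/

section Indicator

variable {K : Type*} [CommRing K]

open Classical in
/-- The indicator of a proposition. -/
noncomputable def ind (K : Type*) [CommRing K] (p : Prop) : K := if p then 1 else 0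

theorem ind_of_true {p : Prop} (h : p) : ind K p = 1 := if_pos h

theorem ind_of_false {p : Prop} (h : ¬ p) : ind K p = 0 := if_neg h

theorem ind_congr {p q : Prop} (h : p ↔ q) : ind K p = ind K q := by rw [propext h]

theorem ind_and (p q : Prop) : ind K (p ∧ q) = ind K p * ind K q := by
  by_cases hp : p <;> by_cases hq : q <;> simp [ind, hp, hq]

theorem ind_or {p q : Prop} (h : ¬ (p ∧ q)) : ind K (p ∨ q) = ind K p + ind K q := by
  by_cases hp : p <;> by_cases hq : q <;> simp_all [ind]

theorem ind_mul_congr {p q : Prop} (h : p ↔ q) {u w : K} (h' : q → u = w) :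
    ind K p * u = ind K q * w := by
  rw [ind_congr h]
  by_cases hq : q
  · rw [h' hq]
  · rw [ind_of_false hq, zero_mul, zero_mul]

theorem ind_exists_unique {ι : Type*} [Fintype ι] {p : ι → Prop} (h : ∃! i, p i) :
    ∑ i, ind K (p i) = 1 := by
  obtain ⟨i, hi, hi'⟩ := h
  rw [Finset.sum_eq_single i, ind_of_true hi]
  · intro j _ hj
    exact ind_of_false fun k => hj (hi' j k)
  · simp

end Indicator

/-! ### Weighted counts of labelled maps. -/

section Defs

variable {K : Type*} [CommRing K] (b : ℕ → K)

open Classical in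
/-- The weight of the cycles of `σ` other than that of `p`, a point on a cycle of length `n`
contributing `b n`. -/
noncomputable def weight {X : Type} [Fintype X] (σ : Perm X) (p : X) : K :=
  ∏ x, if cyc σ p x then 1 else b (len σ x)

/-- Involutions without fixed points. -/
def IsMatching {X : Type} (α : Perm X) : Prop := (∀ i, α (α i) = i) ∧ ∀ i, α i ≠ i

/-- The weighted number of planar maps with half-edges labelled by `H`, with one leg `none` on a
vertex of degree `l`, the leg included. -/
noncomputable def legSum (l : ℕ) (H : Type) [Fintype H] [DecidableEq H] : K :=
  ∑ σ : Perm (Option H), ∑ a : Perm H,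
    ind K (IsMatching a ∧ ConnectedPlanar σ (optionCongr a) ∧ len σ none = l) * weight b σ none

/-- The weighted number of rooted planar maps with half-edges labelled by `X`, with a root vertex
of degree `k`. -/
noncomputable def rootSum (k : ℕ) (X : Type) [Fintype X] [DecidableEq X] : K :=
  ∑ σ : Perm X, ∑ α : Perm X, ∑ r : X,
    ind K (IsMatching α ∧ ConnectedPlanar σ α ∧ len σ r = k) * weight b σ r

/-- The weighted number of rooted planar maps with half-edges labelled by `X`, with a root vertex
of degree `k` and with given root edge. -/
noncomputable def rootEdgeSum (k : ℕ) (X : Type) [Fintype X] [DecidableEq X] (r r' : X) : K :=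
  ∑ σ : Perm X, ∑ α : Perm X,
    ind K (IsMatching α ∧ α r = r' ∧ ConnectedPlanar σ α ∧ len σ r = k) * weight b σ r

end Defs

/-! ### From a leg to a root, and normalisation of the root edge. -/

section Basic

variable {K : Type*} [CommRing K] {b : ℕ → K}

theorem weight_congr {X : Type} [Fintype X] {σ : Perm X} {p q : X} (h : cyc σ p q) :
    weight b σ p = weight b σ q := by
  refine Finset.prod_congr rfl fun x _ => ?_
  have : cyc σ p x ↔ cyc σ q x :=
    ⟨fun k => Setoid.trans' _ (Setoid.symm' _ h) k, fun k => Setoid.trans' _ h k⟩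
  classical exact if_congr this rfl rfl

theorem weight_permCongr {X Y : Type} [Fintype X] [Fintype Y] (e : X ≃ Y) (σ : Perm X) (p : X) :
    weight b (e.permCongr σ) (e p) = weight b σ p := by
  symm
  refine Fintype.prod_equiv e _ _ fun x => ?_
  rw [len_permCongr]
  classical exact if_congr (cyc_permCongr e σ p x).symm rfl rfl

theorem weight_insertBefore {Y : Type} [Fintype Y] [DecidableEq Y] (y : Y) (σ : Perm Y) :
    weight b (insertBefore (some y) σ) none = weight b σ y := by
  have h : ∀ z, cyc (insertBefore (some y) σ) none z ↔ cyc σ y (z.getD y) := fun z => by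
    rw [cyc_insertBefore]; rfl
  rw [weight, Fintype.prod_option, if_pos (Setoid.refl' _ _), one_mul]
  refine Finset.prod_congr rfl fun x _ => ?_
  have h' := h (some x)
  rw [Option.getD_some] at h'
  by_cases k : cyc σ y x
  · rw [if_pos (h'.2 k), if_pos k]
  · rw [if_neg (h'.not.2 k), if_neg k, len_insertBefore_of_not_cyc k]

/-- The transposition merges the cycle of `y` into the marked cycle, whose points carry no weight;
the power is what these points contributed before. -/
theorem weight_of_not_cyc {X : Type} [Fintype X] [DecidableEq X] {σ : Perm X} {x y : X}
    (h : ¬ cyc σ x y) :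
    weight b σ x = b (len σ y) ^ len σ y * weight b (σ * swap x y) x := by
  classical
  have h1 : b (len σ y) ^ len σ y = ∏ z, if cyc σ y z then b (len σ y) else 1 := by
    rw [Finset.prod_ite, Finset.prod_const, Finset.prod_const_one, mul_one, len]
    congr 1
    rw [← Set.ncard_coe_finset]
    simp
  rw [h1, weight, weight, ← Finset.prod_mul_distrib]
  refine Finset.prod_congr rfl fun z _ => ?_
  have h2 : cyc (σ * swap x y) x z ↔ cyc σ x z ∨ cyc σ y z := by
    rw [cyc_mul_swap_eq_glue h]
    constructor
    · rintro (k | ⟨-, k⟩ | ⟨-, k⟩)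
      exacts [Or.inl k, Or.inr k, Or.inl k]
    · rintro (k | k)
      exacts [Or.inl k, Or.inr (Or.inl ⟨Setoid.refl' _ _, k⟩)]
  by_cases hx : cyc σ x z
  · have hy : ¬ cyc σ y z := fun k => h (Setoid.trans' _ hx (Setoid.symm' _ k))
    simp [h2, hx, hy]
  · by_cases hy : cyc σ y z
    · simp [h2, hx, hy, ← len_congr hy]
    · simp [h2, hx, hy, len_mul_swap_of_not hx hy]

theorem len_mul_swap_of_not_cyc {X : Type} [Finite X] [DecidableEq X] {σ : Perm X} {x y : X}
    (h : ¬ cyc σ x y) : len (σ * swap x y) x = len σ x + len σ y := by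
  have : {z | cyc (σ * swap x y) x z} = {z | cyc σ x z} ∪ {z | cyc σ y z} := by
    ext z
    rw [Set.mem_ofPred_eq, cyc_mul_swap_eq_glue h]
    constructor
    · rintro (k | ⟨-, k⟩ | ⟨-, k⟩)
      exacts [Or.inl k, Or.inr k, Or.inl k]
    · rintro (k | k)
      exacts [Or.inl k, Or.inr (Or.inl ⟨Setoid.refl' _ _, k⟩)]
  rw [len, this, Set.ncard_union_eq, len, len]
  rw [Set.disjoint_left]
  intro z hz hz'
  exact h (Setoid.trans' _ hz (Setoid.symm' _ hz'))

theorem isMatching_permCongr {X Y : Type} (e : X ≃ Y) {α : Perm X} :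
    IsMatching (e.permCongr α) ↔ IsMatching α := by
  constructor
  · rintro ⟨h, h'⟩
    exact ⟨fun i => by simpa using h (e i), fun i => by simpa using h' (e i)⟩
  · rintro ⟨h, h'⟩
    exact ⟨fun i => by simp [h], fun i => by simpa [← e.eq_symm_apply] using h' (e.symm i)⟩

theorem two_dvd_card_of_isMatching {X : Type} [Fintype X] {α : Perm X}
    (h : IsMatching α) : 2 ∣ Fintype.card X := by
  classical
  have h1 : α.support = Finset.univ := by
    ext x
    simp [h.2 x]
  have h2 := Perm.two_dvd_card_support (σ := α) (by ext x; simp [pow_two, h.1])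
  rwa [h1, Finset.card_univ] at h2

theorem len_optionCongr_none {Y : Type} (σ : Perm Y) : len (optionCongr σ) none = 1 := by
  rw [len, Set.ncard_eq_one]
  refine ⟨none, ?_⟩
  ext z
  rw [Set.mem_ofPred_eq, cyc_optionCongr]
  rcases z with _ | z
  · simp only [Set.mem_singleton_iff, iff_true]
    exact Setoid.refl' _ _
  · simp [optionSetoid_none]

theorem sum_perm_option {M Y : Type*} [AddCommMonoid M] [Fintype Y] [DecidableEq Y]
    (f : Perm (Option Y) → M) :
    ∑ σ, f σ = ∑ σ : Perm Y, f (optionCongr σ)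
      + ∑ σ : Perm Y, ∑ y, f (swap none (some y) * optionCongr σ) := by
  rw [← Equiv.sum_comp Perm.decomposeOption.symm f, Fintype.sum_prod_type, Fintype.sum_option,
    Finset.sum_comm]
  simp only [Perm.decomposeOption_symm_apply]
  congr 2
  ext σ
  rw [swap_self]
  rfl

theorem sum_perm_option' {M : Type*} {Y : Type} [AddCommMonoid M] [Fintype Y] [DecidableEq Y]
    (f : Perm (Option Y) → M) :
    ∑ σ, f σ = ∑ σ : Perm Y, f (optionCongr σ)
      + ∑ σ : Perm Y, ∑ y, f (insertBefore (some y) σ) :=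
  sum_perm_option f

variable {H : Type} [Fintype H] [DecidableEq H]

theorem legSum_zero : legSum b 0 H = 0 := by
  refine Finset.sum_eq_zero fun σ _ => Finset.sum_eq_zero fun a _ => ?_
  rw [ind_of_false, zero_mul]
  exact fun h => (len_pos σ none).ne' h.2.2

theorem legSum_eq_zero_of_lt {l : ℕ} (h : Fintype.card H + 1 < l) : legSum b l H = 0 := by
  refine Finset.sum_eq_zero fun σ _ => Finset.sum_eq_zero fun a _ => ?_
  rw [ind_of_false, zero_mul]
  rintro ⟨-, -, k⟩
  have := len_le σ none
  rw [Finite.card_option, Nat.card_eq_fintype_card] at this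
  omega

theorem legSum_eq_zero_of_odd {l : ℕ} (h : ¬ 2 ∣ Fintype.card H) : legSum b l H = 0 := by
  refine Finset.sum_eq_zero fun σ _ => Finset.sum_eq_zero fun a _ => ?_
  rw [ind_of_false, zero_mul]
  exact fun k => h (two_dvd_card_of_isMatching k.1)

/-- The half-edge that follows the leg becomes the root; it exists because the leg is not alone on
its vertex. -/
theorem legSum_succ {k : ℕ} (hk : k ≠ 0) : legSum b (k + 1) H = rootSum b k H := by
  rw [legSum, sum_perm_option', Finset.sum_eq_zero, zero_add]
  · refine Finset.sum_congr rfl fun σ _ => ?_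
    rw [Finset.sum_comm]
    refine Finset.sum_congr rfl fun α _ => Finset.sum_congr rfl fun r _ => ?_
    have : len (insertBefore (some r) σ) none = len σ r + 1 :=
      len_insertBefore_of_cyc (Setoid.refl' (cyc σ) r)
    rw [weight_insertBefore, connectedPlanar_insertBefore, this, Nat.add_right_cancel_iff]
  · intro σ _
    refine Finset.sum_eq_zero fun a _ => ?_
    rw [ind_of_false, zero_mul]
    rintro ⟨-, -, h⟩
    rw [len_optionCongr_none] at h
    omega

/-- A leg alone on its vertex leaves no room for an edge in a connected map. -/
theorem legSum_one : legSum b 1 H = ind K (IsEmpty H) := by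
  rw [legSum, sum_perm_option', add_comm, Finset.sum_eq_zero, zero_add]
  · by_cases h : IsEmpty H
    · rw [Fintype.sum_unique, Fintype.sum_unique, ind_of_true h, ind_of_true, one_mul, weight,
        Fintype.prod_option]
      · simp only [Finset.univ_eq_empty, Finset.prod_empty, mul_one]
        exact if_pos (Setoid.refl' _ _)
      · exact ⟨⟨isEmptyElim, isEmptyElim⟩, (connectedPlanar_optionCongr _ _).2 h,
          len_optionCongr_none _⟩
    · rw [ind_of_false h]
      refine Finset.sum_eq_zero fun σ _ => Finset.sum_eq_zero fun a _ => ?_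
      rw [ind_of_false, zero_mul]
      rintro ⟨-, k, -⟩
      exact h ((connectedPlanar_optionCongr _ _).1 k)
  · intro σ _
    refine Finset.sum_eq_zero fun y _ => Finset.sum_eq_zero fun a _ => ?_
    rw [ind_of_false, zero_mul]
    rintro ⟨-, -, h⟩
    have : len (insertBefore (some y) σ) none = len σ y + 1 :=
      len_insertBefore_of_cyc (Setoid.refl' (cyc σ) y)
    have := len_pos σ y
    omega

theorem optionCongr_permCongr {X Y : Type} (e : X ≃ Y) (σ : Perm X) :
    optionCongr (e.permCongr σ) = (optionCongr e).permCongr (optionCongr σ) := by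
  ext1 (_ | x) <;> rfl

theorem legSum_congr {H' : Type} [Fintype H'] [DecidableEq H'] (e : H ≃ H') (l : ℕ) :
    legSum b l H = legSum b l H' := by
  refine Fintype.sum_equiv (optionCongr e).permCongr _ _ fun σ => ?_
  refine Fintype.sum_equiv e.permCongr _ _ fun a => ?_
  have h1 := len_permCongr (optionCongr e) σ none
  have h2 := weight_permCongr (b := b) (optionCongr e) σ none
  rw [optionCongr_apply, Option.map_none] at h1 h2
  rw [h1, h2, isMatching_permCongr, optionCongr_permCongr, connectedPlanar_permCongr]

theorem rootEdgeSum_congr {X Y : Type} [Fintype X] [DecidableEq X] [Fintype Y] [DecidableEq Y]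
    (e : X ≃ Y) (k : ℕ) (r r' : X) :
    rootEdgeSum b k X r r' = rootEdgeSum b k Y (e r) (e r') := by
  refine Fintype.sum_equiv e.permCongr _ _ fun σ => ?_
  refine Fintype.sum_equiv e.permCongr _ _ fun a => ?_
  rw [len_permCongr, weight_permCongr, isMatching_permCongr, connectedPlanar_permCongr,
    permCongr_apply, symm_apply_apply, e.apply_eq_iff_eq]

theorem rootEdgeSum_self {X : Type} [Fintype X] [DecidableEq X] (k : ℕ) (r : X) :
    rootEdgeSum b k X r r = 0 := by
  refine Finset.sum_eq_zero fun σ _ => Finset.sum_eq_zero fun a _ => ?_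
  rw [ind_of_false, zero_mul]
  exact fun h => h.1.2 r h.2.1

theorem rootSum_eq_sum_rootEdgeSum {X : Type} [Fintype X] [DecidableEq X] (k : ℕ) :
    rootSum b k X = ∑ r, ∑ r', rootEdgeSum b k X r r' := by
  have h : ∀ r, ∑ r', rootEdgeSum b k X r r' = ∑ σ : Perm X, ∑ α : Perm X,
      ind K (IsMatching α ∧ ConnectedPlanar σ α ∧ len σ r = k) * weight b σ r := by
    intro r
    simp only [rootEdgeSum]
    rw [Finset.sum_comm]
    refine Finset.sum_congr rfl fun σ _ => ?_
    rw [Finset.sum_comm]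
    refine Finset.sum_congr rfl fun α _ => ?_
    rw [Finset.sum_eq_single (α r)]
    · rw [ind_congr]; tauto
    · intro r' _ hr
      rw [ind_of_false, zero_mul]
      exact fun h => hr h.2.1.symm
    · simp
  simp only [h]
  rw [Finset.sum_comm]
  refine Finset.sum_congr rfl fun σ _ => Finset.sum_comm

theorem exists_equiv_option_option {X : Type} [Fintype X] [DecidableEq X]
    (hX : Fintype.card X = Fintype.card H + 2) {r r' : X} (h : r ≠ r') :
    ∃ e : X ≃ Option (Option H), e r = some none ∧ e r' = none := by
  have e₀ : X ≃ Option (Option H) := Fintype.equivOfCardEq (by simp [hX])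
  let e₁ := e₀.trans (swap (e₀ r') none)
  have h1 : e₁ r' = none := by simp [e₁]
  have h2 : e₁ r ≠ none := fun k => h (e₁.injective (k.trans h1.symm))
  obtain ⟨u, hu⟩ := Option.ne_none_iff_exists'.1 h2
  refine ⟨e₁.trans (optionCongr (swap u none)), ?_, ?_⟩
  · simp [hu]
  · simp [h1, swap_apply_of_ne_of_ne]

/-- A relabelling brings any ordered pair of distinct half-edges into standard position, so every
choice of root edge contributes equally. -/
theorem rootSum_eq_mul {X : Type} [Fintype X] [DecidableEq X]
    (hX : Fintype.card X = Fintype.card H + 2) (k : ℕ) :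
    rootSum b k X = ((Fintype.card H + 2 : ℕ) : K) * ((Fintype.card H + 1 : ℕ) : K)
      * rootEdgeSum b k (Option (Option H)) (some none) none := by
  have h : ∀ r : X, ∑ r', rootEdgeSum b k X r r'
      = ((Fintype.card H + 1 : ℕ) : K) * rootEdgeSum b k (Option (Option H)) (some none) none := by
    intro r
    rw [← Finset.sum_erase (Finset.univ) (rootEdgeSum_self k r)]
    have : ∀ r' ∈ Finset.univ.erase r, rootEdgeSum b k X r r'
        = rootEdgeSum b k (Option (Option H)) (some none) none := by
      intro r' hr'
      obtain ⟨e, h1, h2⟩ := exists_equiv_option_option hX (Finset.ne_of_mem_erase hr').symm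
      rw [rootEdgeSum_congr e, h1, h2]
    rw [Finset.sum_congr rfl this, Finset.sum_const, Finset.card_erase_of_mem (Finset.mem_univ _),
      Finset.card_univ, hX, nsmul_eq_mul]
    rfl
  rw [rootSum_eq_sum_rootEdgeSum]
  simp only [h]
  rw [Finset.sum_const, Finset.card_univ, hX, nsmul_eq_mul, mul_assoc]

end Basic

end PlanarCensus

namespace PlanarCensus

open Equiv

/-! ### Contracting the root edge: the case of two distinct ends. -/

section EdgeRemoval

variable {K : Type*} [CommRing K] {b : ℕ → K} {H : Type} [Fintype H] [DecidableEq H]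

theorem eq_optionCongr_of_apply_none {Y : Type} [DecidableEq Y] {σ : Perm (Option Y)}
    (h : σ none = none) : ∃ a : Perm Y, σ = optionCongr a := by
  refine ⟨removeNone σ, ?_⟩
  rw [map_equiv_removeNone, h, swap_self]
  rfl

theorem swap_apply_some_some {H : Type} [DecidableEq H] (h : H) :
    swap (some none : Option (Option H)) none (some (some h)) = some (some h) :=
  swap_apply_of_ne_of_ne (by simp) (by simp)

theorem isMatching_mul_swap_iff {H : Type} [DecidableEq H] {a : Perm H} :
    IsMatching (optionCongr (optionCongr a) * swap (some none) none) ↔ IsMatching a := by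
  constructor
  · rintro ⟨h, h'⟩
    constructor
    · intro i
      have := h (some (some i))
      simpa [swap_apply_some_some] using this
    · intro i
      have := h' (some (some i))
      simpa [swap_apply_some_some] using this
  · rintro ⟨h, h'⟩
    constructor
    · rintro (_ | _ | i) <;> simp [swap_apply_some_some, h]
    · rintro (_ | _ | i) <;> simp [swap_apply_some_some, h']

theorem sum_matching_of_edge (f : Perm (Option (Option H)) → K) :
    ∑ α, ind K (IsMatching α ∧ α (some none) = none) * f α
      = ∑ a : Perm H, ind K (IsMatching a) *
          f (optionCongr (optionCongr a) * swap (some none) none) := by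
  symm
  refine Finset.sum_of_injOn
    (fun a : Perm H => optionCongr (optionCongr a) * swap (some none) none) ?_ ?_ ?_ ?_
  · intro a _ a' _ h
    exact optionCongr_injective (optionCongr_injective (mul_right_cancel h))
  · intro _ _
    simp
  · intro α _ hα
    rw [ind_of_false, zero_mul]
    rintro ⟨h, h'⟩
    apply hα
    have h1 : (α * swap (some none) none : Perm (Option (Option H))) none = none := by simp [h']
    have h2 : α none = some none := by rw [← h', h.1]
    obtain ⟨β, hβ⟩ := eq_optionCongr_of_apply_none h1
    have h3 : β none = none := by
      have : optionCongr β (some none) = some none := by rw [← hβ]; simp [h2]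
      simpa using this
    obtain ⟨a, rfl⟩ := eq_optionCongr_of_apply_none h3
    refine ⟨a, by simp, ?_⟩
    simp only [← hβ, mul_assoc, swap_mul_self, mul_one]
  · intro a _
    congr 1
    apply ind_congr
    rw [isMatching_mul_swap_iff]
    simp

/-- Steps are counted from `1` to the length, the last one returning to `p`, because the number of
steps will be the degree of a vertex. -/
theorem sum_of_cyc {X : Type} [Fintype X] (σ : Perm X) (p : X) (f : X → K) :
    ∑ y, ind K (cyc σ p y) * f y = ∑ n ∈ Finset.Icc 1 (len σ p), f ((σ ^ n) p) := by
  symm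
  refine Finset.sum_of_injOn (fun n => (σ ^ n) p) ?_ ?_ ?_ ?_
  · intro i hi j hj h
    rw [Finset.mem_coe, Finset.mem_Icc] at hi hj
    obtain ⟨i, rfl⟩ : ∃ i', i = i' + 1 := ⟨i - 1, by omega⟩
    obtain ⟨j, rfl⟩ : ∃ j', j = j' + 1 := ⟨j - 1, by omega⟩
    simp only [pow_succ', Perm.mul_apply] at h
    have := pow_injOn_len σ p (show i < len σ p by omega) (show j < len σ p by omega)
      (σ.injective h)
    omega
  · intro _ _
    simp
  · intro y _ hy
    rw [ind_of_false, zero_mul]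
    intro h
    apply hy
    obtain ⟨n, hn, rfl⟩ := (cyc_iff_exists_lt_len σ p y).1 h
    rcases Nat.eq_zero_or_pos n with rfl | h0
    · refine ⟨len σ p, ?_, ?_⟩
      · rw [Finset.mem_coe, Finset.mem_Icc]
        omega
      · simp [pow_len_apply]
    · refine ⟨n, ?_, rfl⟩
      rw [Finset.mem_coe, Finset.mem_Icc]
      omega
  · intro n _
    rw [ind_of_true, one_mul]
    exact ⟨n, by simp⟩

/-- The leg `none` inserted before the `n`-th element after `p` comes `n` steps after `some p`. -/
theorem insertBefore_pow_apply {X : Type} [Fintype X] [DecidableEq X] (σ : Perm X) (p : X) {n : ℕ}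
    (hn : 1 ≤ n) (hn' : n ≤ len σ p) :
    (insertBefore (some ((σ ^ n) p)) σ ^ n) (some p) = none := by
  have h : ∀ i < n, (insertBefore (some ((σ ^ n) p)) σ ^ i) (some p) = some ((σ ^ i) p) := by
    intro i
    induction i with
    | zero => intro _; rfl
    | succ i ih =>
      intro hi
      rw [pow_succ', Perm.mul_apply, ih (by omega), insertBefore_some_apply_of_ne, pow_succ',
        Perm.mul_apply]
      rw [← Perm.mul_apply, ← pow_succ', Ne, Option.some.injEq]
      intro k
      obtain ⟨n, rfl⟩ : ∃ n', n = n' + 1 := ⟨n - 1, by omega⟩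
      simp only [pow_succ', Perm.mul_apply] at k
      have := pow_injOn_len σ p (show i < len σ p by omega) (show n < len σ p by omega)
        (σ.injective k)
      omega
  obtain ⟨n, rfl⟩ : ∃ n', n = n' + 1 := ⟨n - 1, by omega⟩
  rw [pow_succ', Perm.mul_apply, h n (by omega)]
  have : (σ ^ (n + 1)) p = σ ((σ ^ n) p) := by rw [pow_succ', Perm.mul_apply]
  rw [this, insertBefore_some_apply_of_eq]

/-- The weight depends only on the marked cycle, which also contains the new leg. -/
theorem weight_insertBefore_some {Y : Type} [Fintype Y] [DecidableEq Y] {y p : Y} {σ : Perm Y}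
    (h : cyc σ p y) : weight b (insertBefore (some y) σ) (some p) = weight b σ p := by
  rw [weight_congr h, ← weight_insertBefore y σ]
  apply weight_congr
  rw [cyc_insertBefore]
  exact h

/-- The contribution of the maps whose root edge is not a loop. -/
theorem sum_not_loop (a : Perm H) {k : ℕ} (hk : k ≠ 0) :
    ∑ σ : Perm (Option (Option H)),
        ind K (cyc σ (some none) none ∧ ConnectedPlanar σ (optionCongr (optionCongr a)) ∧
          len (σ * swap (some none) none) (some none) = k)
        * weight b (σ * swap (some none) none) (some none)
      = ∑ n ∈ Finset.Icc 1 (Fintype.card H + 1), b n ^ n * ∑ σ : Perm (Option H),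
          ind K (ConnectedPlanar σ (optionCongr a) ∧ len σ none = k + n - 1)
            * weight b σ none := by
  rw [sum_perm_option', Finset.sum_eq_zero, zero_add]
  swap
  · intro σ _
    rw [ind_of_false, zero_mul]
    rintro ⟨h, -⟩
    rw [cyc_optionCongr] at h
    exact optionSetoid_none _ _ (Setoid.symm' _ h)
  simp only [Finset.mul_sum]
  rw [Finset.sum_comm (s := Finset.Icc 1 _)]
  refine Finset.sum_congr rfl fun σ _ => ?_
  have hlen : len σ none ≤ Fintype.card H + 1 := by
    have := len_le σ none
    rwa [Finite.card_option, Nat.card_eq_fintype_card] at this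
  have h1 : ∀ y : Option H, ind K (cyc (insertBefore (some y) σ) (some none) none ∧
        ConnectedPlanar (insertBefore (some y) σ) (optionCongr (optionCongr a)) ∧
        len (insertBefore (some y) σ * swap (some none) none) (some none) = k)
        * weight b (insertBefore (some y) σ * swap (some none) none) (some none)
      = ind K (cyc σ none y) * (ind K (ConnectedPlanar σ (optionCongr a)) *
        (ind K (len (insertBefore (some y) σ * swap (some none) none) (some none) = k)
        * weight b (insertBefore (some y) σ * swap (some none) none) (some none))) := by
    intro y
    have : cyc (insertBefore (some y) σ) (some none) none ↔ cyc σ none y := by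
      rw [cyc_insertBefore]
      rfl
    rw [connectedPlanar_insertBefore, this, ind_and, ind_and]
    ring
  rw [Finset.sum_congr rfl fun y _ => h1 y, sum_of_cyc]
  -- The range of `n` is made independent of `σ`: since `k ≥ 1`, the equality `len σ none = k + n -
  -- 1` already forces `n ≤ len σ none`.
  rw [← Finset.sum_subset (Finset.Icc_subset_Icc_right hlen)]
  · refine Finset.sum_congr rfl fun n hn => ?_
    rw [Finset.mem_Icc] at hn
    set y := (σ ^ n) none with hy
    set σ₁ := insertBefore (some y) σ with hσ₁
    have hyc : cyc σ none y := ⟨n, by simp [hy]⟩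
    have e1 : (σ₁ ^ n) (some none) = none := insertBefore_pow_apply σ none hn.1 hn.2
    have e2 : len σ₁ (some none) = len σ none + 1 := by
      rw [hσ₁, len_insertBefore_of_cyc (Setoid.symm' _ hyc), len_congr hyc]
    have e3 := len_mul_swap_pow σ₁ (some none) hn.1 (by omega)
    rw [e1] at e3
    have e4 : cyc σ₁ (some none) none := by
      rw [hσ₁, cyc_insertBefore]
      exact hyc
    have e5 := not_cyc_mul_swap (by simp) e4
    -- Here `n` is the degree of the lost end and `k` that of the root vertex. The contracted vertex
    -- with both legs has degree `k + n`, hence `k + n - 1` once the leg `none` is forgotten.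
    have e6 := len_mul_swap_of_not_cyc e5
    have e7 := weight_of_not_cyc (b := b) e5
    rw [mul_assoc, swap_mul_self, mul_one] at e6 e7
    rw [e7, e3, hσ₁, weight_insertBefore_some hyc, ← hσ₁, ind_and]
    have e8 : len (σ₁ * swap (some none) none) (some none) = k ↔ len σ none = k + n - 1 := by
      omega
    rw [ind_congr e8]
    ring
  · intro n hn' hn
    rw [ind_of_false, zero_mul, mul_zero]
    rintro ⟨-, h⟩
    rw [Finset.mem_Icc] at hn hn'
    omega

/-- The contracted map is taken as summation variable: the original vertex permutation is `σ` times
the transposition, and its edge permutation is a matching of `H` times the same transposition.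
`connectedPlanar_mul_swap_iff` then separates the ordinary edges from the loops. -/
theorem rootEdgeSum_eq {k : ℕ} (hk : k ≠ 0) :
    rootEdgeSum b k (Option (Option H)) (some none) none
      = ∑ n ∈ Finset.Icc 1 (Fintype.card H + 1), b n ^ n * legSum b (k + n - 1) H
        + ∑ σ : Perm (Option (Option H)), ∑ a : Perm H,
          ind K (IsMatching a ∧ ¬ orb σ (optionCongr (optionCongr a)) (some none) none ∧
            (∀ z, orb σ (optionCongr (optionCongr a)) (some none) z ∨
              orb σ (optionCongr (optionCongr a)) none z) ∧
            numClasses (cyc σ) + numClasses (cyc (optionCongr (optionCongr a)))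
              + numClasses (cyc (σ * optionCongr (optionCongr a))) = Fintype.card H + 6 ∧
            len σ (some none) + len σ none = k)
          * weight b (σ * swap (some none) none) (some none) := by
  have h1 : rootEdgeSum b k (Option (Option H)) (some none) none
      = ∑ a : Perm H, ind K (IsMatching a) * ∑ σ : Perm (Option (Option H)),
        ind K (ConnectedPlanar (σ * swap (some none) none)
            (optionCongr (optionCongr a) * swap (some none) none) ∧
          len (σ * swap (some none) none) (some none) = k) *
          weight b (σ * swap (some none) none) (some none) := by
    rw [rootEdgeSum, ← Equiv.sum_comp (Equiv.mulRight (swap (some none) none)), Finset.sum_comm]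
    rw [← sum_matching_of_edge fun α => ∑ σ : Perm (Option (Option H)),
      ind K (ConnectedPlanar (σ * swap (some none) none) α ∧
        len (σ * swap (some none) none) (some none) = k) *
        weight b (σ * swap (some none) none) (some none)]
    refine Finset.sum_congr rfl fun α _ => ?_
    rw [Finset.mul_sum]
    refine Finset.sum_congr rfl fun σ _ => ?_
    rw [coe_mulRight, ← mul_assoc, ← ind_and]
    congr 1
    apply ind_congr
    tauto
  rw [h1, Finset.sum_comm (γ := Perm (Option (Option H)))]
  have h2 : ∑ n ∈ Finset.Icc 1 (Fintype.card H + 1), b n ^ n * legSum b (k + n - 1) H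
      = ∑ a : Perm H, ind K (IsMatching a) * ∑ n ∈ Finset.Icc 1 (Fintype.card H + 1),
        b n ^ n * ∑ σ : Perm (Option H),
          ind K (ConnectedPlanar σ (optionCongr a) ∧ len σ none = k + n - 1)
            * weight b σ none := by
    simp only [Finset.mul_sum, legSum]
    rw [Finset.sum_comm (s := (Finset.univ : Finset (Perm H)))]
    refine Finset.sum_congr rfl fun n _ => ?_
    rw [Finset.sum_comm]
    refine Finset.sum_congr rfl fun a _ => Finset.sum_congr rfl fun σ _ => ?_
    rw [ind_and]
    ring
  rw [h2, ← Finset.sum_add_distrib]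
  refine Finset.sum_congr rfl fun a _ => ?_
  rw [← sum_not_loop a hk, Finset.mul_sum, Finset.mul_sum, ← Finset.sum_add_distrib]
  refine Finset.sum_congr rfl fun σ _ => ?_
  rw [connectedPlanar_mul_swap_iff (by simp) (by simp) (by simp)]
  have hcard : Nat.card (Option (Option H)) + 4 = Fintype.card H + 6 := by
    rw [Finite.card_option, Finite.card_option, Nat.card_eq_fintype_card]
  rw [hcard, or_and_right, ind_or, add_mul, mul_add, ind_and (IsMatching a), mul_assoc (ind K _),
    and_assoc]
  · congr 2
    refine ind_mul_congr ?_ fun _ => rfl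
    have : ¬ orb σ (optionCongr (optionCongr a)) (some none) none →
        (len (σ * swap (some none) none) (some none) = k ↔
          len σ (some none) + len σ none = k) := by
      intro h
      rw [len_mul_swap_of_not_cyc fun h' => h (cyc_le_orb_left _ _ h')]
    tauto
  · rintro ⟨⟨h, -⟩, ⟨h', -⟩, -⟩
    exact h' (cyc_le_orb_left _ _ h.1)

end EdgeRemoval

end PlanarCensus

namespace PlanarCensus

open Equiv

/-! ### Contracting the root edge: the case of a loop. -/

section Loop

variable {K : Type*} [CommRing K] {b : ℕ → K} {H H₁ H₂ : Type}

/-- The half-edges of two maps with one leg each, the legs being `some none` and `none`. -/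
def legsEquiv (e : H₁ ⊕ H₂ ≃ H) : Option H₁ ⊕ Option H₂ ≃ Option (Option H) where
  toFun := Sum.elim (fun o => some (o.map (e ∘ Sum.inl))) (fun o => o.map (some ∘ e ∘ Sum.inr))
  invFun
    | none => .inr none
    | some none => .inl none
    | some (some h) => Sum.map some some (e.symm h)
  left_inv := by rintro ((_ | h) | (_ | h)) <;> simp
  right_inv := by
    rintro (_ | _ | h)
    · rfl
    · rfl
    · obtain ⟨u | u, rfl⟩ := e.surjective h <;> simp

theorem legsEquiv_inl_none (e : H₁ ⊕ H₂ ≃ H) : legsEquiv e (.inl none) = some none := rfl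

theorem legsEquiv_inr_none (e : H₁ ⊕ H₂ ≃ H) : legsEquiv e (.inr none) = none := rfl

theorem legsEquiv_inl_some (e : H₁ ⊕ H₂ ≃ H) (u : H₁) :
    legsEquiv e (.inl (some u)) = some (some (e (.inl u))) := rfl

theorem legsEquiv_inr_some (e : H₁ ⊕ H₂ ≃ H) (u : H₂) :
    legsEquiv e (.inr (some u)) = some (some (e (.inr u))) := rfl

theorem optionCongr_optionCongr_permCongr (e : H₁ ⊕ H₂ ≃ H) (a₁ : Perm H₁) (a₂ : Perm H₂) :
    optionCongr (optionCongr (e.permCongr (Perm.sumCongr a₁ a₂)))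
      = (legsEquiv e).permCongr (Perm.sumCongr (optionCongr a₁) (optionCongr a₂)) := by
  ext1 x
  obtain ⟨x, rfl⟩ := (legsEquiv e).surjective x
  rw [permCongr_apply, symm_apply_apply]
  rcases x with (_ | u) | (_ | u)
  · rfl
  · rw [legsEquiv_inl_some]
    simp [legsEquiv_inl_some]
  · rfl
  · rw [legsEquiv_inr_some]
    simp [legsEquiv_inr_some]

theorem isMatching_sumCongr {a₁ : Perm H₁} {a₂ : Perm H₂} :
    IsMatching (Perm.sumCongr a₁ a₂) ↔ IsMatching a₁ ∧ IsMatching a₂ := by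
  simp only [IsMatching, Sum.forall, Perm.sumCongr_apply, Sum.map_inl, Sum.map_inr,
    Sum.inl.injEq, Sum.inr.injEq, ne_eq]
  tauto

variable [Fintype H] [DecidableEq H] [Fintype H₁] [DecidableEq H₁] [Fintype H₂] [DecidableEq H₂]

theorem weight_sumCongr_mul_swap {H₁ H₂ : Type} [Fintype H₁] [Fintype H₂] [DecidableEq (H₁ ⊕ H₂)] (σ₁ : Perm H₁) (σ₂ : Perm H₂) (p : H₁)
    (q : H₂) : weight b (Perm.sumCongr σ₁ σ₂ * swap (.inl p) (.inr q)) (.inl p)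
      = weight b σ₁ p * weight b σ₂ q := by
  have h : ¬ cyc (Perm.sumCongr σ₁ σ₂) (.inl p) (.inr q) := by
    rw [cyc_sumCongr]
    exact sumSetoid_inl_inr _ _ _ _
  have h1 : ∀ z, cyc (Perm.sumCongr σ₁ σ₂ * swap (.inl p) (.inr q)) (.inl p) z ↔
      sumSetoid (cyc σ₁) (cyc σ₂) (.inl p) z ∨ sumSetoid (cyc σ₁) (cyc σ₂) (.inr q) z := by
    intro z
    rw [cyc_mul_swap_eq_glue h, cyc_sumCongr]
    constructor
    · rintro (k | ⟨-, k⟩ | ⟨-, k⟩)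
      exacts [Or.inl k, Or.inr k, Or.inl k]
    · rintro (k | k)
      exacts [Or.inl k, Or.inr (Or.inl ⟨Setoid.refl' _ _, k⟩)]
  rw [weight, Fintype.prod_sum_type]
  congr 1
  · refine Finset.prod_congr rfl fun z _ => ?_
    have h2 := h1 (.inl z)
    rw [sumSetoid_inl, or_iff_left (sumSetoid_inr_inl _ _ _ _)] at h2
    by_cases k : cyc σ₁ p z
    · rw [if_pos (h2.2 k), if_pos k]
    · rw [if_neg (h2.not.2 k), if_neg k, len_mul_swap_of_not, len_sumCongr_inl]
      · rwa [cyc_sumCongr, sumSetoid_inl]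
      · rw [cyc_sumCongr]
        exact sumSetoid_inr_inl _ _ _ _
  · refine Finset.prod_congr rfl fun z _ => ?_
    have h2 := h1 (.inr z)
    rw [sumSetoid_inr, or_iff_right (sumSetoid_inl_inr _ _ _ _)] at h2
    by_cases k : cyc σ₂ q z
    · rw [if_pos (h2.2 k), if_pos k]
    · rw [if_neg (h2.not.2 k), if_neg k, len_mul_swap_of_not, len_sumCongr_inr]
      · rw [cyc_sumCongr]
        exact sumSetoid_inl_inr _ _ _ _
      · rwa [cyc_sumCongr, sumSetoid_inr]

/-- The conditions on the pair of planar maps obtained by contracting a root edge which is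
a loop. -/
def SplitCondition (k : ℕ) (σ : Perm (Option (Option H))) (a : Perm H) : Prop :=
  IsMatching a ∧ ¬ orb σ (optionCongr (optionCongr a)) (some none) none ∧
    (∀ z, orb σ (optionCongr (optionCongr a)) (some none) z ∨
      orb σ (optionCongr (optionCongr a)) none z) ∧
    numClasses (cyc σ) + numClasses (cyc (optionCongr (optionCongr a)))
      + numClasses (cyc (σ * optionCongr (optionCongr a))) = Fintype.card H + 6 ∧
    len σ (some none) + len σ none = k

theorem sum_antidiagonal_legSum_mul (k : ℕ) :
    ∑ p ∈ Finset.HasAntidiagonal.antidiagonal k, legSum b p.1 H₁ * legSum b p.2 H₂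
      = ∑ x : (Perm (Option H₁) × Perm H₁) × (Perm (Option H₂) × Perm H₂),
        ind K ((IsMatching x.1.2 ∧ IsMatching x.2.2) ∧
          (ConnectedPlanar x.1.1 (optionCongr x.1.2) ∧ ConnectedPlanar x.2.1 (optionCongr x.2.2)) ∧
          len x.1.1 none + len x.2.1 none = k)
          * (weight b x.1.1 none * weight b x.2.1 none) := by
  have h : ∀ (l : ℕ) (H : Type) [Fintype H] [DecidableEq H], legSum b l H
      = ∑ x : Perm (Option H) × Perm H, ind K (IsMatching x.2 ∧
        ConnectedPlanar x.1 (optionCongr x.2) ∧ len x.1 none = l) * weight b x.1 none := by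
    intro l H _ _
    rw [Fintype.sum_prod_type]
    rfl
  rw [Fintype.sum_prod_type]
  simp only [h, Finset.sum_mul_sum]
  rw [Finset.sum_comm]
  refine Finset.sum_congr rfl fun x _ => ?_
  rw [Finset.sum_comm]
  refine Finset.sum_congr rfl fun y _ => ?_
  have h1 : ∀ p : ℕ × ℕ, ind K (IsMatching x.2 ∧ ConnectedPlanar x.1 (optionCongr x.2) ∧
      len x.1 none = p.1) * weight b x.1 none * (ind K (IsMatching y.2 ∧
        ConnectedPlanar y.1 (optionCongr y.2) ∧ len y.1 none = p.2) * weight b y.1 none)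
      = ind K ((IsMatching x.2 ∧ IsMatching y.2) ∧
        (ConnectedPlanar x.1 (optionCongr x.2) ∧ ConnectedPlanar y.1 (optionCongr y.2)))
        * (weight b x.1 none * weight b y.1 none) * ind K ((len x.1 none, len y.1 none) = p) := by
    intro p
    rw [← Prod.mk.eta (p := p), Prod.mk.injEq]
    simp only [ind_and]
    ring
  rw [Finset.sum_congr rfl fun p _ => h1 p, ← Finset.mul_sum]
  have h2 : ∑ p ∈ Finset.HasAntidiagonal.antidiagonal k, ind K ((len x.1 none, len y.1 none) = p)
      = ind K (len x.1 none + len y.1 none = k) := by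
    by_cases hk : len x.1 none + len y.1 none = k
    · rw [ind_of_true hk, Finset.sum_eq_single (len x.1 none, len y.1 none), ind_of_true rfl]
      · intro p _ hp
        exact ind_of_false fun k => hp k.symm
      · intro h
        exact (h (Finset.HasAntidiagonal.mem_antidiagonal.2 hk)).elim
    · rw [ind_of_false hk]
      refine Finset.sum_eq_zero fun p hp => ind_of_false ?_
      rintro rfl
      exact hk (Finset.HasAntidiagonal.mem_antidiagonal.1 hp)
  rw [h2]
  simp only [ind_and]
  ring

/-- In a disjoint union, the two leg components cover everything exactly when each summand is
connected, and the Euler count then makes both planar. The first clause fixes which half-edges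
belong to the component of the leg `some none`. -/
theorem splitCondition_iff {H H₁ H₂ : Type} [Fintype H] [Fintype H₁] [Fintype H₂] (e : H₁ ⊕ H₂ ≃ H) (k : ℕ) (σ₁ : Perm (Option H₁)) (a₁ : Perm H₁)
    (σ₂ : Perm (Option H₂)) (a₂ : Perm H₂) :
    ((∀ h, (∃ u, e (.inl u) = h) ↔ orb ((legsEquiv e).permCongr (Perm.sumCongr σ₁ σ₂))
        (optionCongr (optionCongr (e.permCongr (Perm.sumCongr a₁ a₂)))) (some none)
          (some (some h))) ∧
      SplitCondition k ((legsEquiv e).permCongr (Perm.sumCongr σ₁ σ₂))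
        (e.permCongr (Perm.sumCongr a₁ a₂))) ↔
    (IsMatching a₁ ∧ IsMatching a₂) ∧
      (ConnectedPlanar σ₁ (optionCongr a₁) ∧ ConnectedPlanar σ₂ (optionCongr a₂)) ∧
      len σ₁ none + len σ₂ none = k := by
  have hcard : Nat.card (Option H₁ ⊕ Option H₂) + 4 = Fintype.card H + 6 := by
    rw [Nat.card_congr (legsEquiv e), Finite.card_option, Finite.card_option,
      Nat.card_eq_fintype_card]
  have top : ∀ {X : Type} (s : Setoid (Option X)), s = ⊤ ↔ ∀ z, s none z := by
    intro X s
    rw [Setoid.eq_top_iff]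
    exact ⟨fun h z => h _ _, fun h x y => s.trans' (s.symm' (h x)) (h y)⟩
  have l1 := len_permCongr (legsEquiv e) (Perm.sumCongr σ₁ σ₂) (.inl none)
  have l2 := len_permCongr (legsEquiv e) (Perm.sumCongr σ₁ σ₂) (.inr none)
  rw [legsEquiv_inl_none, len_sumCongr_inl] at l1
  rw [legsEquiv_inr_none, len_sumCongr_inr] at l2
  rw [SplitCondition, optionCongr_optionCongr_permCongr, isMatching_permCongr, isMatching_sumCongr,
    permCongr_mul', cyc_permCongr_eq, cyc_permCongr_eq, cyc_permCongr_eq,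
    numClasses_comap (legsEquiv e).symm.surjective, numClasses_comap (legsEquiv e).symm.surjective,
    numClasses_comap (legsEquiv e).symm.surjective, l1, l2, connectedPlanar_sumCongr_iff, hcard,
    orb_permCongr_eq, orb_sumCongr, top, top]
  set s₁ := orb σ₁ (optionCongr a₁)
  set s₂ := orb σ₂ (optionCongr a₂)
  have i1 : ∀ o, (legsEquiv e).symm (some (o.map (e ∘ Sum.inl))) = Sum.inl o := fun o =>
    (legsEquiv e).symm_apply_apply (.inl o)
  have i2 : ∀ o, (legsEquiv e).symm (o.map (some ∘ e ∘ Sum.inr)) = Sum.inr o := fun o =>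
    (legsEquiv e).symm_apply_apply (.inr o)
  have j1 : (legsEquiv e).symm (some none) = .inl none := rfl
  have j2 : (legsEquiv e).symm none = .inr none := rfl
  simp only [Setoid.comap_rel, j1, j2]
  have hz : (∀ z, sumSetoid s₁ s₂ (.inl none) ((legsEquiv e).symm z) ∨
      sumSetoid s₁ s₂ (.inr none) ((legsEquiv e).symm z)) ↔
      (∀ z, s₁ none z) ∧ ∀ z, s₂ none z := by
    rw [(legsEquiv e).symm.forall_congr_left]
    simp only [symm_symm, symm_apply_apply, Sum.forall, sumSetoid_inl, sumSetoid_inr,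
      sumSetoid_inl_inr, sumSetoid_inr_inl, or_false, false_or]
  have hh : (∀ z, s₁ none z) → ∀ h, (∃ u, e (.inl u) = h) ↔
      sumSetoid s₁ s₂ (.inl none) ((legsEquiv e).symm (some (some h))) := by
    intro hs h
    obtain ⟨u | u, rfl⟩ := e.surjective h
    · have := i1 (some u)
      simp only [Option.map_some, Function.comp_apply] at this
      rw [this, sumSetoid_inl]
      simp [hs]
    · have := i2 (some u)
      simp only [Option.map_some, Function.comp_apply] at this
      rw [this]
      simp [sumSetoid_inl_inr]
  have hn : ¬ sumSetoid s₁ s₂ (.inl none) (.inr none) := sumSetoid_inl_inr _ _ _ _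
  rw [hz]
  tauto

theorem sum_splitCondition (e : H₁ ⊕ H₂ ≃ H) (k : ℕ) :
    ∑ x : Perm (Option (Option H)) × Perm H,
      ind K ((∀ h, (∃ u, e (.inl u) = h) ↔
        orb x.1 (optionCongr (optionCongr x.2)) (some none) (some (some h))) ∧
        SplitCondition k x.1 x.2) * weight b (x.1 * swap (some none) none) (some none)
      = ∑ p ∈ Finset.HasAntidiagonal.antidiagonal k, legSum b p.1 H₁ * legSum b p.2 H₂ := by
  rw [sum_antidiagonal_legSum_mul]
  symm
  refine Finset.sum_of_injOn (fun x => ((legsEquiv e).permCongr (Perm.sumCongr x.1.1 x.2.1),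
    e.permCongr (Perm.sumCongr x.1.2 x.2.2))) ?_ ?_ ?_ ?_
  · rintro ⟨⟨σ₁, a₁⟩, σ₂, a₂⟩ _ ⟨⟨σ₁', a₁'⟩, σ₂', a₂'⟩ _ h
    simp only [Prod.mk.injEq, EmbeddingLike.apply_eq_iff_eq] at h
    have h1 := Perm.sumCongrHom_injective (a₁ := (σ₁, σ₂)) (a₂ := (σ₁', σ₂')) h.1
    have h2 := Perm.sumCongrHom_injective (a₁ := (a₁, a₂)) (a₂ := (a₁', a₂')) h.2
    simp only [Prod.mk.injEq] at h1 h2 ⊢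
    tauto
  · intro _ _
    simp
  · rintro ⟨σ, a⟩ _ hx
    rw [ind_of_false, zero_mul]
    rintro ⟨h1, -, h2, -, -⟩
    apply hx
    set s := orb σ (optionCongr (optionCongr a)) with hs
    have h3 : ∀ z, (∃ u, legsEquiv e (.inl u) = z) ↔ s (some none) z := by
      rintro (_ | _ | h)
      · constructor
        · rintro ⟨u, hu⟩
          exact absurd (hu.trans (legsEquiv_inr_none e).symm) (by simp)
        · exact fun k => (h2 k).elim
      · exact ⟨fun _ => Setoid.refl' _ _, fun _ => ⟨none, rfl⟩⟩
      · rw [← h1]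
        constructor
        · rintro ⟨_ | u, hu⟩
          · simp [legsEquiv_inl_none] at hu
          · exact ⟨u, by simpa [legsEquiv_inl_some] using hu⟩
        · rintro ⟨u, rfl⟩
          exact ⟨some u, rfl⟩
    -- Both permutations preserve the component of the first leg, which is the image of the left
    -- summand; hence they split as sums of permutations.
    have h4 : Set.MapsTo ((legsEquiv e).symm.permCongr σ) (Set.range Sum.inl)
        (Set.range Sum.inl) := by
      rintro _ ⟨u, rfl⟩
      rw [permCongr_apply, symm_symm]
      obtain ⟨w, hw⟩ := (h3 (σ (legsEquiv e (.inl u)))).2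
        (Setoid.trans' _ ((h3 _).1 ⟨u, rfl⟩) (orb_apply_left _ _ _))
      exact ⟨w, by rw [← hw, symm_apply_apply]⟩
    have h5 : Set.MapsTo (e.symm.permCongr a) (Set.range Sum.inl) (Set.range Sum.inl) := by
      rintro _ ⟨u, rfl⟩
      rw [permCongr_apply, symm_symm]
      obtain ⟨w, hw⟩ := (h1 (a (e (.inl u)))).2
        (Setoid.trans' _ ((h1 _).1 ⟨u, rfl⟩)
          (orb_apply_right σ (optionCongr (optionCongr a)) (some (some (e (.inl u))))))
      exact ⟨w, by rw [← hw, symm_apply_apply]⟩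
    obtain ⟨⟨σ₁, σ₂⟩, hσ⟩ := Perm.mem_sumCongrHom_range_of_perm_mapsTo_inl h4
    obtain ⟨⟨a₁, a₂⟩, ha⟩ := Perm.mem_sumCongrHom_range_of_perm_mapsTo_inl h5
    refine ⟨((σ₁, a₁), (σ₂, a₂)), by simp, ?_⟩
    simp only [Perm.sumCongrHom_apply] at hσ ha
    simp only [hσ, ha]
    congr 1
    · ext1 x
      simp
    · ext1 x
      simp
  · rintro ⟨⟨σ₁, a₁⟩, σ₂, a₂⟩ _
    refine ind_mul_congr (splitCondition_iff e k σ₁ a₁ σ₂ a₂).symm fun _ => ?_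
    dsimp only
    have : (swap (some none) none : Perm (Option (Option H)))
        = (legsEquiv e).permCongr (swap (.inl none) (.inr none)) :=
      (symm_trans_swap_trans (Sum.inl none) (Sum.inr none) (legsEquiv e)).symm
    rw [this, permCongr_mul', ← legsEquiv_inl_none e, weight_permCongr, weight_sumCongr_mul_swap]

/-- The contribution of the maps whose root edge is a loop. -/
theorem sum_loop (k : ℕ) :
    ∑ σ : Perm (Option (Option H)), ∑ a : Perm H,
      ind K (SplitCondition k σ a) * weight b (σ * swap (some none) none) (some none)
    = ∑ s : Finset H, ∑ p ∈ Finset.HasAntidiagonal.antidiagonal k,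
        legSum b p.1 {h // h ∈ s} * legSum b p.2 {h // h ∉ s} := by
  have h1 : ∀ s : Finset H, ∀ h,
      (∃ u, Equiv.sumCompl (fun h => h ∈ s) (.inl u) = h) ↔ h ∈ s := by
    intro s h
    simp
  have h2 : ∀ s : Finset H, ∑ p ∈ Finset.HasAntidiagonal.antidiagonal k,
      legSum b p.1 {h // h ∈ s} * legSum b p.2 {h // h ∉ s}
      = ∑ x : Perm (Option (Option H)) × Perm H, ind K (∀ h, h ∈ s ↔
        orb x.1 (optionCongr (optionCongr x.2)) (some none) (some (some h))) *
        (ind K (SplitCondition k x.1 x.2)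
          * weight b (x.1 * swap (some none) none) (some none)) := by
    intro s
    rw [← sum_splitCondition (Equiv.sumCompl fun h => h ∈ s) k]
    refine Finset.sum_congr rfl fun x _ => ?_
    simp only [h1]
    rw [ind_and, mul_assoc]
  simp only [h2]
  symm
  rw [Finset.sum_comm, Fintype.sum_prod_type]
  refine Finset.sum_congr rfl fun σ _ => Finset.sum_congr rfl fun a _ => ?_
  -- For given permutations exactly one subset contributes: the half-edges in the component of the
  -- first leg.
  rw [← Finset.sum_mul, ind_exists_unique, one_mul]
  classical
  refine ⟨Finset.univ.filter fun h =>
    orb σ (optionCongr (optionCongr a)) (some none) (some (some h)), by simp, ?_⟩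
  intro s hs
  ext h
  simp [hs]

end Loop

end PlanarCensus

namespace PlanarCensus

open Equiv

/-! ### Tutte's recursion. -/

section Recursion

variable {K : Type*} [CommRing K]

/-- The weighted number of planar maps with `m` edges, with a weight `a n` per vertex of degree
`n`, and with one leg on an unweighted vertex of degree `l`, the leg included. -/
noncomputable def mapCount (a : ℕ → K) : ℕ → ℕ → K
  | 0, l => if l = 1 then 1 else 0
  | _ + 1, 0 => 0
  | _ + 1, 1 => 0
  | m + 1, k + 2 => ∑ n ∈ Finset.Icc 1 (2 * m + 1), a n * mapCount a m (k + n)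
      + ∑ p ∈ Finset.HasAntidiagonal.antidiagonal (k + 1),
          ∑ i : Fin (m + 1), mapCount a i p.1 * mapCount a (m - i) p.2
termination_by m => m

theorem mapCount_add_two (a : ℕ → K) (m k : ℕ) :
    mapCount a (m + 1) (k + 2) = ∑ n ∈ Finset.Icc 1 (2 * m + 1), a n * mapCount a m (k + n)
      + ∑ p ∈ Finset.HasAntidiagonal.antidiagonal (k + 1),
          ∑ i ∈ Finset.range (m + 1), mapCount a i p.1 * mapCount a (m - i) p.2 := by
  rw [mapCount]
  congr 1
  refine Finset.sum_congr rfl fun p _ => ?_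
  rw [Fin.sum_univ_eq_sum_range fun i => mapCount a i p.1 * mapCount a (m - i) p.2]

theorem map_mapCount {K' : Type*} [CommRing K'] (f : K →+* K') (a : ℕ → K) (m l : ℕ) :
    f (mapCount a m l) = mapCount (fun n => f (a n)) m l := by
  induction m using Nat.strong_induction_on generalizing l with
  | _ m ih =>
    rcases m with _ | m
    · rw [mapCount, mapCount]
      split_ifs <;> simp
    rcases l with _ | _ | k
    · simp [mapCount]
    · simp [mapCount]
    · rw [mapCount_add_two, mapCount_add_two, map_add, map_sum, map_sum]
      congr 1
      · refine Finset.sum_congr rfl fun n _ => ?_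
        rw [map_mul, ih m (by omega)]
      · refine Finset.sum_congr rfl fun p _ => ?_
        rw [map_sum]
        refine Finset.sum_congr rfl fun i hi => ?_
        rw [Finset.mem_range] at hi
        rw [map_mul, ih i (by omega), ih (m - i) (by omega)]

theorem sum_range_even {M : Type*} [AddCommMonoid M] (m : ℕ) (g : ℕ → M)
    (hg : ∀ c, ¬ 2 ∣ c → g c = 0) :
    ∑ c ∈ Finset.range (2 * m + 1), g c = ∑ i ∈ Finset.range (m + 1), g (2 * i) := by
  symm
  refine Finset.sum_of_injOn (fun i => 2 * i) ?_ ?_ ?_ ?_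
  · intro i _ j _ h
    simpa using h
  · intro i hi
    simp only [Finset.coe_range, Set.mem_Iio] at hi ⊢
    omega
  · intro c hc h
    refine hg c ?_
    rintro ⟨i, rfl⟩
    refine h ⟨i, ?_, rfl⟩
    simp only [Finset.coe_range, Set.mem_Iio, Finset.mem_range] at hc ⊢
    omega
  · intro _ _
    rfl

variable {b : ℕ → K}

/-- Only the size of the subset matters, and odd sizes contribute nothing since such sets have no
perfect matching. -/
theorem sum_legSum_mul_legSum (m i j : ℕ) :
    ∑ s : Finset (Fin (2 * m)), legSum b i {h // h ∈ s} * legSum b j {h // h ∉ s}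
      = ∑ c ∈ Finset.range (m + 1), ((2 * m).choose (2 * c) : K) *
          (legSum b i (Fin (2 * c)) * legSum b j (Fin (2 * (m - c)))) := by
  have h : ∀ s : Finset (Fin (2 * m)), legSum b i {h // h ∈ s} * legSum b j {h // h ∉ s}
      = legSum b i (Fin s.card) * legSum b j (Fin (2 * m - s.card)) := by
    intro s
    rw [legSum_congr (Fintype.equivFinOfCardEq (Fintype.card_coe s)) i,
      legSum_congr (Fintype.equivFinOfCardEq (α := {h // h ∉ s}) (n := 2 * m - s.card) ?_) j]
    rw [Fintype.card_subtype_compl, Fintype.card_coe, Fintype.card_fin]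
  rw [Finset.sum_congr rfl fun s _ => h s, ← Finset.powerset_univ,
    Finset.sum_powerset_apply_card (fun c => legSum b i (Fin c) * legSum b j (Fin (2 * m - c))),
    Finset.card_univ, Fintype.card_fin, sum_range_even]
  · refine Finset.sum_congr rfl fun c hc => ?_
    rw [nsmul_eq_mul, Nat.mul_sub]
  · intro c hc
    rw [legSum_eq_zero_of_odd (by rwa [Fintype.card_fin]), zero_mul, smul_zero]

/-- The labelled count satisfies the recursion of `mapCount`, multiplied by a factorial: the choice
of a root edge gives `(2m+2)(2m+1)`, and the binomial coefficient of the two components absorbs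
their factorials. -/
theorem legSum_fin (m l : ℕ) :
    legSum b l (Fin (2 * m)) = ((2 * m).factorial : K) * mapCount (fun n => b n ^ n) m l := by
  induction m using Nat.strong_induction_on generalizing l with
  | _ m ih =>
    rcases l with _ | _ | k
    · rw [legSum_zero]
      rcases m with _ | m <;> simp [mapCount]
    · rw [zero_add, legSum_one]
      rcases m with _ | m
      · rw [ind_of_true (by rw [mul_zero]; infer_instance)]
        simp [mapCount]
      · rw [ind_of_false]
        · simp [mapCount]
        · rw [not_isEmpty_iff]
          exact ⟨⟨0, by omega⟩⟩
    rcases m with _ | m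
    · rw [legSum_eq_zero_of_lt (by simp)]
      simp [mapCount]
    rw [legSum_succ (by omega), rootSum_eq_mul (H := Fin (2 * m)) (by simp [mul_add]),
      rootEdgeSum_eq (by omega), mapCount_add_two]
    have h := sum_loop (b := b) (H := Fin (2 * m)) (k + 1)
    simp only [SplitCondition] at h
    rw [h, Finset.sum_comm (s := Finset.univ)]
    simp only [sum_legSum_mul_legSum, Fintype.card_fin]
    have e1 : ((2 * (m + 1)).factorial : K)
        = ((2 * m + 2 : ℕ) : K) * ((2 * m + 1 : ℕ) : K) * ((2 * m).factorial : K) := by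
      rw [show 2 * (m + 1) = 2 * m + 1 + 1 by ring, Nat.factorial_succ, Nat.factorial_succ]
      push_cast
      ring
    rw [e1, mul_assoc _ ((2 * m).factorial : K)]
    congr 1
    rw [mul_add, Finset.mul_sum, Finset.mul_sum]
    congr 1
    · refine Finset.sum_congr rfl fun n _ => ?_
      rw [show k + 1 + n - 1 = k + n by omega, ih m (by omega)]
      ring
    · refine Finset.sum_congr rfl fun p _ => ?_
      rw [Finset.mul_sum]
      refine Finset.sum_congr rfl fun c hc => ?_
      rw [Finset.mem_range] at hc
      rw [ih c (by omega), ih (m - c) (by omega)]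
      have e2 := Nat.choose_mul_factorial_mul_factorial (show 2 * c ≤ 2 * m by omega)
      rw [← Nat.mul_sub] at e2
      rw [← e2]
      push_cast
      ring

/-- The weighted number of rooted planar maps with `m` edges and labelled half-edges. -/
theorem sum_rootSum_fin (m : ℕ) :
    ∑ k ∈ Finset.Icc 1 (2 * m), b k ^ k * rootSum b k (Fin (2 * m))
      = ((2 * m).factorial : K) *
        (mapCount (fun n => b n ^ n) (m + 1) 3 - if m = 0 then 1 else 0) := by
  have h1 : ∀ m, mapCount (fun n => b n ^ n) m 0 = 0 := fun m => by rcases m <;> simp [mapCount]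
  have h2 : ∀ m, mapCount (fun n => b n ^ n) m 1 = if m = 0 then 1 else 0 := fun m => by
    rcases m <;> simp [mapCount]
  have h3 : mapCount (fun n => b n ^ n) (m + 1) 3
      = ∑ n ∈ Finset.Icc 1 (2 * m + 1), b n ^ n * mapCount (fun n => b n ^ n) m (1 + n)
        + if m = 0 then 1 else 0 := by
    -- In the quadratic term only two legs of degree `1` survive, as degree `0` does not occur; such
    -- a leg forces an edgeless map, whence the correction at `m = 0`.
    rw [show 3 = 1 + 2 from rfl, mapCount_add_two]
    congr 1
    rw [Finset.Nat.sum_antidiagonal_eq_sum_range_succ_mk, Finset.sum_range_succ,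
      Finset.sum_range_succ, Finset.sum_range_one]
    simp only [h1, h2, zero_mul, mul_zero, Finset.sum_const_zero, zero_add, add_zero,
      Nat.add_sub_cancel, Nat.sub_self]
    rcases m with _ | m
    · simp
    · rw [if_neg (by omega)]
      refine Finset.sum_eq_zero fun i hi => ?_
      rw [Finset.mem_range] at hi
      rcases Nat.eq_zero_or_pos i with rfl | h
      · rw [if_neg (by omega : ¬ m + 1 - 0 = 0), mul_zero]
      · rw [if_neg h.ne', zero_mul]
  rw [h3, add_sub_cancel_right, Finset.mul_sum, Finset.sum_Icc_succ_top (by omega)]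
  -- The top term `n = 2m + 1` vanishes, since a leg vertex has degree at most `2m + 1`. The
  -- factorial is kept so that nothing has to be cancelled in `K`.
  have h4 := legSum_fin (b := b) m (1 + (2 * m + 1))
  rw [legSum_eq_zero_of_lt (by rw [Fintype.card_fin]; omega)] at h4
  rw [mul_left_comm, ← h4, mul_zero, add_zero]
  refine Finset.sum_congr rfl fun k hk => ?_
  rw [Finset.mem_Icc] at hk
  rw [← legSum_succ (by omega), legSum_fin, add_comm k]
  ring

end Recursion

end PlanarCensus

namespace PlanarCensus

open Equiv

/-! ### Labelled maps versus rooted maps up to relabelling. -/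

section Labelled

theorem isPretransitive_iff {X : Type} (σ α : Perm X) :
    MulAction.IsPretransitive (Subgroup.closure {σ, α}) X ↔ orb σ α = ⊤ := by
  constructor
  · intro h
    rw [Setoid.eq_top_iff]
    intro x y
    obtain ⟨⟨g, hg⟩, rfl⟩ := h.exists_smul_eq x y
    change orb σ α x (g x)
    clear h
    induction hg using Subgroup.closure_induction generalizing x with
    | mem g hg =>
      rcases hg with rfl | rfl
      · exact orb_apply_left _ _ _
      · exact orb_apply_right _ _ _
    | one => exact Setoid.refl' _ _
    | mul g g' _ _ h h' => exact Setoid.trans' _ (h' x) (h (g' x))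
    | inv g _ h =>
      exact Setoid.symm' _ (by simpa using h (g⁻¹ x))
  · intro h
    have h1 : orb σ α ≤ MulAction.orbitRel (Subgroup.closure {σ, α}) X := by
      rw [orb_le_iff]
      refine ⟨fun x => Setoid.symm' _ ?_, fun x => Setoid.symm' _ ?_⟩
      · exact ⟨⟨σ, Subgroup.subset_closure (by simp)⟩, rfl⟩
      · exact ⟨⟨α, Subgroup.subset_closure (by simp)⟩, rfl⟩
    rw [h] at h1
    constructor
    intro x y
    obtain ⟨g, hg⟩ := h1 (x := y) (y := x) trivial
    exact ⟨g, hg⟩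

theorem cycleLength_mk {X : Type} (σ : Perm X) (x : X) :
    cycleLength (Quotient.mk _ x : Cycles σ) = len σ x := by
  rw [cycleLength, len, ← Nat.card_coe_set_eq]
  refine Nat.card_congr (Equiv.subtypeEquivRight fun y => ?_)
  rw [Set.mem_ofPred_eq, Setoid.comm' (cyc σ)]
  exact ⟨fun h => Quotient.exact h, fun h => Quotient.sound h⟩

theorem card_len_eq {X : Type} [Finite X] (σ : Perm X) (n : ℕ) :
    Nat.card {x // len σ x = n} = n * numCyclesOfLength σ n := by
  have e : {x // len σ x = n} ≃
      Σ c : {c : Cycles σ // cycleLength c = n}, {x : X // (Quotient.mk _ x : Cycles σ) = c.1} :=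
    { toFun := fun x => ⟨⟨Quotient.mk _ x.1, by rw [cycleLength_mk, x.2]⟩, x.1, rfl⟩
      invFun := fun y => ⟨y.2.1, by rw [← cycleLength_mk, y.2.2, y.1.2]⟩
      left_inv := fun x => rfl
      right_inv := by
        rintro ⟨⟨c, hc⟩, x, hx⟩
        dsimp only at hx
        subst hx
        rfl }
  have : Finite (Cycles σ) := Quotient.finite _
  have : Fintype {c : Cycles σ // cycleLength c = n} := Fintype.ofFinite _
  rw [Nat.card_congr e, Nat.card_sigma, Finset.sum_congr rfl fun c _ => (c.2 : cycleLength c.1 = n),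
    Finset.sum_const, Finset.card_univ, numCyclesOfLength, Nat.card_eq_fintype_card, smul_eq_mul,
    mul_comm]

theorem len_of_isMatching {X : Type} [Finite X] {α : Perm X} (h : IsMatching α) (x : X) :
    len α x = 2 := by
  have h1 : len α x ∣ 2 := by
    rw [len_eq_minimalPeriod]
    exact Function.IsPeriodicPt.minimalPeriod_dvd (h.1 x)
  rcases (Nat.dvd_prime Nat.prime_two).1 h1 with h2 | h2
  · rw [len_eq_minimalPeriod, Function.minimalPeriod_eq_one_iff_isFixedPt] at h2
    exact (h.2 x h2).elim
  · exact h2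

theorem two_mul_numCycles_of_isMatching {X : Type} [Finite X] {α : Perm X} (h : IsMatching α) :
    2 * numCycles α = Nat.card X := by
  have h1 : numCyclesOfLength α 2 = numCycles α := by
    refine Nat.card_congr (Equiv.subtypeUnivEquiv ?_)
    rintro ⟨x⟩
    exact (cycleLength_mk α x).trans (len_of_isMatching h x)
  rw [← h1, ← card_len_eq]
  exact Nat.card_congr (Equiv.subtypeUnivEquiv (len_of_isMatching h))

/-- A matching has as many cycles as half the points, so `- c(α)` may be replaced by `c(α) - 2m`. -/
theorem planar_iff {m : ℕ} {σ α : Perm (Fin (2 * m))} (h : IsMatching α) :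
    (numCycles σ : ℤ) - (numCycles α : ℤ) + (numCycles (σ * α) : ℤ) = 2 ↔
      numClasses (cyc σ) + numClasses (cyc α) + numClasses (cyc (σ * α))
        = Nat.card (Fin (2 * m)) + 2 := by
  have h1 := two_mul_numCycles_of_isMatching h
  change _ ↔ numCycles σ + numCycles α + numCycles (σ * α) = _
  omega

/-- Labelled rooted planar maps as triples. -/
def labelledEquiv (m : ℕ) : LabelledRootedPlanarMap m ≃
    {x : Perm (Fin (2 * m)) × Perm (Fin (2 * m)) × Fin (2 * m) //
      IsMatching x.2.1 ∧ ConnectedPlanar x.1 x.2.1} where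
  toFun M := ⟨(M.σ, M.α, M.root), ⟨M.involutive, M.fixedPointFree⟩,
    (isPretransitive_iff _ _).1 M.transitive,
    (planar_iff ⟨M.involutive, M.fixedPointFree⟩).1 M.planar⟩
  invFun x :=
    { σ := x.1.1
      α := x.1.2.1
      involutive := x.2.1.1
      fixedPointFree := x.2.1.2
      transitive := (isPretransitive_iff _ _).2 x.2.2.1
      planar := (planar_iff x.2.1).2 x.2.2.2
      root := x.1.2.2 }
  left_inv _ := rfl
  right_inv _ := rfl

theorem LabelledRootedPlanarMap.ext' {m : ℕ} {M M' : LabelledRootedPlanarMap m} (h : M.σ = M'.σ)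
    (h' : M.α = M'.α) (h'' : M.root = M'.root) : M = M' := by
  apply (labelledEquiv m).injective
  apply Subtype.ext
  simp only [labelledEquiv, coe_fn_mk, h, h', h'']

/-- Relabelling the half-edges of a rooted planar map. -/
def relabel {m : ℕ} (ρ : Perm (Fin (2 * m))) (M : LabelledRootedPlanarMap m) :
    LabelledRootedPlanarMap m :=
  (labelledEquiv m).symm ⟨(ρ.permCongr M.σ, ρ.permCongr M.α, ρ M.root),
    (isMatching_permCongr ρ).2 (labelledEquiv m M).2.1,
    (connectedPlanar_permCongr ρ).2 (labelledEquiv m M).2.2⟩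

theorem permCongr_eq_conj {X : Type} (ρ σ : Perm X) : ρ.permCongr σ = ρ * σ * ρ⁻¹ := by
  ext x
  simp

/-- The points where the two relabellings agree form a union of orbits containing the root, hence
everything by transitivity. -/
theorem relabel_injective {m : ℕ} {M : LabelledRootedPlanarMap m} {ρ ρ' : Perm (Fin (2 * m))}
    (h : relabel ρ M = relabel ρ' M) : ρ = ρ' := by
  have h1 : ρ.permCongr M.σ = ρ'.permCongr M.σ := congrArg LabelledRootedPlanarMap.σ h
  have h2 : ρ.permCongr M.α = ρ'.permCongr M.α := congrArg LabelledRootedPlanarMap.α h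
  have h3 : ρ M.root = ρ' M.root := congrArg LabelledRootedPlanarMap.root h
  have key : ∀ τ : Perm (Fin (2 * m)), ρ.permCongr τ = ρ'.permCongr τ → ∀ x,
      (ρ x = ρ' x) = (ρ (τ x) = ρ' (τ x)) := by
    intro τ hτ x
    have e1 : ρ (τ x) = ρ.permCongr τ (ρ x) := by simp
    have e2 : ρ' (τ x) = ρ.permCongr τ (ρ' x) := by rw [hτ]; simp
    rw [e1, e2, EmbeddingLike.apply_eq_iff_eq]
  have h4 : orb M.σ M.α ≤ Setoid.ker fun x => ρ x = ρ' x :=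
    orb_le_iff.2 ⟨key _ h1, key _ h2⟩
  rw [show orb M.σ M.α = ⊤ from (labelledEquiv m M).2.2.1] at h4
  ext1 x
  have : (ρ M.root = ρ' M.root) = (ρ x = ρ' x) := h4 (x := M.root) (y := x) trivial
  rwa [← this]

/-- Rooted planar maps have no symmetries. -/
theorem card_labelled (m : ℕ) (k : ℕ+ → ℕ) :
    Nat.card {M : LabelledRootedPlanarMap m // ∀ n : ℕ+, numCyclesOfLength M.σ n = k n}
      = (2 * m).factorial * Nat.card {M : RootedPlanarMap m // ∀ n : ℕ+, M.numVertices n = k n} := by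
  have hmk : ∀ (M : LabelledRootedPlanarMap m) (n : ℕ),
      RootedPlanarMap.numVertices
        (Quotient.mk (LabelledRootedPlanarMap.relabelling m) M : RootedPlanarMap m) n
        = numCyclesOfLength M.σ n := fun _ _ => rfl
  have hrel : ∀ (ρ : Perm (Fin (2 * m))) (M : LabelledRootedPlanarMap m),
      (LabelledRootedPlanarMap.relabelling m).r M (relabel ρ M) := fun ρ M =>
    ⟨ρ, permCongr_eq_conj ρ M.σ, permCongr_eq_conj ρ M.α, rfl⟩
  have hout : ∀ q : RootedPlanarMap m,
      (Quotient.mk (LabelledRootedPlanarMap.relabelling m) (Quotient.out q) : RootedPlanarMap m)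
        = q := fun q => Quotient.out_eq q
  have hnum : ∀ (ρ : Perm (Fin (2 * m))) (q : RootedPlanarMap m) (n : ℕ),
      numCyclesOfLength (relabel ρ (Quotient.out q)).σ n = q.numVertices n := by
    intro ρ q n
    rw [← hmk, ← Quotient.sound (hrel ρ (Quotient.out q)), hout]
  -- A representative is fixed in each class; the labelled maps of the class are its relabellings,
  -- without repetition.
  let f : Perm (Fin (2 * m)) × {M : RootedPlanarMap m // ∀ n : ℕ+, M.numVertices n = k n} →
      {M : LabelledRootedPlanarMap m // ∀ n : ℕ+, numCyclesOfLength M.σ n = k n} :=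
    fun x => ⟨relabel x.1 (Quotient.out x.2.1), fun n => (hnum _ _ _).trans (x.2.2 n)⟩
  have hf : Function.Bijective f := by
    constructor
    · rintro ⟨ρ, q, hq⟩ ⟨ρ', q', hq'⟩ h
      have h1 : relabel ρ (Quotient.out q) = relabel ρ' (Quotient.out q') :=
        congrArg Subtype.val h
      have h2 : q = q' := by
        rw [← hout q, ← hout q', Quotient.sound (hrel ρ (Quotient.out q)),
          Quotient.sound (hrel ρ' (Quotient.out q')), h1]
      subst h2
      rw [relabel_injective h1]
    · rintro ⟨M, hM⟩
      set q : RootedPlanarMap m := Quotient.mk (LabelledRootedPlanarMap.relabelling m) M with hq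
      obtain ⟨ρ, h1, h2, h3⟩ := Quotient.exact (hout q)
      refine ⟨(ρ, ⟨q, hM⟩), Subtype.ext (LabelledRootedPlanarMap.ext' ?_ ?_ h3.symm)⟩
      · exact (permCongr_eq_conj _ _).trans h1.symm
      · exact (permCongr_eq_conj _ _).trans h2.symm
  rw [← Nat.card_congr (Equiv.ofBijective f hf), Nat.card_prod, Nat.card_perm, Nat.card_fin]

end Labelled

/-! ### Coefficients of the generating function. -/

section Coefficients

open MvPolynomial

theorem prod_len_eq {K : Type*} [CommRing K] (b : ℕ → K) {X : Type} [Fintype X] (σ : Perm X)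
    (r : X) : ∏ x, b (len σ x) = b (len σ r) ^ len σ r * weight b σ r := by
  classical
  have h1 : b (len σ r) ^ len σ r = ∏ z, if cyc σ r z then b (len σ r) else 1 := by
    rw [Finset.prod_ite, Finset.prod_const, Finset.prod_const_one, mul_one, len]
    congr 1
    rw [← Set.ncard_coe_finset]
    simp
  rw [h1, weight, ← Finset.prod_mul_distrib]
  refine Finset.prod_congr rfl fun z _ => ?_
  by_cases h : cyc σ r z
  · simp [h, ← len_congr h]
  · simp [h]

theorem sum_rootSum_eq {K : Type*} [CommRing K] (b : ℕ → K) (N : ℕ) :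
    ∑ k ∈ Finset.Icc 1 N, b k ^ k * rootSum b k (Fin N)
      = ∑ x : Perm (Fin N) × Perm (Fin N) × Fin N,
          ind K (IsMatching x.2.1 ∧ ConnectedPlanar x.1 x.2.1) * ∏ i, b (len x.1 i) := by
  have h : ∀ k, rootSum b k (Fin N) = ∑ x : Perm (Fin N) × Perm (Fin N) × Fin N,
      ind K (IsMatching x.2.1 ∧ ConnectedPlanar x.1 x.2.1 ∧ len x.1 x.2.2 = k)
        * weight b x.1 x.2.2 := by
    intro k
    simp only [Fintype.sum_prod_type]
    rfl
  simp only [h, Finset.mul_sum]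
  rw [Finset.sum_comm]
  refine Finset.sum_congr rfl fun x _ => ?_
  rw [Finset.sum_eq_single (len x.1 x.2.2), prod_len_eq b x.1 x.2.2]
  · rw [← and_assoc, ind_and _ (_ = _), ind_of_true (p := len x.1 x.2.2 = _) rfl]
    ring
  · intro k _ hk
    rw [ind_of_false, zero_mul, mul_zero]
    exact fun h => hk h.2.2.symm
  · intro hk
    have h1 := len_pos x.1 x.2.2
    have h2 := len_le x.1 x.2.2
    rw [Nat.card_fin] at h2
    exact (hk (Finset.mem_Icc.2 ⟨h1, h2⟩)).elim

/-- The exponent vector with entries `n * k n`. -/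
noncomputable def scale (k : ℕ+ →₀ ℕ) : ℕ+ →₀ ℕ :=
  Finsupp.onFinset k.support (fun n => n * k n) (by simp)

theorem scale_apply (k : ℕ+ →₀ ℕ) (n : ℕ+) : scale k n = n * k n := rfl

theorem scale_injective : Function.Injective scale := by
  intro k k' h
  ext n
  have := DFunLike.congr_fun h n
  rw [scale_apply, scale_apply] at this
  exact Nat.eq_of_mul_eq_mul_left n.pos this

/-- The substitution `X n ↦ X n ^ n` is injective on monomials. It turns weights per vertex into
weights per half-edge without loss. -/
theorem coeff_scale_aeval (p : MvPolynomial ℕ+ ℚ) (k : ℕ+ →₀ ℕ) :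
    coeff (scale k) (aeval (fun n : ℕ+ => (X n : MvPolynomial ℕ+ ℚ) ^ (n : ℕ)) p) = coeff k p := by
  classical
  induction p using MvPolynomial.induction_on' with
  | add p q hp hq => rw [map_add, coeff_add, coeff_add, hp, hq]
  | monomial e c =>
    have : aeval (fun n : ℕ+ => (X n : MvPolynomial ℕ+ ℚ) ^ (n : ℕ)) (monomial e c)
        = monomial (scale e) c := by
      rw [aeval_monomial, monomial_eq (s := scale e), algebraMap_eq, Finsupp.prod,
        Finsupp.prod_of_support_subset (s := e.support)]
      · congr 1
        refine Finset.prod_congr rfl fun n _ => ?_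
        rw [← pow_mul, scale_apply]
      · intro n
        simp [scale_apply]
      · simp
    rw [this, coeff_monomial, coeff_monomial]
    simp only [scale_injective.eq_iff]

/-- The family `x` extended by `1` at `0`. -/
def extendOne {K : Type*} [One K] (x : ℕ+ → K) (n : ℕ) : K := if h : 0 < n then x ⟨n, h⟩ else 1

theorem map_extendOne {K K' : Type*} [CommRing K] [CommRing K'] (f : K →+* K') (x : ℕ+ → K)
    (n : ℕ) : f (extendOne x n) = extendOne (fun n => f (x n)) n := by
  rw [extendOne, extendOne]
  split_ifs <;> simp

theorem extendOne_pnat {K : Type*} [One K] (x : ℕ+ → K) (n : ℕ+) : extendOne x n = x n :=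
  dif_pos n.pos

/-- The product is a monomial in which `X n` has exponent `n` times the number of cycles of length
`n`. -/
theorem coeff_prod_len {Y : Type} [Fintype Y] (σ : Perm Y) (k : ℕ+ →₀ ℕ) :
    coeff (scale k) (∏ i, extendOne (X : ℕ+ → MvPolynomial ℕ+ ℚ) (len σ i))
      = ind ℚ (∀ n : ℕ+, numCyclesOfLength σ n = k n) := by
  classical
  obtain ⟨L, hL⟩ : ∃ L : Y → ℕ+, ∀ i, (L i : ℕ) = len σ i :=
    ⟨fun i => ⟨_, len_pos σ i⟩, fun _ => rfl⟩
  have h1 : ∏ i, extendOne (X : ℕ+ → MvPolynomial ℕ+ ℚ) (len σ i)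
      = monomial (∑ i, Finsupp.single (L i) 1) 1 := by
    rw [monomial_sum_one]
    refine Finset.prod_congr rfl fun i _ => ?_
    rw [← hL, extendOne_pnat]
    rfl
  have h2 : (∑ i, Finsupp.single (L i) 1) = scale k ↔
      ∀ n : ℕ+, numCyclesOfLength σ n = k n := by
    rw [DFunLike.ext_iff]
    refine forall_congr' fun n => ?_
    have h3 : (∑ i, Finsupp.single (L i) 1) n
        = n * numCyclesOfLength σ n := by
      rw [← card_len_eq, Finsupp.finsetSum_apply, Nat.card_eq_fintype_card, Fintype.card_subtype,
        Finset.card_filter]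
      refine Finset.sum_congr rfl fun i _ => ?_
      rw [Finsupp.single_apply]
      exact if_congr (by rw [← PNat.coe_inj, hL]) rfl rfl
    rw [h3, scale_apply, Nat.mul_right_inj n.pos.ne']
  rw [h1, coeff_monomial, ← ind_congr h2]
  by_cases h : (∑ i, Finsupp.single (L i) 1) = scale k
  · rw [if_pos h, ind_of_true h]
  · rw [if_neg h, ind_of_false h]

/-- Both sides times `(2m)!` count labelled rooted maps: the left by absence of symmetries, the
right by the recursion with `b n = X n`, read at the exponent `scale k`. -/
theorem coeff_E₀ (d : Option ℕ+ →₀ ℕ) :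
    MvPowerSeries.coeff d E₀ = coeff d.some
      (mapCount (extendOne (X : ℕ+ → MvPolynomial ℕ+ ℚ)) (d none + 1) 3
        - if d none = 0 then 1 else 0) := by
  set m := d none with hm
  set k := d.some with hk
  have h1 : MvPowerSeries.coeff d E₀
      = (Nat.card {M : RootedPlanarMap m // ∀ n : ℕ+, M.numVertices n = k n} : ℚ) := rfl
  have h2 : (Nat.card {M : LabelledRootedPlanarMap m // ∀ n : ℕ+, numCyclesOfLength M.σ n = k n}
      : ℚ) = ∑ x : Perm (Fin (2 * m)) × Perm (Fin (2 * m)) × Fin (2 * m),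
        ind ℚ ((IsMatching x.2.1 ∧ ConnectedPlanar x.1 x.2.1) ∧
          ∀ n : ℕ+, numCyclesOfLength x.1 n = k n) := by
    classical
    have e : {M : LabelledRootedPlanarMap m // ∀ n : ℕ+, numCyclesOfLength M.σ n = k n} ≃
        {x : Perm (Fin (2 * m)) × Perm (Fin (2 * m)) × Fin (2 * m) //
          (IsMatching x.2.1 ∧ ConnectedPlanar x.1 x.2.1) ∧
            ∀ n : ℕ+, numCyclesOfLength x.1 n = k n} :=
      ((labelledEquiv m).subtypeEquiv (q := fun x => ∀ n : ℕ+, numCyclesOfLength x.1.1 n = k n)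
        fun _ => Iff.rfl).trans (Equiv.subtypeSubtypeEquivSubtypeInter
          (fun x : Perm (Fin (2 * m)) × Perm (Fin (2 * m)) × Fin (2 * m) =>
            IsMatching x.2.1 ∧ ConnectedPlanar x.1 x.2.1)
          fun x => ∀ n : ℕ+, numCyclesOfLength x.1 n = k n)
    rw [Nat.card_congr e, Nat.card_eq_fintype_card, Fintype.card_subtype, Finset.card_filter]
    push_cast
    refine Finset.sum_congr rfl fun x _ => ?_
    rw [ind]
    congr 1
  have h3 := congrArg (coeff (scale k))
    (sum_rootSum_fin (b := extendOne (X : ℕ+ → MvPolynomial ℕ+ ℚ)) m)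
  have h4 : mapCount (fun n => extendOne (X : ℕ+ → MvPolynomial ℕ+ ℚ) n ^ n) (m + 1) 3
      - (if m = 0 then 1 else 0)
      = aeval (fun n : ℕ+ => (X n : MvPolynomial ℕ+ ℚ) ^ (n : ℕ))
        (mapCount (extendOne (X : ℕ+ → MvPolynomial ℕ+ ℚ)) (m + 1) 3
          - if m = 0 then 1 else 0) := by
    rw [map_sub]
    congr 1
    · have := map_mapCount (aeval fun n : ℕ+ => (X n : MvPolynomial ℕ+ ℚ) ^ (n : ℕ)).toRingHom
        (extendOne (X : ℕ+ → MvPolynomial ℕ+ ℚ)) (m + 1) 3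
      refine Eq.trans ?_ this.symm
      congr 1
      ext1 n
      rw [map_extendOne]
      rw [extendOne, extendOne]
      split_ifs with h
      · exact (aeval_X (fun n : ℕ+ => (X n : MvPolynomial ℕ+ ℚ) ^ (n : ℕ)) _).symm
      · simp
    · split_ifs <;> simp
  rw [h4, sum_rootSum_eq, coeff_sum, ← C_eq_coe_nat, coeff_C_mul, coeff_scale_aeval] at h3
  have h5 : ∀ x : Perm (Fin (2 * m)) × Perm (Fin (2 * m)) × Fin (2 * m),
      coeff (scale k) (ind (MvPolynomial ℕ+ ℚ) (IsMatching x.2.1 ∧ ConnectedPlanar x.1 x.2.1)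
        * ∏ i, extendOne (X : ℕ+ → MvPolynomial ℕ+ ℚ) (len x.1 i))
      = ind ℚ ((IsMatching x.2.1 ∧ ConnectedPlanar x.1 x.2.1) ∧
          ∀ n : ℕ+, numCyclesOfLength x.1 n = k n) := by
    intro x
    rw [ind_and _ (∀ n : ℕ+, _), ← coeff_prod_len]
    by_cases h : IsMatching x.2.1 ∧ ConnectedPlanar x.1 x.2.1
    · rw [ind_of_true h, ind_of_true h, one_mul, one_mul]
    · rw [ind_of_false h, ind_of_false h, zero_mul, zero_mul, coeff_zero]
  rw [Finset.sum_congr rfl fun x _ => h5 x, ← h2, card_labelled] at h3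
  push_cast at h3
  rw [h1]
  exact mul_left_cancel₀ (by positivity) h3

theorem aeval_v_eq (p : MvPolynomial ℕ+ ℚ) :
    (aeval v p : Series) = (rename some p : MvPolynomial (Option ℕ+) ℚ) := by
  induction p using MvPolynomial.induction_on with
  | C c =>
    rw [aeval_C, rename_C, coe_C]
    rfl
  | add p q hp hq => rw [map_add, map_add, coe_add, hp, hq]
  | mul_X p n hp =>
    rw [map_mul, map_mul, coe_mul, hp, aeval_X, rename_X, coe_X]
    rfl

theorem coeff_aeval_v (p : MvPolynomial ℕ+ ℚ) (d : Option ℕ+ →₀ ℕ) :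
    MvPowerSeries.coeff d (aeval v p : Series) = if d none = 0 then coeff d.some p else 0 := by
  rw [aeval_v_eq, coeff_coe]
  split_ifs with h
  · have : d = d.some.mapDomain some := by
      ext (_ | n)
      · rw [h, Finsupp.mapDomain_of_notMem_range]
        simp
      · rw [Finsupp.mapDomain_apply (Option.some_injective _), Finsupp.some_apply]
    conv_lhs => rw [this]
    exact coeff_rename_mapDomain _ (Option.some_injective _) _ _
  · apply coeff_rename_eq_zero
    rintro u rfl
    exfalso
    apply h
    rw [Finsupp.mapDomain_of_notMem_range]
    simp

end Coefficients

end PlanarCensus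

namespace PlanarCensus

/-! ### Weighted lattice paths. -/

section PathCount

variable {K : Type*} [CommRing K]

/-- The coefficient of `x ^ k` in `(x + S + R / x) ^ n`. -/
def pathCount (R S : K) : ℕ → ℕ → K
  | 0, k => if k = 0 then 1 else 0
  | n + 1, 0 => S * pathCount R S n 0 + 2 * R * pathCount R S n 1
  | n + 1, k + 1 => pathCount R S n k + S * pathCount R S n (k + 1) + R * pathCount R S n (k + 2)

theorem pathCount_eq_zero (R S : K) {n k : ℕ} (h : n < k) : pathCount R S n k = 0 := by
  induction n generalizing k with
  | zero => rw [pathCount, if_neg (by omega)]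
  | succ n ih =>
    obtain ⟨k, rfl⟩ : ∃ k', k = k' + 1 := ⟨k - 1, by omega⟩
    rw [pathCount, ih (by omega), ih (by omega), ih (by omega)]
    ring

/-- Since `x + S + R / x` is invariant under `x ↦ R / x`, its powers have the coefficient of `x ^
(-k)` equal to `R ^ k` times that of `x ^ k`. With `p` for `x` and `q` for `R / x`, no division is
needed. The same symmetry explains the factor `2` in `pathCount`. -/
theorem pow_eq_sum_pathCount {R S p q : K} (hpq : p * q = R) (n J : ℕ) (hJ : n ≤ J) :
    (S + p + q) ^ n = pathCount R S n 0
      + ∑ j ∈ Finset.range J, pathCount R S n (j + 1) * (p ^ (j + 1) + q ^ (j + 1)) := by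
  induction n with
  | zero =>
    rw [pow_zero, Finset.sum_eq_zero]
    · simp [pathCount]
    · intro j _
      rw [pathCount_eq_zero R S (by omega), zero_mul]
  | succ n ih =>
    obtain ⟨J, rfl⟩ : ∃ J', J = J' + 1 := ⟨J - 1, by omega⟩
    rw [pow_succ', ih (by omega), pathCount]
    have h1 : ∀ j, pathCount R S (n + 1) (j + 1) * (p ^ (j + 1) + q ^ (j + 1))
        = S * (pathCount R S n (j + 1) * (p ^ (j + 1) + q ^ (j + 1)))
          + pathCount R S n j * (p ^ (j + 1) + q ^ (j + 1))
          + R * (pathCount R S n (j + 2) * (p ^ (j + 1) + q ^ (j + 1))) := by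
      intro j
      rw [pathCount]
      ring
    have h2 : ∀ j, (p + q) * (pathCount R S n (j + 1) * (p ^ (j + 1) + q ^ (j + 1)))
        = pathCount R S n (j + 1) * (p ^ (j + 2) + q ^ (j + 2))
          + R * (pathCount R S n (j + 1) * (p ^ j + q ^ j)) := by
      intro j
      rw [← hpq]
      ring
    have h3 : (S + p + q) * (pathCount R S n 0
        + ∑ j ∈ Finset.range (J + 1), pathCount R S n (j + 1) * (p ^ (j + 1) + q ^ (j + 1)))
        = S * pathCount R S n 0 + pathCount R S n 0 * (p + q)
          + (S * ∑ j ∈ Finset.range (J + 1), pathCount R S n (j + 1) * (p ^ (j + 1) + q ^ (j + 1))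
            + ∑ j ∈ Finset.range (J + 1), (p + q) *
              (pathCount R S n (j + 1) * (p ^ (j + 1) + q ^ (j + 1)))) := by
      rw [← Finset.mul_sum]
      ring
    rw [h3]
    simp only [h1, h2, Finset.sum_add_distrib, ← Finset.mul_sum]
    have e1 : ∑ j ∈ Finset.range (J + 1), pathCount R S n j * (p ^ (j + 1) + q ^ (j + 1))
        = ∑ j ∈ Finset.range (J + 1), pathCount R S n (j + 1) * (p ^ (j + 2) + q ^ (j + 2))
          + pathCount R S n 0 * (p + q) := by
      rw [Finset.sum_range_succ', Finset.sum_range_succ _ J, pathCount_eq_zero R S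
        (show n < J + 1 by omega)]
      ring
    have e2 : ∑ j ∈ Finset.range (J + 1), pathCount R S n (j + 1) * (p ^ j + q ^ j)
        = ∑ j ∈ Finset.range (J + 1), pathCount R S n (j + 2) * (p ^ (j + 1) + q ^ (j + 1))
          + 2 * pathCount R S n 1 := by
      rw [Finset.sum_range_succ', Finset.sum_range_succ _ J, pathCount_eq_zero R S
        (show n < J + 2 by omega)]
      ring
    rw [e1, e2]
    ring

/-- Among `n` steps, `2i + k` are not level and `i` of these go down. The slack in `N`, where
binomials vanish, aligns the ranges in the induction. -/
theorem pathCount_eq_sum (R S : K) (n k N : ℕ) (hN : n ≤ N) :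
    pathCount R S n k = ∑ i ∈ Finset.range (N + 1),
      ((n.choose (2 * i + k) * (2 * i + k).choose i : ℕ) : K) * R ^ i * S ^ (n - (2 * i + k)) := by
  induction n generalizing k N with
  | zero =>
    rw [pathCount, Finset.sum_range_succ', Finset.sum_eq_zero]
    · rcases k with _ | k <;> simp
    · intro i _
      rw [Nat.choose_eq_zero_of_lt (by omega)]
      simp
  | succ n ih =>
    obtain ⟨N, rfl⟩ : ∃ N', N = N' + 1 := ⟨N - 1, by omega⟩
    have hS : ∀ i k, S * (((n.choose (2 * i + k) * (2 * i + k).choose i : ℕ) : K) * R ^ i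
        * S ^ (n - (2 * i + k))) = ((n.choose (2 * i + k) * (2 * i + k).choose i : ℕ) : K) * R ^ i
        * S ^ (n + 1 - (2 * i + k)) := by
      intro i k
      rcases le_or_gt (2 * i + k) n with h | h
      · rw [Nat.sub_add_comm h, pow_succ]
        ring
      · rw [Nat.choose_eq_zero_of_lt h]
        simp
    rcases k with _ | k
    · rw [pathCount, ih 0 (N + 1) (by omega), ih 1 N (by omega), Finset.mul_sum, Finset.mul_sum,
        Finset.sum_congr rfl fun i _ => hS i 0, Finset.sum_range_succ',
        Finset.sum_range_succ' _ (N + 1), add_right_comm, ← Finset.sum_add_distrib]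
      congr 1
      · refine Finset.sum_congr rfl fun i _ => ?_
        have e1 : (2 * (i + 1) + 0).choose (i + 1) = 2 * (2 * i + 1).choose i := by
          rw [show 2 * (i + 1) + 0 = 2 * i + 1 + 1 by ring, Nat.choose_succ_succ,
            Nat.choose_symm_half]
          ring
        have e2 : n + 1 - (2 * (i + 1) + 0) = n - (2 * i + 1) := by omega
        rw [e1, e2, show 2 * (i + 1) + 0 = 2 * i + 1 + 1 by ring, Nat.choose_succ_succ n]
        push_cast
        ring
      · simp
    · rw [pathCount, ih k (N + 1) (by omega), ih (k + 1) (N + 1) (by omega), ih (k + 2) N (by omega),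
        Finset.mul_sum, Finset.mul_sum, Finset.sum_congr rfl fun i _ => hS i (k + 1),
        ← Finset.sum_add_distrib, Finset.sum_range_succ', Finset.sum_range_succ' _ (N + 1),
        add_right_comm, ← Finset.sum_add_distrib]
      congr 1
      · refine Finset.sum_congr rfl fun i _ => ?_
        have e1 : n - (2 * (i + 1) + k) = n - (2 * i + (k + 2)) := by omega
        have e2 : n + 1 - (2 * (i + 1) + (k + 1)) = n - (2 * i + (k + 2)) := by omega
        rw [e1, e2, show 2 * (i + 1) + (k + 1) = 2 * i + (k + 2) + 1 by ring,
          show 2 * (i + 1) + k = 2 * i + (k + 2) by ring, Nat.choose_succ_succ n,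
          Nat.choose_succ_succ (2 * i + (k + 2)) i]
        push_cast
        ring
      · have e2 : n + 1 - (2 * 0 + (k + 1)) = n - (2 * 0 + k) := by omega
        rw [e2, show 2 * 0 + (k + 1) = 2 * 0 + k + 1 by ring, Nat.choose_succ_succ n]
        push_cast
        simp
        ring

end PathCount

/-! ### The power series that parametrises the solution. -/

section Uniformizer

variable {K : Type*} [CommRing K]

/-- The coefficients of the series `y` with `y = X * (1 + S * y + R * y ^ 2)`. -/
noncomputable def uniformizerCoeff (R S : K) : ℕ → K
  | 0 => 0
  | n + 1 => (if n = 0 then 1 else 0) + S * uniformizerCoeff R S n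
      + R * ∑ i : Fin (n + 1), uniformizerCoeff R S i * uniformizerCoeff R S (n - i)

/-- The series `y` with `y = X * (1 + S * y + R * y ^ 2)`. -/
noncomputable def uniformizer (R S : K) : PowerSeries K := PowerSeries.mk (uniformizerCoeff R S)

theorem uniformizer_eq (R S : K) :
    uniformizer R S = PowerSeries.X * (1 + PowerSeries.C S * uniformizer R S
      + PowerSeries.C R * uniformizer R S ^ 2) := by
  ext n
  rcases n with _ | n
  · rw [PowerSeries.coeff_zero_X_mul, uniformizer, PowerSeries.coeff_mk, uniformizerCoeff]
  · rw [PowerSeries.coeff_succ_X_mul, uniformizer, PowerSeries.coeff_mk, uniformizerCoeff, map_add,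
      map_add, PowerSeries.coeff_C_mul, PowerSeries.coeff_C_mul, PowerSeries.coeff_one, pow_two,
      PowerSeries.coeff_mul, PowerSeries.coeff_mk,
      Finset.Nat.sum_antidiagonal_eq_sum_range_succ_mk,
      Fin.sum_univ_eq_sum_range fun i => uniformizerCoeff R S i * uniformizerCoeff R S (n - i)]
    simp only [PowerSeries.coeff_mk]

end Uniformizer

end PlanarCensus

namespace PlanarCensus

/-! ### The explicit series satisfies Tutte's equation. -/

section LoopEquation

variable {K : Type*} [CommRing K]

theorem map_pathCount {K' : Type*} [CommRing K'] (f : K →+* K') (R S : K) (n k : ℕ) :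
    f (pathCount R S n k) = pathCount (f R) (f S) n k := by
  induction n generalizing k with
  | zero =>
    rw [pathCount, pathCount]
    split_ifs <;> simp
  | succ n ih =>
    rcases k with _ | k
    · rw [pathCount, pathCount, map_add, map_mul, map_mul, map_mul, map_ofNat, ih, ih]
    · simp [pathCount, ih]

/-- The weight of the paths that end at height `-j`. -/
def pathSum (R S : K) (a : ℕ → K) (N j : ℕ) : K :=
  R ^ j * ∑ n ∈ Finset.Icc 1 N, a n * pathCount R S (n - 1) j

/-- The series whose coefficients count planar maps with one leg. -/
noncomputable def resolvent (R S : K) (a : ℕ → K) (N : ℕ) : PowerSeries K :=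
  uniformizer R S - ∑ j ∈ Finset.range (N + 2),
    PowerSeries.C (pathSum R S a N (j + 2)) * uniformizer R S ^ (j + 2)

/-- Laurent series without positive powers. -/
def NoPositivePart (x : LaurentSeries K) : Prop := ∀ k : ℕ, 1 ≤ k → HahnSeries.coeff x (k : ℤ) = 0

theorem NoPositivePart.add {x y : LaurentSeries K} (hx : NoPositivePart x)
    (hy : NoPositivePart y) : NoPositivePart (x + y) := fun k hk => by
  rw [HahnSeries.coeff_add, hx k hk, hy k hk, add_zero]

theorem NoPositivePart.C_mul (c : K) {x : LaurentSeries K} (hx : NoPositivePart x) :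
    NoPositivePart (HahnSeries.C c * x) := fun k hk => by
  rw [HahnSeries.C_mul_eq_smul, HahnSeries.coeff_smul, hx k hk, smul_zero]

theorem NoPositivePart.sum {ι : Type*} {s : Finset ι} {x : ι → LaurentSeries K}
    (h : ∀ i ∈ s, NoPositivePart (x i)) : NoPositivePart (∑ i ∈ s, x i) := fun k hk => by
  rw [HahnSeries.coeff_sum]
  exact Finset.sum_eq_zero fun i hi => h i hi k hk

theorem coeff_single_neg_one_mul (x : LaurentSeries K) (k : ℤ) :
    HahnSeries.coeff ((HahnSeries.single (-1) 1 : LaurentSeries K) * x) k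
      = HahnSeries.coeff x (k + 1) := by
  have := HahnSeries.coeff_single_mul_add (r := (1 : K)) (x := x) (a := k + 1) (b := -1)
  rwa [add_neg_cancel_right, one_mul] at this

theorem NoPositivePart.single_mul {x : LaurentSeries K} (hx : NoPositivePart x) :
    NoPositivePart ((HahnSeries.single (-1) 1 : LaurentSeries K) * x) := fun k hk => by
  rw [coeff_single_neg_one_mul]
  exact_mod_cast hx (k + 1) (by omega)

theorem coeff_single_pow_mul (f : PowerSeries K) (n k : ℕ) :
    HahnSeries.coeff ((HahnSeries.single (-1) 1 : LaurentSeries K) ^ n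
      * HahnSeries.ofPowerSeries ℤ K f) (k : ℤ) = PowerSeries.coeff (k + n) f := by
  induction n generalizing k with
  | zero => rw [pow_zero, one_mul, HahnSeries.ofPowerSeries_apply_coeff, add_zero]
  | succ n ih =>
    rw [pow_succ', mul_assoc, coeff_single_neg_one_mul]
    have := ih (k + 1)
    push_cast at this
    rw [this]
    congr 2
    omega

theorem single_mul_uniformizer (R S : K) :
    (HahnSeries.single (-1) 1 : LaurentSeries K)
        * HahnSeries.ofPowerSeries ℤ K (uniformizer R S)
      = 1 + HahnSeries.C S * HahnSeries.ofPowerSeries ℤ K (uniformizer R S)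
        + HahnSeries.C R * HahnSeries.ofPowerSeries ℤ K (uniformizer R S) ^ 2 := by
  conv_lhs => rw [uniformizer_eq]
  rw [map_mul, map_add, map_add, map_mul, map_mul, map_pow,
    map_one (HahnSeries.ofPowerSeries ℤ K), HahnSeries.ofPowerSeries_X,
    HahnSeries.ofPowerSeries_C, HahnSeries.ofPowerSeries_C, ← mul_assoc, HahnSeries.single_mul_single]
  simp

variable {R S t : K} {a : ℕ → K} {N : ℕ}

theorem coeff_resolvent [IsDomain K] [CharZero K] (ht : t ≠ 0)
    (hR : R = t + t * ∑ n ∈ Finset.Icc 1 N, a n * (R * pathCount R S (n - 1) 1))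
    (hS : S = t * ∑ n ∈ Finset.Icc 1 N, a n * pathCount R S (n - 1) 0) {k : ℕ} (hk : 1 ≤ k) :
    PowerSeries.coeff (k + 1) (resolvent R S a N)
      = t * ∑ n ∈ Finset.Icc 1 N, a n * PowerSeries.coeff (k + n - 1) (resolvent R S a N)
        + t * ∑ p ∈ Finset.HasAntidiagonal.antidiagonal k,
          PowerSeries.coeff p.1 (resolvent R S a N) * PowerSeries.coeff p.2 (resolvent R S a N) := by
  set w := resolvent R S a N with hw
  set Y := HahnSeries.ofPowerSeries ℤ K (uniformizer R S) with hY
  set Z : LaurentSeries K := HahnSeries.single (-1) 1 with hZ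
  set q : LaurentSeries K := HahnSeries.C R * Y with hq
  -- This plays the part of the inverse of the uniformizer, written without inversion.
  set p : LaurentSeries K := Z - HahnSeries.C S - q with hp
  set c : ℕ → K := fun j => pathCount R S 1 j
    - t * ∑ n ∈ Finset.Icc 1 N, a n * pathCount R S (n - 1) j with hc
  have hpq : p * q = HahnSeries.C R := by
    have := single_mul_uniformizer R S
    rw [← hY, ← hZ] at this
    rw [hp, hq]
    linear_combination HahnSeries.C R * this
  have hsum : HahnSeries.C S + p + q = Z := by rw [hp]; ring
  have hZpow : ∀ n ≤ N + 3, Z ^ n = HahnSeries.C (pathCount R S n 0)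
      + ∑ j ∈ Finset.range (N + 3), HahnSeries.C (pathCount R S n (j + 1))
        * (p ^ (j + 1) + q ^ (j + 1)) := by
    intro n hn
    rw [← hsum, pow_eq_sum_pathCount hpq n (N + 3) hn, map_pathCount]
    simp only [map_pathCount]
  -- This and the next fact are the only uses of the equations for `S` and `R`: no constant term,
  -- and linear term `t` times the uniformizer.
  have hc0 : c 0 = 0 := by
    simp only [hc]
    rw [← hS]
    simp [pathCount]
  have hc1 : R * c 1 = t := by
    simp only [hc]
    have : R * (t * ∑ n ∈ Finset.Icc 1 N, a n * pathCount R S (n - 1) 1)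
        = t * ∑ n ∈ Finset.Icc 1 N, a n * (R * pathCount R S (n - 1) 1) := by
      rw [mul_left_comm, Finset.mul_sum]
      congr 1
      exact Finset.sum_congr rfl fun n _ => by ring
    rw [mul_sub, this]
    have h1 : pathCount R S 1 1 = 1 := by simp [pathCount]
    rw [h1]
    linear_combination hR
  have hc2 : ∀ j, R ^ (j + 2) * c (j + 2) = - (t * pathSum R S a N (j + 2)) := by
    intro j
    simp only [hc, pathSum]
    rw [pathCount_eq_zero R S (show 1 < j + 2 by omega)]
    ring
  set u : LaurentSeries K := ∑ j ∈ Finset.range (N + 3), HahnSeries.C (c (j + 1)) * q ^ (j + 1)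
    with hu
  set u' : LaurentSeries K := ∑ j ∈ Finset.range (N + 3), HahnSeries.C (c (j + 1)) * p ^ (j + 1)
    with hu'
  have hf : Z - HahnSeries.C t * ∑ n ∈ Finset.Icc 1 N, HahnSeries.C (a n) * Z ^ (n - 1)
      = u + u' := by
    have h1 : ∑ n ∈ Finset.Icc 1 N, HahnSeries.C (a n) * Z ^ (n - 1)
        = HahnSeries.C (∑ n ∈ Finset.Icc 1 N, a n * pathCount R S (n - 1) 0)
          + ∑ j ∈ Finset.range (N + 3), HahnSeries.C (∑ n ∈ Finset.Icc 1 N,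
            a n * pathCount R S (n - 1) (j + 1)) * (p ^ (j + 1) + q ^ (j + 1)) := by
      simp only [map_sum, Finset.sum_mul]
      rw [Finset.sum_comm, ← Finset.sum_add_distrib]
      refine Finset.sum_congr rfl fun n hn => ?_
      rw [Finset.mem_Icc] at hn
      rw [hZpow (n - 1) (by omega), mul_add, map_mul, Finset.mul_sum]
      congr 1
      refine Finset.sum_congr rfl fun j _ => ?_
      rw [map_mul, mul_assoc]
    have h2 : Z = Z ^ 1 := (pow_one Z).symm
    rw [h1]
    nth_rw 1 [h2]
    rw [hZpow 1 (by omega), mul_add, ← map_mul, Finset.mul_sum (Finset.range (N + 3)),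
      add_sub_add_comm, ← map_sub,
      ← Finset.sum_sub_distrib]
    change HahnSeries.C (c 0) + _ = _
    rw [hc0, map_zero, zero_add, hu, hu', ← Finset.sum_add_distrib]
    refine Finset.sum_congr rfl fun j _ => ?_
    simp only [hc]
    rw [map_sub, map_mul]
    ring
  have huw : u = HahnSeries.C t * HahnSeries.ofPowerSeries ℤ K w := by
    rw [hw, resolvent, map_sub, map_sum, hu, Finset.sum_range_succ', mul_sub, Finset.mul_sum,
      add_comm, sub_eq_add_neg, ← Finset.sum_neg_distrib]
    congr 1
    · rw [zero_add, pow_one, hq, ← mul_assoc, ← map_mul, mul_comm (c 1), hc1]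
    · refine Finset.sum_congr rfl fun j _ => ?_
      rw [hq, mul_pow, ← mul_assoc, ← map_pow, ← map_mul, mul_comm (c _), hc2, map_mul,
        HahnSeries.ofPowerSeries_C, map_pow, map_neg, map_mul, hY]
      ring
  -- Symmetric polynomials in `p` and `q` are polynomials in `p + q = Z - S` and `p * q = R`. Power
  -- sums come from the Newton recursion, mixed terms by extracting factors `p * q`.
  have hsym : ∀ i j, NoPositivePart (q ^ i * p ^ j + q ^ j * p ^ i) := by
    have h0 : ∀ j, NoPositivePart (p ^ j + q ^ j) ∧ NoPositivePart (p ^ (j + 1) + q ^ (j + 1)) := by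
      have one : NoPositivePart (1 : LaurentSeries K) := fun k hk => by
        rw [HahnSeries.coeff_one, if_neg (by omega)]
      intro j
      induction j with
      | zero =>
        constructor
        · simpa using one.add one
        · have h : p ^ (0 + 1) + q ^ (0 + 1) = Z * 1 + HahnSeries.C (-S) * 1 := by
            rw [hp, map_neg]
            ring
          rw [h]
          exact one.single_mul.add (one.C_mul _)
      | succ j ih =>
        refine ⟨ih.2, ?_⟩
        have h : p ^ (j + 1 + 1) + q ^ (j + 1 + 1) = Z * (p ^ (j + 1) + q ^ (j + 1))
            + (HahnSeries.C (-S) * (p ^ (j + 1) + q ^ (j + 1))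
              + HahnSeries.C (-R) * (p ^ j + q ^ j)) := by
          rw [map_neg, map_neg, ← hpq, ← hsum]
          ring
        rw [h]
        exact ih.2.single_mul.add ((ih.2.C_mul _).add (ih.1.C_mul _))
    intro i
    induction i with
    | zero =>
      intro j
      simpa [pow_zero] using (h0 j).1
    | succ i ih =>
      intro j
      rcases j with _ | j
      · simpa [add_comm] using (h0 (i + 1)).1
      · have h : q ^ (i + 1) * p ^ (j + 1) + q ^ (j + 1) * p ^ (i + 1)
            = HahnSeries.C R * (q ^ i * p ^ j + q ^ j * p ^ i) := by
          rw [← hpq]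
          ring
        rw [h]
        exact (ih j).C_mul _
  have huu : NoPositivePart (u * u') := by
    -- Doubling the product symmetrises it term by term; the factor `2` is cancelled afterwards by
    -- characteristic zero.
    have h : u * u' + u * u' = ∑ i ∈ Finset.range (N + 3), ∑ j ∈ Finset.range (N + 3),
        HahnSeries.C (c (i + 1) * c (j + 1))
          * (q ^ (i + 1) * p ^ (j + 1) + q ^ (j + 1) * p ^ (i + 1)) := by
      have h1 : u * u' = ∑ i ∈ Finset.range (N + 3), ∑ j ∈ Finset.range (N + 3),
          HahnSeries.C (c (i + 1) * c (j + 1)) * (q ^ (i + 1) * p ^ (j + 1)) := by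
        rw [hu, hu', Finset.sum_mul_sum]
        refine Finset.sum_congr rfl fun i _ => Finset.sum_congr rfl fun j _ => ?_
        rw [map_mul]
        ring
      have h2 : u * u' = ∑ i ∈ Finset.range (N + 3), ∑ j ∈ Finset.range (N + 3),
          HahnSeries.C (c (i + 1) * c (j + 1)) * (q ^ (j + 1) * p ^ (i + 1)) := by
        rw [h1, Finset.sum_comm]
        refine Finset.sum_congr rfl fun i _ => Finset.sum_congr rfl fun j _ => ?_
        rw [mul_comm (c _)]
      nth_rw 1 [h1]
      rw [h2, ← Finset.sum_add_distrib]
      refine Finset.sum_congr rfl fun i _ => ?_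
      rw [← Finset.sum_add_distrib]
      refine Finset.sum_congr rfl fun j _ => ?_
      rw [mul_add]
    intro k hk
    have h1 : HahnSeries.coeff (u * u' + u * u') (k : ℤ) = 0 := by
      rw [h]
      exact NoPositivePart.sum (fun i _ => NoPositivePart.sum fun j _ => (hsym _ _).C_mul _) k hk
    rw [HahnSeries.coeff_add, ← two_mul] at h1
    exact (mul_eq_zero.1 h1).resolve_left two_ne_zero
  -- The product is `u * (f - u)` with `f = u + u'` and `u = t * w`; the common factor `t` is then
  -- cancelled.
  have huf : HahnSeries.C t * (Z * HahnSeries.ofPowerSeries ℤ K w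
      - HahnSeries.C t * ∑ n ∈ Finset.Icc 1 N, HahnSeries.C (a n) * (Z ^ (n - 1)
        * HahnSeries.ofPowerSeries ℤ K w)
      - HahnSeries.C t * HahnSeries.ofPowerSeries ℤ K (w * w)) = u * u' := by
    have h1 : ∑ n ∈ Finset.Icc 1 N, HahnSeries.C (a n) * (Z ^ (n - 1)
        * HahnSeries.ofPowerSeries ℤ K w) = (∑ n ∈ Finset.Icc 1 N, HahnSeries.C (a n) * Z ^ (n - 1))
          * HahnSeries.ofPowerSeries ℤ K w := by
      rw [Finset.sum_mul]
      exact Finset.sum_congr rfl fun n _ => by ring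
    have h2 : u' = (Z - HahnSeries.C t * ∑ n ∈ Finset.Icc 1 N, HahnSeries.C (a n) * Z ^ (n - 1))
        - u := by rw [hf]; ring
    rw [h2, huw, h1, map_mul]
    ring
  have key := huu k hk
  rw [← huf, HahnSeries.C_mul_eq_smul, HahnSeries.coeff_smul, smul_eq_mul] at key
  have key' := (mul_eq_zero.1 key).resolve_left ht
  have h1 := coeff_single_pow_mul w 1 k
  rw [pow_one] at h1
  rw [HahnSeries.coeff_sub, HahnSeries.coeff_sub, h1, HahnSeries.C_mul_eq_smul,
    HahnSeries.C_mul_eq_smul, HahnSeries.coeff_smul, HahnSeries.coeff_smul,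
    HahnSeries.ofPowerSeries_apply_coeff, HahnSeries.coeff_sum, PowerSeries.coeff_mul] at key'
  have h2 : ∀ n ∈ Finset.Icc 1 N, HahnSeries.coeff (HahnSeries.C (a n) * (Z ^ (n - 1)
      * HahnSeries.ofPowerSeries ℤ K w)) (k : ℤ) = a n * PowerSeries.coeff (k + n - 1) w := by
    intro n hn
    rw [Finset.mem_Icc] at hn
    rw [HahnSeries.C_mul_eq_smul, HahnSeries.coeff_smul, coeff_single_pow_mul, smul_eq_mul,
      Nat.add_sub_assoc hn.1]
  rw [Finset.sum_congr rfl h2, smul_eq_mul, smul_eq_mul] at key'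
  linear_combination key'

theorem uniformizer_eq_X_mul (R S : K) : ∃ f : PowerSeries K,
    uniformizer R S = PowerSeries.X * f ∧ PowerSeries.coeff 0 f = 1 ∧ PowerSeries.coeff 1 f = S ∧
      PowerSeries.coeff 2 f = S ^ 2 + R := by
  obtain ⟨f, hf⟩ : ∃ f, uniformizer R S = PowerSeries.X * f := ⟨_, uniformizer_eq R S⟩
  have h : ∀ n, PowerSeries.coeff n f = uniformizerCoeff R S (n + 1) := by
    intro n
    rw [← PowerSeries.coeff_succ_X_mul, ← hf, uniformizer, PowerSeries.coeff_mk]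
  have h1 : uniformizerCoeff R S 1 = 1 := by simp [uniformizerCoeff]
  have h2 : uniformizerCoeff R S 2 = S := by
    rw [uniformizerCoeff, h1, Fin.sum_univ_two]
    simp [uniformizerCoeff]
  refine ⟨f, hf, by rw [h, h1], by rw [h, h2], ?_⟩
  rw [h, uniformizerCoeff, h2, Fin.sum_univ_three]
  simp [h1, uniformizerCoeff]
  ring

theorem coeff_resolvent_zero : PowerSeries.coeff 0 (resolvent R S a N) = 0 := by
  obtain ⟨f, hf, -⟩ := uniformizer_eq_X_mul R S
  rw [resolvent, map_sub, map_sum, Finset.sum_eq_zero, hf, PowerSeries.coeff_zero_X_mul, sub_zero]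
  intro j _
  rw [PowerSeries.coeff_C_mul, hf, mul_pow, PowerSeries.coeff_X_pow_mul', if_neg (by omega),
    mul_zero]

theorem coeff_resolvent_one : PowerSeries.coeff 1 (resolvent R S a N) = 1 := by
  obtain ⟨f, hf, h0, -⟩ := uniformizer_eq_X_mul R S
  rw [resolvent, map_sub, map_sum, Finset.sum_eq_zero, hf, PowerSeries.coeff_succ_X_mul, h0,
    sub_zero]
  intro j _
  rw [PowerSeries.coeff_C_mul, hf, mul_pow, PowerSeries.coeff_X_pow_mul', if_neg (by omega),
    mul_zero]

/-- The uniformizer starts with `X`, so only its powers up to the cube matter; the range `N + 2`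
contains the square and the cube even for `N = 0`. -/
theorem coeff_resolvent_three : PowerSeries.coeff 3 (resolvent R S a N)
    = R + S ^ 2 - (2 * S * pathSum R S a N 2 + pathSum R S a N 3) := by
  obtain ⟨f, hf, h0, h1, h2⟩ := uniformizer_eq_X_mul R S
  have h3 : PowerSeries.coeff 1 (f ^ 2) = 2 * S := by
    rw [pow_two, PowerSeries.coeff_mul, Finset.Nat.sum_antidiagonal_eq_sum_range_succ_mk,
      Finset.sum_range_succ, Finset.sum_range_one]
    simp only [Nat.sub_self, Nat.sub_zero, h0, h1]
    ring
  have h4 : PowerSeries.coeff 0 (f ^ 3) = 1 := by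
    rw [PowerSeries.coeff_zero_eq_constantCoeff_apply] at h0 ⊢
    rw [map_pow, h0, one_pow]
  rw [resolvent, map_sub, map_sum, Finset.sum_range_succ', Finset.sum_range_succ',
    Finset.sum_eq_zero, hf]
  · simp only [PowerSeries.coeff_C_mul, mul_pow, PowerSeries.coeff_X_pow_mul']
    rw [PowerSeries.coeff_succ_X_mul, h2]
    norm_num [h3, h4]
    ring
  · intro j _
    rw [PowerSeries.coeff_C_mul, hf, mul_pow, PowerSeries.coeff_X_pow_mul', if_neg (by omega),
      mul_zero]

end LoopEquation

/-! ### Uniqueness of the solution modulo powers of `t`. -/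

section Expansion

variable {K : Type*} [CommRing K]

/-- A vertex carries at most the `2m` half-edges and the leg. -/
theorem mapCount_eq_zero (a : ℕ → K) {m l : ℕ} (h : 2 * m + 1 < l) : mapCount a m l = 0 := by
  induction m using Nat.strong_induction_on generalizing l with
  | _ m ih =>
    rcases m with _ | m
    · rw [mapCount, if_neg (by omega)]
    obtain ⟨k, rfl⟩ : ∃ k, l = k + 2 := ⟨l - 2, by omega⟩
    rw [mapCount_add_two, Finset.sum_eq_zero, Finset.sum_eq_zero, add_zero]
    · rintro ⟨i, j⟩ hij
      rw [Finset.HasAntidiagonal.mem_antidiagonal] at hij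
      dsimp only at hij ⊢
      refine Finset.sum_eq_zero fun c hc => ?_
      rw [Finset.mem_range] at hc
      rcases Nat.lt_or_ge (2 * c + 1) i with h1 | h1
      · rw [ih c (by omega) h1, zero_mul]
      · rw [ih (m - c) (by omega) (by omega), mul_zero]
    · intro n hn
      rw [Finset.mem_Icc] at hn
      rw [ih m (by omega) (by omega), mul_zero]

theorem dvd_mul_sub_sum (t : K) (f g : ℕ → K) (m : ℕ) :
    t ^ m ∣ (∑ i ∈ Finset.range m, t ^ i * f i) * (∑ i ∈ Finset.range m, t ^ i * g i)
      - ∑ i ∈ Finset.range m, t ^ i * ∑ j ∈ Finset.range (i + 1), f j * g (i - j) := by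
  have h1 : ∑ i ∈ Finset.range m, t ^ i * ∑ j ∈ Finset.range (i + 1), f j * g (i - j)
      = ∑ i ∈ Finset.range m, ∑ j ∈ Finset.range (m - i), t ^ (i + j) * (f i * g j) := by
    rw [← Finset.sum_range_diag_flip m fun i j => t ^ (i + j) * (f i * g j)]
    refine Finset.sum_congr rfl fun i _ => ?_
    rw [Finset.mul_sum]
    refine Finset.sum_congr rfl fun j hj => ?_
    rw [Finset.mem_range] at hj
    rw [show j + (i - j) = i by omega]
  rw [h1, Finset.sum_mul_sum, ← Finset.sum_sub_distrib]
  refine Finset.dvd_sum fun i hi => ?_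
  rw [Finset.mem_range] at hi
  rw [← Finset.sum_range_add_sum_Ico _ (show m - i ≤ m by omega)]
  have h2 : ∑ j ∈ Finset.range (m - i), t ^ i * f i * (t ^ j * g j)
      = ∑ j ∈ Finset.range (m - i), t ^ (i + j) * (f i * g j) :=
    Finset.sum_congr rfl fun j _ => by ring
  rw [h2, add_sub_cancel_left]
  refine Finset.dvd_sum fun j hj => ?_
  rw [Finset.mem_Ico] at hj
  have h3 : t ^ i * f i * (t ^ j * g j) = t ^ (i + j) * (f i * g j) := by ring
  rw [h3]
  exact (pow_dvd_pow t (by omega)).mul_right _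

/-- Both sides satisfy the same recursion, whose right side has a factor `t`: a congruence modulo `t
^ m` for all `l` improves to `t ^ (m + 1)`. Indices `0` and `1` are initial values. -/
theorem dvd_resolvent_sub [IsDomain K] [CharZero K] {R S t : K} {a : ℕ → K} {N : ℕ} (ht : t ≠ 0)
    (ha : ∀ n, N < n → a n = 0)
    (hR : R = t + t * ∑ n ∈ Finset.Icc 1 N, a n * (R * pathCount R S (n - 1) 1))
    (hS : S = t * ∑ n ∈ Finset.Icc 1 N, a n * pathCount R S (n - 1) 0) (m l : ℕ) :
    t ^ m ∣ PowerSeries.coeff l (resolvent R S a N)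
      - ∑ i ∈ Finset.range m, t ^ i * mapCount a i l := by
  set w := fun l => PowerSeries.coeff l (resolvent R S a N) with hw
  induction m generalizing l with
  | zero => simp
  | succ m ih =>
    have h0 : ∀ l, mapCount a 0 l = if l = 1 then 1 else 0 := fun l => by rw [mapCount]
    rcases l with _ | _ | k
    · rw [coeff_resolvent_zero, Finset.sum_eq_zero, sub_zero]
      · exact dvd_zero _
      · intro i _
        rcases i with _ | i <;> simp [mapCount]
    · rw [zero_add, coeff_resolvent_one, Finset.sum_range_succ', Finset.sum_eq_zero]
      · simp [mapCount]
      · intro i _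
        simp [mapCount]
    -- Both ranges are extended to their maximum: beyond `N` the weights vanish, beyond `2i + 1` the
    -- counts do.
    · have h1 : ∀ i, ∑ n ∈ Finset.Icc 1 (2 * i + 1), a n * mapCount a i (k + n)
          = ∑ n ∈ Finset.Icc 1 N, a n * mapCount a i (k + n) := by
        intro i
        rw [Finset.sum_subset (Finset.Icc_subset_Icc_right (le_max_left (2 * i + 1) N)),
          Finset.sum_subset (Finset.Icc_subset_Icc_right (le_max_right (2 * i + 1) N))]
        · intro n hn hn'
          rw [Finset.mem_Icc] at hn hn'
          rw [ha n (by omega), zero_mul]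
        · intro n hn hn'
          rw [Finset.mem_Icc] at hn hn'
          rw [mapCount_eq_zero a (by omega), mul_zero]
      rw [coeff_resolvent ht hR hS (by omega), Finset.sum_range_succ', h0, if_neg (by omega),
        mul_zero, add_zero]
      simp only [mapCount_add_two, h1]
      have h2 : ∑ i ∈ Finset.range m, t ^ (i + 1) *
          (∑ n ∈ Finset.Icc 1 N, a n * mapCount a i (k + n)
            + ∑ p ∈ Finset.HasAntidiagonal.antidiagonal (k + 1),
              ∑ j ∈ Finset.range (i + 1), mapCount a j p.1 * mapCount a (i - j) p.2)
          = t * (∑ n ∈ Finset.Icc 1 N, a n * ∑ i ∈ Finset.range m, t ^ i * mapCount a i (k + n)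
            + ∑ p ∈ Finset.HasAntidiagonal.antidiagonal (k + 1), ∑ i ∈ Finset.range m,
              t ^ i * ∑ j ∈ Finset.range (i + 1), mapCount a j p.1 * mapCount a (i - j) p.2) := by
        simp only [Finset.mul_sum (Finset.range m)]
        rw [Finset.sum_comm (s := Finset.Icc 1 N),
          Finset.sum_comm (s := Finset.HasAntidiagonal.antidiagonal (k + 1)),
          ← Finset.sum_add_distrib, Finset.mul_sum]
        refine Finset.sum_congr rfl fun i _ => ?_
        rw [← Finset.mul_sum, pow_succ', mul_assoc, mul_add, Finset.mul_sum (Finset.Icc 1 N)]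
        congr 3
        ext n
        ring
      rw [h2, ← mul_add, ← mul_sub, pow_succ']
      apply mul_dvd_mul_left
      rw [add_sub_add_comm, ← Finset.sum_sub_distrib, ← Finset.sum_sub_distrib]
      refine dvd_add (Finset.dvd_sum fun n hn => ?_) (Finset.dvd_sum fun p _ => ?_)
      · rw [← mul_sub, show k + 1 + n - 1 = k + n by omega]
        exact (ih _).mul_left _
      · have e1 := ih p.1
        have e2 := ih p.2
        have e3 := dvd_mul_sub_sum t (fun i => mapCount a i p.1) (fun i => mapCount a i p.2) m
        set u := ∑ i ∈ Finset.range m, t ^ i * mapCount a i p.1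
        set u' := ∑ i ∈ Finset.range m, t ^ i * mapCount a i p.2
        have e4 := dvd_add (dvd_add (e1.mul_right (w p.2)) (e2.mul_left u)) e3
        convert e4 using 1
        simp only [hw]
        ring

end Expansion

end PlanarCensus

namespace PlanarCensus

open scoped Nat

/-! ### Path counts as the factorial sums of the theorem. -/

section ExplicitSums

theorem pathCount_eq_sum_factorial (R S : Series) (n k : ℕ) :
    pathCount R S n k = ∑ i ∈ (Finset.range (n + 1)).filter (fun i => 2 * i + k ≤ n),
      const ((n ! : ℚ) / ((i ! : ℚ) * ((i + k)! : ℚ) * ((n - (2 * i + k))! : ℚ)))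
        * R ^ i * S ^ (n - (2 * i + k)) := by
  rw [pathCount_eq_sum R S n k n le_rfl, Finset.sum_filter]
  refine Finset.sum_congr rfl fun i _ => ?_
  split_ifs with h
  · rw [← map_natCast (MvPowerSeries.C (σ := Option ℕ+) (R := ℚ))]
    congr 3
    rw [Nat.cast_mul, Nat.cast_choose ℚ h, Nat.cast_choose ℚ (show i ≤ 2 * i + k by omega),
      show 2 * i + k - i = i + k by omega]
    have h1 : ((2 * i + k)! : ℚ) ≠ 0 := Nat.cast_ne_zero.2 (Nat.factorial_ne_zero _)
    field_simp
  · rw [Nat.choose_eq_zero_of_lt (by omega)]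
    simp

theorem sum_eq_pathCount_zero (R S : Series) (n : ℕ) (hn : 0 < n) :
    ∑ j ∈ Finset.Icc 0 ((n - 1) / 2),
      const (((n - 1)! : ℚ) / ((j ! : ℚ) ^ 2 * ((n - 2 * j - 1)! : ℚ)))
        * R ^ j * S ^ (n - 2 * j - 1) = pathCount R S (n - 1) 0 := by
  rw [pathCount_eq_sum_factorial]
  refine Finset.sum_congr ?_ fun j _ => ?_
  · ext j
    simp only [Finset.mem_Icc, Finset.mem_filter, Finset.mem_range]
    omega
  · rw [show n - 1 - (2 * j + 0) = n - 2 * j - 1 by omega, add_zero, pow_two]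

theorem sum_eq_mul_pathCount_one (R S : Series) (n : ℕ) (hn : 0 < n) :
    ∑ j ∈ Finset.Icc 1 (n / 2),
      const (((n - 1)! : ℚ) / ((j ! : ℚ) * ((j - 1)! : ℚ) * ((n - 2 * j)! : ℚ)))
        * R ^ j * S ^ (n - 2 * j) = R * pathCount R S (n - 1) 1 := by
  rw [pathCount_eq_sum_factorial, Finset.mul_sum]
  refine Finset.sum_nbij' (fun j => j - 1) (fun i => i + 1) ?_ ?_ ?_ ?_ ?_
  · intro j hj
    simp only [Finset.mem_Icc, Finset.mem_filter, Finset.mem_range] at hj ⊢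
    omega
  · intro j hj
    simp only [Finset.mem_Icc, Finset.mem_filter, Finset.mem_range] at hj ⊢
    omega
  · intro j hj
    simp only [Finset.mem_Icc] at hj
    omega
  · intro j _
    omega
  · intro j hj
    simp only [Finset.mem_Icc] at hj
    obtain ⟨i, rfl⟩ : ∃ i, j = i + 1 := ⟨j - 1, by omega⟩
    rw [Nat.add_sub_cancel, show n - 1 - (2 * i + 1) = n - 2 * (i + 1) by omega,
      mul_comm ((i + 1)! : ℚ), pow_succ]
    ring

/-- Over the common denominator the two path sums have numerators `2(n + 2 - 2j)` and `j - 2`, which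
add up to `2n - 3j + 2`. -/
theorem sum_eq_pathCount_two_add_three (R S : Series) (n : ℕ) (hn : 0 < n) :
    ∑ j ∈ Finset.Icc 2 ((n + 2) / 2),
      const (((2 * (n : ℚ) - 3 * (j : ℚ) + 2) * ((n - 1)! : ℚ)) /
          ((j ! : ℚ) * ((j - 2)! : ℚ) * ((n + 2 - 2 * j)! : ℚ)))
        * R ^ j * S ^ (n + 2 - 2 * j)
      = 2 * S * (R ^ 2 * pathCount R S (n - 1) 2) + R ^ 3 * pathCount R S (n - 1) 3 := by
  have h2 : 2 * S * (R ^ 2 * pathCount R S (n - 1) 2) = ∑ j ∈ Finset.Icc 2 ((n + 2) / 2),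
      const ((2 * ((n + 2 - 2 * j : ℕ) : ℚ) * ((n - 1)! : ℚ)) /
          ((j ! : ℚ) * ((j - 2)! : ℚ) * ((n + 2 - 2 * j)! : ℚ)))
        * R ^ j * S ^ (n + 2 - 2 * j) := by
    rw [pathCount_eq_sum_factorial, Finset.mul_sum, Finset.mul_sum]
    refine Finset.sum_of_injOn (fun i => i + 2) (fun a _ b _ h => by simpa using h) ?_ ?_ ?_
    · intro i hi
      simp only [Finset.coe_filter, Finset.mem_range, Set.mem_ofPred_eq, Finset.coe_Icc,
        Set.mem_Icc] at hi ⊢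
      omega
    · intro j hj hj'
      simp only [Finset.mem_Icc] at hj
      -- The one index not reached by the shift is where this factor of the numerator vanishes.
      have : n + 2 - 2 * j = 0 := by
        by_contra h
        apply hj'
        refine ⟨j - 2, ?_, by dsimp only; omega⟩
        simp only [Finset.coe_filter, Finset.mem_range, Set.mem_ofPred_eq]
        omega
      rw [this]
      simp
    · intro i hi
      simp only [Finset.mem_filter, Finset.mem_range] at hi
      obtain ⟨r, hr⟩ : ∃ r, n - 1 = 2 * i + 2 + r := ⟨n - 1 - (2 * i + 2), by omega⟩
      rw [show n - 1 - (2 * i + 2) = r by omega, show n + 2 - 2 * (i + 2) = r + 1 by omega,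
        Nat.add_sub_cancel, pow_succ S r, pow_add R]
      have h1 : 2 * ((r + 1 : ℕ) : ℚ) * ((n - 1)! : ℚ) / (((i + 2)! : ℚ) * (i ! : ℚ)
          * ((r + 1)! : ℚ)) = 2 * (((n - 1)! : ℚ) / ((i ! : ℚ) * ((i + 2)! : ℚ) * (r ! : ℚ))) := by
        have := Nat.cast_ne_zero (R := ℚ).2 (Nat.factorial_ne_zero i)
        have := Nat.cast_ne_zero (R := ℚ).2 (Nat.factorial_ne_zero (i + 2))
        have := Nat.cast_ne_zero (R := ℚ).2 (Nat.factorial_ne_zero r)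
        have : ((r : ℚ) + 1) ≠ 0 := by positivity
        rw [Nat.factorial_succ r]
        push_cast
        field_simp
      have h4 : ∀ x : ℚ, const (2 * x) = 2 * const x := fun x => by
        simp only [const, map_mul, map_ofNat]
      rw [h1, h4]
      ring
  have h3 : R ^ 3 * pathCount R S (n - 1) 3 = ∑ j ∈ Finset.Icc 2 ((n + 2) / 2),
      const ((((j - 2 : ℕ) : ℚ) * ((n - 1)! : ℚ)) /
          ((j ! : ℚ) * ((j - 2)! : ℚ) * ((n + 2 - 2 * j)! : ℚ)))
        * R ^ j * S ^ (n + 2 - 2 * j) := by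
    rw [pathCount_eq_sum_factorial, Finset.mul_sum]
    refine Finset.sum_of_injOn (fun i => i + 3) (fun a _ b _ h => by simpa using h) ?_ ?_ ?_
    · intro i hi
      simp only [Finset.coe_filter, Finset.mem_range, Set.mem_ofPred_eq, Finset.coe_Icc,
        Set.mem_Icc] at hi ⊢
      omega
    · intro j hj hj'
      simp only [Finset.mem_Icc] at hj
      have : j - 2 = 0 := by
        by_contra h
        apply hj'
        refine ⟨j - 3, ?_, by dsimp only; omega⟩
        simp only [Finset.coe_filter, Finset.mem_range, Set.mem_ofPred_eq]
        omega
      rw [this]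
      simp
    · intro i hi
      simp only [Finset.mem_filter, Finset.mem_range] at hi
      rw [show n + 2 - 2 * (i + 3) = n - 1 - (2 * i + 3) by omega,
        show i + 3 - 2 = i + 1 by omega, pow_add R]
      have h1 : ((i + 1 : ℕ) : ℚ) * ((n - 1)! : ℚ) / (((i + 3)! : ℚ) * ((i + 1)! : ℚ)
          * ((n - 1 - (2 * i + 3))! : ℚ)) = ((n - 1)! : ℚ) / ((i ! : ℚ) * ((i + 3)! : ℚ)
            * ((n - 1 - (2 * i + 3))! : ℚ)) := by
        have := Nat.cast_ne_zero (R := ℚ).2 (Nat.factorial_ne_zero i)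
        have := Nat.cast_ne_zero (R := ℚ).2 (Nat.factorial_ne_zero (i + 3))
        have := Nat.cast_ne_zero (R := ℚ).2 (Nat.factorial_ne_zero (n - 1 - (2 * i + 3)))
        have : ((i : ℚ) + 1) ≠ 0 := by positivity
        rw [Nat.factorial_succ i]
        push_cast
        field_simp
      rw [h1]
      ring
  rw [h2, h3, ← Finset.sum_add_distrib]
  refine Finset.sum_congr rfl fun j hj => ?_
  simp only [Finset.mem_Icc] at hj
  have e : 2 * ((n + 2 - 2 * j : ℕ) : ℚ) + ((j - 2 : ℕ) : ℚ) = 2 * (n : ℚ) - 3 * (j : ℚ) + 2 := by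
    rw [Nat.cast_sub (by omega), Nat.cast_sub (by omega)]
    push_cast
    ring
  rw [← add_mul, ← add_mul, ← map_add, ← add_div, ← add_mul, e]

end ExplicitSums

/-! ### Discarding the variables of large index. -/

section Truncation

/-- The terms that contain no `vₙ` with `n > N`. -/
noncomputable def truncation (N : ℕ) (F : Series) : Series := fun d =>
  open scoped Classical in
  if ∀ n : ℕ+, d (some n) ≠ 0 → (n : ℕ) ≤ N then MvPowerSeries.coeff d F else 0

theorem coeff_truncation_of_le {N : ℕ} (F : Series) {d : Option ℕ+ →₀ ℕ}
    (h : ∀ n : ℕ+, d (some n) ≠ 0 → (n : ℕ) ≤ N) :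
    MvPowerSeries.coeff d (truncation N F) = MvPowerSeries.coeff d F := by
  classical
  exact if_pos h

theorem coeff_truncation_of_lt {N : ℕ} (F : Series) {d : Option ℕ+ →₀ ℕ} {n : ℕ+}
    (h : d (some n) ≠ 0) (hN : N < n) : MvPowerSeries.coeff d (truncation N F) = 0 := by
  classical
  exact if_neg fun h1 => by have := h1 n h; omega

/-- Setting `vₙ = 0` for `n > N`. -/
noncomputable def truncate (N : ℕ) : Series →+* Series where
  toFun := truncation N
  map_zero' := by
    ext d
    by_cases h : ∀ n : ℕ+, d (some n) ≠ 0 → (n : ℕ) ≤ N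
    · exact coeff_truncation_of_le _ h
    · push Not at h
      obtain ⟨n, hn, hN⟩ := h
      rw [coeff_truncation_of_lt _ hn hN, map_zero]
  map_one' := by
    classical
    ext d
    by_cases h : ∀ n : ℕ+, d (some n) ≠ 0 → (n : ℕ) ≤ N
    · exact coeff_truncation_of_le _ h
    · push Not at h
      obtain ⟨n, hn, hN⟩ := h
      rw [coeff_truncation_of_lt _ hn hN, MvPowerSeries.coeff_one, if_neg]
      rintro rfl
      exact hn rfl
  map_add' F G := by
    ext d
    rw [map_add]
    by_cases h : ∀ n : ℕ+, d (some n) ≠ 0 → (n : ℕ) ≤ N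
    · simp only [coeff_truncation_of_le _ h, map_add]
    · push Not at h
      obtain ⟨n, hn, hN⟩ := h
      simp only [coeff_truncation_of_lt _ hn hN, add_zero]
  map_mul' F G := by
    classical
    ext d
    rw [MvPowerSeries.coeff_mul]
    by_cases h : ∀ n : ℕ+, d (some n) ≠ 0 → (n : ℕ) ≤ N
    · rw [coeff_truncation_of_le _ h, MvPowerSeries.coeff_mul]
      refine Finset.sum_congr rfl fun p hp => ?_
      rw [Finset.HasAntidiagonal.mem_antidiagonal] at hp
      rw [coeff_truncation_of_le, coeff_truncation_of_le]
      · intro n hn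
        apply h
        rw [← hp, Finsupp.add_apply]
        omega
      · intro n hn
        apply h
        rw [← hp, Finsupp.add_apply]
        omega
    · push Not at h
      obtain ⟨n, hn, hN⟩ := h
      rw [coeff_truncation_of_lt _ hn hN, Finset.sum_eq_zero]
      intro p hp
      rw [Finset.HasAntidiagonal.mem_antidiagonal] at hp
      rw [← hp, Finsupp.add_apply] at hn
      by_cases h1 : p.1 (some n) = 0
      · rw [coeff_truncation_of_lt G (d := p.2) (n := n) (by omega) hN, mul_zero]
      · rw [coeff_truncation_of_lt F h1 hN, zero_mul]

variable {N : ℕ}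

theorem coeff_truncate_of_le (F : Series) {d : Option ℕ+ →₀ ℕ}
    (h : ∀ n : ℕ+, d (some n) ≠ 0 → (n : ℕ) ≤ N) :
    MvPowerSeries.coeff d (truncate N F) = MvPowerSeries.coeff d F :=
  coeff_truncation_of_le F h

theorem coeff_truncate_of_lt (F : Series) {d : Option ℕ+ →₀ ℕ} {n : ℕ+} (h : d (some n) ≠ 0)
    (hN : N < n) : MvPowerSeries.coeff d (truncate N F) = 0 :=
  coeff_truncation_of_lt F h hN

theorem truncate_t : truncate N t = t := by
  ext d
  by_cases h : ∀ n : ℕ+, d (some n) ≠ 0 → (n : ℕ) ≤ N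
  · exact coeff_truncate_of_le t h
  · push Not at h
    obtain ⟨n, hn, hN⟩ := h
    rw [coeff_truncate_of_lt t hn hN, t, MvPowerSeries.coeff_X, if_neg]
    rintro rfl
    simp at hn

theorem truncate_v_mul_of_lt {n : ℕ+} (hn : N < n) (F : Series) : truncate N (v n * F) = 0 := by
  classical
  ext d
  rw [map_zero]
  by_cases h : ∀ n : ℕ+, d (some n) ≠ 0 → (n : ℕ) ≤ N
  · rw [coeff_truncate_of_le _ h, v, MvPowerSeries.X, MvPowerSeries.coeff_monomial_mul, if_neg]
    intro hle
    have h1 := hle (some n)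
    have h2 := h n (by rw [Finsupp.single_eq_same] at h1; omega)
    omega
  · push Not at h
    obtain ⟨k, hk, hN⟩ := h
    exact coeff_truncate_of_lt _ hk hN

theorem truncate_v_of_lt {n : ℕ+} (hn : N < n) : truncate N (v n) = 0 := by
  have := truncate_v_mul_of_lt hn 1
  rwa [mul_one] at this

theorem coeff_vSum (A : ℕ+ → Series) (d : Option ℕ+ →₀ ℕ) :
    MvPowerSeries.coeff d (vSum A) = ∑ᶠ n : ℕ+, MvPowerSeries.coeff d (v n * A n) := rfl

/-- The weights of the truncated series. -/
noncomputable def truncatedWeight (N : ℕ) (n : ℕ) : Series := truncate N (extendOne v n)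

theorem truncatedWeight_eq_zero {n : ℕ} (hn : N < n) : truncatedWeight N n = 0 := by
  obtain ⟨k, rfl⟩ : ∃ k : ℕ+, n = k := ⟨⟨n, by omega⟩, rfl⟩
  rw [truncatedWeight, extendOne_pnat, truncate_v_of_lt hn]

/-- After truncation only finitely many weights remain, so the formal sum becomes a finite sum, as
the algebraic part of the proof requires. -/
theorem truncate_vSum (A : ℕ → Series) :
    truncate N (vSum fun n => A n)
      = ∑ n ∈ Finset.Icc 1 N, truncatedWeight N n * truncate N (A n) := by
  have h1 : ∀ n : ℕ+, truncate N (v n * A n) = truncatedWeight N n * truncate N (A n) := by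
    intro n
    rw [truncatedWeight, extendOne_pnat, map_mul]
  ext d
  rw [map_sum]
  have h3 : ∀ B : ℕ → ℚ, (∀ n, N < n → B n = 0) → ∑ᶠ n : ℕ+, B n = ∑ n ∈ Finset.Icc 1 N, B n := by
    intro B hB
    have hinj : Set.InjOn (fun n : ℕ+ => (n : ℕ))
        ((fun n : ℕ+ => (n : ℕ)) ⁻¹' (Finset.Icc 1 N : Set ℕ)) := PNat.coe_injective.injOn
    rw [finsum_eq_sum_of_support_subset (s := (Finset.Icc 1 N).preimage (fun n : ℕ+ => (n : ℕ)) hinj)]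
    · refine Finset.sum_preimage _ _ hinj _ fun n hn hn' => ?_
      exact absurd ⟨⟨n, by rw [Finset.mem_Icc] at hn; omega⟩, rfl⟩ hn'
    · intro n hn
      rw [Finset.mem_coe, Finset.mem_preimage, Finset.mem_Icc]
      refine ⟨n.pos, ?_⟩
      by_contra h
      exact hn (hB n (by omega))
  by_cases h : ∀ n : ℕ+, d (some n) ≠ 0 → (n : ℕ) ≤ N
  · rw [coeff_truncate_of_le _ h, coeff_vSum, ← h3]
    · refine finsum_congr fun n => ?_
      rw [← h1, coeff_truncate_of_le _ h]
    · intro n hn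
      rw [truncatedWeight_eq_zero hn, zero_mul, map_zero]
  · push Not at h
    obtain ⟨k, hk, hN⟩ := h
    rw [coeff_truncate_of_lt _ hk hN, Finset.sum_eq_zero]
    intro n hn
    rw [Finset.mem_Icc] at hn
    rw [truncatedWeight, ← map_mul, coeff_truncate_of_lt _ hk hN]

end Truncation

end PlanarCensus

namespace PlanarCensus

/-! ### Existence and uniqueness of the pair of series. -/

section FixedPoint

theorem t_pow_dvd_iff {m : ℕ} {F : Series} :
    t ^ m ∣ F ↔ ∀ d : Option ℕ+ →₀ ℕ, d none < m → MvPowerSeries.coeff d F = 0 :=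
  MvPowerSeries.X_pow_dvd_iff

theorem t_ne_zero : t ≠ 0 := fun h => by
  have := congrArg (MvPowerSeries.coeff (Finsupp.single none 1)) h
  rw [t, MvPowerSeries.coeff_index_single_self_X, map_zero] at this
  exact one_ne_zero this

/-- Congruence modulo `t ^ m` of pairs of series. -/
def Congruent (m : ℕ) (p q : Series × Series) : Prop := t ^ m ∣ p.1 - q.1 ∧ t ^ m ∣ p.2 - q.2

theorem Congruent.symm {m : ℕ} {p q : Series × Series} (h : Congruent m p q) : Congruent m q p :=
  ⟨(dvd_sub_comm).1 h.1, (dvd_sub_comm).1 h.2⟩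

theorem Congruent.trans {m : ℕ} {p q r : Series × Series} (h : Congruent m p q)
    (h' : Congruent m q r) : Congruent m p r :=
  ⟨by simpa using dvd_add h.1 h'.1, by simpa using dvd_add h.2 h'.2⟩

theorem Congruent.of_le {m k : ℕ} (hk : k ≤ m) {p q : Series × Series} (h : Congruent m p q) :
    Congruent k p q :=
  ⟨(pow_dvd_pow t hk).trans h.1, (pow_dvd_pow t hk).trans h.2⟩

theorem eq_of_forall_t_pow_dvd {F G : Series} (h : ∀ m, t ^ m ∣ F - G) : F = G := by
  ext d
  have := t_pow_dvd_iff.1 (h (d none + 1)) d (Nat.lt_succ_self _)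
  rwa [map_sub, sub_eq_zero] at this

theorem eq_of_forall_congruent {p q : Series × Series} (h : ∀ m, Congruent m p q) : p = q :=
  Prod.ext (eq_of_forall_t_pow_dvd fun m => (h m).1) (eq_of_forall_t_pow_dvd fun m => (h m).2)

/-- The coefficient at `d` is stationary from index `d none + 1` on; its final value defines the
limit. -/
theorem exists_t_adic_limit (F : ℕ → Series) (h : ∀ m k, m ≤ k → t ^ m ∣ F k - F m) :
    ∃ G : Series, ∀ m, t ^ m ∣ G - F m := by
  let G : Series := fun d => MvPowerSeries.coeff d (F (d none + 1))
  have hG : ∀ d, MvPowerSeries.coeff d G = MvPowerSeries.coeff d (F (d none + 1)) := fun _ => rfl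
  refine ⟨G, fun m => t_pow_dvd_iff.2 fun d hd => ?_⟩
  have := t_pow_dvd_iff.1 (h (d none + 1) m hd) d (Nat.lt_succ_self _)
  rw [map_sub, sub_eq_zero] at this
  rw [map_sub, hG, this, sub_self]

/-- Banach's argument in the `t`-adic topology: iterates from any two starting points agree modulo
`t ^ m` after `m` steps. -/
theorem existsUnique_fixedPoint (Φ : Series × Series → Series × Series)
    (h : ∀ m p q, Congruent m p q → Congruent (m + 1) (Φ p) (Φ q)) : ∃! p, Φ p = p := by
  have h0 : ∀ p q, Congruent 0 p q := fun p q => by simp [Congruent]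
  have hn : ∀ m p q, Congruent m (Φ^[m] p) (Φ^[m] q) := by
    intro m p q
    induction m with
    | zero => exact h0 _ _
    | succ m ih =>
      rw [Function.iterate_succ_apply', Function.iterate_succ_apply']
      exact h _ _ _ ih
  have hc : ∀ m k, m ≤ k → Congruent m (Φ^[k] 0) (Φ^[m] 0) := by
    intro m k hk
    obtain ⟨j, rfl⟩ := Nat.exists_eq_add_of_le hk
    rw [Function.iterate_add_apply]
    exact hn _ _ _
  obtain ⟨R, hR⟩ := exists_t_adic_limit (fun m => (Φ^[m] 0).1) fun m k hk => (hc m k hk).1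
  obtain ⟨S, hS⟩ := exists_t_adic_limit (fun m => (Φ^[m] 0).2) fun m k hk => (hc m k hk).2
  have hp : ∀ m, Congruent m (R, S) (Φ^[m] 0) := fun m => ⟨hR m, hS m⟩
  refine ⟨(R, S), eq_of_forall_congruent fun m => ?_, fun q hq => eq_of_forall_congruent fun m => ?_⟩
  · have h1 := h m _ _ (hp m)
    rw [← Function.iterate_succ_apply' Φ] at h1
    exact (h1.trans (hp (m + 1)).symm).of_le (Nat.le_succ m)
  · have h1 := hn m q 0
    rw [Function.iterate_fixed hq] at h1
    exact h1.trans (hp m).symm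

theorem t_pow_dvd_vSum_sub {m : ℕ} {A B : ℕ+ → Series} (h : ∀ n, t ^ m ∣ A n - B n) :
    t ^ m ∣ vSum A - vSum B := by
  refine t_pow_dvd_iff.2 fun d hd => ?_
  rw [map_sub, sub_eq_zero, coeff_vSum, coeff_vSum]
  refine finsum_congr fun n => ?_
  have := t_pow_dvd_iff.1 ((h n).mul_left (v n)) d hd
  rwa [mul_sub, map_sub, sub_eq_zero] at this

theorem dvd_sub_iff_mk_eq {K : Type*} [CommRing K] {x a b : K} :
    x ∣ a - b ↔ Ideal.Quotient.mk (Ideal.span {x}) a = Ideal.Quotient.mk (Ideal.span {x}) b := by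
  rw [Ideal.Quotient.eq, Ideal.mem_span_singleton]

theorem dvd_pathCount_sub {K : Type*} [CommRing K] {x R R' S S' : K} (hR : x ∣ R - R')
    (hS : x ∣ S - S') (n k : ℕ) : x ∣ pathCount R S n k - pathCount R' S' n k := by
  rw [dvd_sub_iff_mk_eq] at hR hS ⊢
  rw [map_pathCount, map_pathCount, hR, hS]

theorem isSolution_iff (R S : Series) : IsSolution R S ↔
    R = t + t * vSum (fun n => R * pathCount R S (n - 1) 1) ∧
    S = t * vSum (fun n => pathCount R S (n - 1) 0) := by
  rw [IsSolution]
  simp only [sum_eq_mul_pathCount_one R S _ (PNat.pos _),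
    sum_eq_pathCount_zero R S _ (PNat.pos _)]

/-- The explicit factor `t` in both equations makes the map a contraction. -/
theorem existsUnique_isSolution : ∃! p : Series × Series, IsSolution p.1 p.2 := by
  have h := existsUnique_fixedPoint (fun p =>
    (t + t * vSum (fun n => p.1 * pathCount p.1 p.2 (n - 1) 1),
      t * vSum (fun n => pathCount p.1 p.2 (n - 1) 0))) ?_
  · convert h using 3 with p
    rw [isSolution_iff, Prod.ext_iff]
    exact and_congr eq_comm eq_comm
  · rintro m ⟨R, S⟩ ⟨R', S'⟩ ⟨hR, hS⟩
    dsimp only at hR hS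
    constructor
    · dsimp only
      rw [add_sub_add_left_eq_sub, ← mul_sub, pow_succ']
      refine mul_dvd_mul_left t (t_pow_dvd_vSum_sub fun n => ?_)
      have h1 := dvd_pathCount_sub hR hS (n - 1) 1
      rw [dvd_sub_iff_mk_eq] at hR h1 ⊢
      rw [map_mul, map_mul, hR, h1]
    · dsimp only
      rw [← mul_sub, pow_succ']
      exact mul_dvd_mul_left t (t_pow_dvd_vSum_sub fun n => dvd_pathCount_sub hR hS _ _)

theorem vanishesAtZero_t_mul (F : Series) : VanishesAtZero (t * F) := fun d hd =>
  (t_pow_dvd_iff (m := 1)).1 (by rw [pow_one]; exact dvd_mul_right t F) d (by omega)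

theorem vanishesAtZero_of_isSolution {R S : Series} (h : IsSolution R S) :
    VanishesAtZero R ∧ VanishesAtZero S := by
  rw [isSolution_iff] at h
  refine ⟨?_, ?_⟩
  · rw [h.1, ← mul_one_add]
    exact vanishesAtZero_t_mul _
  · rw [h.2]
    exact vanishesAtZero_t_mul _

end FixedPoint

/-! ### The formula for the generating function. -/

section GeneratingFunction

open MvPolynomial (X)

theorem coeff_t_pow_mul (i : ℕ) (F : Series) (d : Option ℕ+ →₀ ℕ) :
    MvPowerSeries.coeff d (t ^ i * F)
      = if i ≤ d none then MvPowerSeries.coeff (d - Finsupp.single none i) F else 0 := by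
  rw [t, MvPowerSeries.X_pow_eq, MvPowerSeries.coeff_monomial_mul, one_mul]
  simp only [Finsupp.single_le_iff]

theorem some_sub_single_none (d : Option ℕ+ →₀ ℕ) (i : ℕ) :
    (d - Finsupp.single none i).some = d.some := by
  ext n
  simp

theorem coeff_t_pow_mul_mapCount (i l : ℕ) (d : Option ℕ+ →₀ ℕ) :
    MvPowerSeries.coeff d (t ^ i * mapCount (extendOne v) i l)
      = if i = d none then MvPolynomial.coeff d.some
          (mapCount (extendOne (X : ℕ+ → MvPolynomial ℕ+ ℚ)) i l) else 0 := by
  have h : mapCount (extendOne v) i l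
      = (MvPolynomial.aeval v (mapCount (extendOne (X : ℕ+ → MvPolynomial ℕ+ ℚ)) i l) : Series) := by
    have := map_mapCount (MvPolynomial.aeval (R := ℚ) v : MvPolynomial ℕ+ ℚ →ₐ[ℚ] Series).toRingHom
      (extendOne X) i l
    simp only [map_extendOne] at this
    rw [AlgHom.toRingHom_eq_coe, AlgHom.coe_toRingHom] at this
    rw [this]
    simp
  rw [coeff_t_pow_mul, h, coeff_aeval_v, some_sub_single_none]
  have h1 : (d - Finsupp.single none i : Option ℕ+ →₀ ℕ) none = d none - i := by simp
  rw [h1]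
  split_ifs <;> first | rfl | omega

theorem coeff_t_mul_E₀ (d : Option ℕ+ →₀ ℕ) : MvPowerSeries.coeff d (t * E₀)
    = MvPolynomial.coeff d.some (mapCount (extendOne (X : ℕ+ → MvPolynomial ℕ+ ℚ)) (d none) 3)
      - MvPowerSeries.coeff d t := by
  classical
  have h := coeff_t_pow_mul 1 E₀ d
  rw [pow_one] at h
  rw [h, t, MvPowerSeries.coeff_X]
  split_ifs with h1 h2 h2
  · rw [coeff_E₀, some_sub_single_none, h2]
    simp
  · rw [coeff_E₀, some_sub_single_none]
    have h3 : (d - Finsupp.single none 1 : Option ℕ+ →₀ ℕ) none = d none - 1 := by simp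
    rw [h3, Nat.sub_add_cancel h1, MvPolynomial.coeff_sub]
    congr 1
    -- The correction at zero edges contributes only to the monomial `t` itself, excluded in this
    -- branch.
    split_ifs with h4
    · rw [MvPolynomial.coeff_one, if_neg]
      intro h5
      apply h2
      ext o
      rcases o with _ | n
      · rw [Finsupp.single_eq_same]
        omega
      · have := DFunLike.congr_fun h5 n
        rw [Finsupp.zero_apply, Finsupp.some_apply] at this
        rw [← this]
        simp
    · rfl
  · rw [h2] at h1
    simp at h1
  · rw [mapCount_eq_zero _ (by omega)]
    simp

/-- The comparison is made one coefficient at a time, so that finitely many weights suffice and the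
loop equation applies to the truncated series. -/
theorem t_mul_E₀_eq {R S : Series} (h : IsSolution R S) :
    t * E₀ = R + S ^ 2 - vSum (fun n => 2 * S * (R ^ 2 * pathCount R S (n - 1) 2)
      + R ^ 3 * pathCount R S (n - 1) 3) - t := by
  rw [isSolution_iff] at h
  ext d
  -- Truncating at the largest index occurring in `d` leaves the coefficient at `d` unchanged.
  obtain ⟨N, hN⟩ : ∃ N, ∀ n : ℕ+, d (some n) ≠ 0 → (n : ℕ) ≤ N := by
    refine ⟨d.support.sup fun o => o.elim 0 fun n : ℕ+ => (n : ℕ), fun n hn => ?_⟩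
    exact Finset.le_sup (f := fun o : Option ℕ+ => o.elim 0 fun n : ℕ+ => (n : ℕ))
      (Finsupp.mem_support_iff.2 hn)
  have hR := congrArg (truncate N) h.1
  have hS := congrArg (truncate N) h.2
  rw [map_add, map_mul, truncate_t, truncate_vSum fun n => R * pathCount R S (n - 1) 1] at hR
  rw [map_mul, truncate_t, truncate_vSum fun n => pathCount R S (n - 1) 0] at hS
  simp only [map_mul, map_pathCount] at hR hS
  have : IsDomain Series := NoZeroDivisors.to_isDomain _
  have : CharZero Series := algebraRat.charZero _
  have key := dvd_resolvent_sub t_ne_zero (fun n => truncatedWeight_eq_zero) hR hS (d none + 1) 3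
  have key' := t_pow_dvd_iff.1 key d (Nat.lt_succ_self _)
  rw [map_sub, sub_eq_zero, map_sum] at key'
  have h1 : ∀ i, MvPowerSeries.coeff d (t ^ i * mapCount (truncatedWeight N) i 3)
      = if i = d none then MvPolynomial.coeff d.some
          (mapCount (extendOne (X : ℕ+ → MvPolynomial ℕ+ ℚ)) i 3) else 0 := by
    intro i
    rw [← coeff_t_pow_mul_mapCount, ← coeff_truncate_of_le (t ^ i * mapCount (extendOne v) i 3) hN,
      map_mul (truncate N), map_pow (truncate N), truncate_t, map_mapCount]
    rfl
  simp only [h1] at key'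
  rw [Finset.sum_ite_eq', if_pos (Finset.mem_range.2 (Nat.lt_succ_self _)),
    coeff_resolvent_three] at key'
  rw [coeff_t_mul_E₀, ← key', map_sub _ _ t]
  congr 1
  rw [← coeff_truncate_of_le (R + S ^ 2 - _) hN, map_sub (truncate N), map_add (truncate N),
    map_pow (truncate N),
    truncate_vSum fun n => 2 * S * (R ^ 2 * pathCount R S (n - 1) 2)
      + R ^ 3 * pathCount R S (n - 1) 3]
  congr 2
  simp only [map_add, map_mul, map_pow, map_pathCount, map_ofNat, pathSum]
  rw [Finset.mul_sum, Finset.mul_sum, Finset.mul_sum, ← Finset.sum_add_distrib]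
  exact Finset.sum_congr rfl fun n _ => by ring

end GeneratingFunction

end PlanarCensus

open PlanarCensus in
open scoped Nat in
/-- There is exactly one solution `(R, S)`; it vanishes at `t = 0`, and it gives `E⁽⁰⁾`. The
division by `t` in the formula for `E⁽⁰⁾` is written as a multiplication of the other side
by `t`, which is not a zero divisor in the ring of formal power series. -/
theorem mainTheorem3 :
    (∃! p : Series × Series, IsSolution p.1 p.2) ∧
    ∀ R S : Series, IsSolution R S →
      VanishesAtZero R ∧ VanishesAtZero S ∧
      t * E₀ = R + S ^ 2
        - vSum (fun n => ∑ j ∈ Finset.Icc 2 (((n : ℕ) + 2) / 2),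
            const (((2 * (n : ℚ) - 3 * (j : ℚ) + 2) * (((n : ℕ) - 1)! : ℚ)) /
                ((j ! : ℚ) * ((j - 2)! : ℚ) * (((n : ℕ) + 2 - 2 * j)! : ℚ)))
              * R ^ j * S ^ ((n : ℕ) + 2 - 2 * j))
        - t := by
  refine ⟨existsUnique_isSolution, fun R S h => ?_⟩
  obtain ⟨h1, h2⟩ := vanishesAtZero_of_isSolution h
  refine ⟨h1, h2, ?_⟩
  rw [t_mul_E₀_eq h]
  congr 3
  funext n
  exact (sum_eq_pathCount_two_add_three R S n n.pos).symm
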